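/- **Setting.** Let $q_->q_+>0$, and let $q(x,t)\in\mathbb R$ be, for $t$ in an open set $T$ of times, a classical solution ($C^3$ in $x$) of the defocusing mKdV equation $q_t-6q^2q_x+q_{xxx}=0$ with $q\to q_\pm$ as $x\to\pm\infty$, such that for every $t\in T$ one has $(1+|x|)(q-q_\pm)\in L^1(\mathbb R_\pm)$ and $q_x,q_{xx}\in L^1(\mathbb R)$. Fix $t\in T$; it is suppressed below. Put $\sigma_3=\mathrm{diag}(1,-1)$, $Q=\begin{pmatrix}0&q\\q&0\end{pmatrix}$, $Q_\pm=\begin{pmatrix}0&q_\pm\\q_\pm&0\end{pmatrix}$, $\Sigma_\pm=(-\infty,-q_\pm]\cup[q_\pm,\infty)$ and $\Sigma_0=[-q_-,-q_+]\cup[q_+,q_-]$. Let $\lambda_\pm(k)$ be the square root of $k^2-q_\pm^2$ that is analytic in $\mathbb C\setminus\Sigma_\pm$ with $\operatorname{Im}\lambda_\pm>0$, and on $\Sigma_\pm$ equals its boundary value from above, $\lambda_\pm(k)=\operatorname{sgn}(k)\sqrt{k^2-q_\pm^2}$. Let $E_\pm=I+\frac{i}{k-\lambda_\pm}\sigma_3Q_\pm$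 and $\gamma_\pm=\det E_\pm$. The Jost solutions $\phi_\pm$ solve $\phi_x=(ik\sigma_3+Q)\phi$, and $\mu_\pm=\phi_\pm e^{i\lambda_\pm x\sigma_3}\to E_\pm$ as $x\to\pm\infty$ (columnwise, for those columns and $k$ for which they exist). The scattering coefficients are $$s_{11}=\tfrac{\mathrm{Wr}(\phi_{-,1},\phi_{+,2})}{\gamma_+},\quad s_{12}=\tfrac{\mathrm{Wr}(\phi_{-,2},\phi_{+,2})}{\gamma_+},\quad s_{21}=\tfrac{\mathrm{Wr}(\phi_{+,1},\phi_{-,1})}{\gamma_+},\quad s_{22}=\tfrac{\mathrm{Wr}(\phi_{+,1},\phi_{-,2})}{\gamma_+},$$ and $\rho=s_{21}/s_{11}$, $\tilde\rho=s_{12}/s_{22}$. Set $$M(x,k)=\Big(\frac{\mu_{-,1}}{s_{11}},\ \mu_{+,2}\Big),\qquad N=ME_+^{-1},$$ and let the superscripts $+$ and $-$ denote boundary values on the real line from above and from below. Define $$V_0=\begin{pmatrix}1-(1-\rho\tilde\rho)e^{i(\lambda_--\lambda_+)x}&\tilde\rho e^{-2i\lambda_+x}\\-\rho e^{2i\lambda_-x}&1-e^{i(\lambda_--\lambda_+)x}\end{pmatrix}\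 (k\in\Sigma_-),\qquad V_0=\begin{pmatrix}1&\frac1\rho e^{-2i\lambda_+x}\\-\rho&1-e^{-i(\lambda_++\lambda_-)x}\end{pmatrix}\ (k\in\Sigma_0).$$ **Assumptions on the spectrum.** There are no spectral singularities, i.e. $\mathrm{Wr}(\phi_{-,1},\phi_{+,2})\ne0$ on $\Sigma_+$; and the zeros of $s_{11}$ in $(-q_+,q_+)$ are finitely many distinct points $k_1,\dots,k_J$ (possibly $J=0$), all simple. **Statement.** There are constants $b_j$ (depending on $t$ only) with $\phi_{-,1}(x,k_j)=b_j\,\phi_{+,2}(x,k_j)$ for all $x$. Put $C_j=b_j/s_{11}'(k_j)$ and $\lambda_{\pm,j}=\lambda_\pm(k_j)$. Then for every $x\in\mathbb R$: 1. $M$ is analytic in $\mathbb C\setminus(\Sigma_+\cup\{k_1,\dots,k_J\})$. On the interior of $\Sigma_+$ the boundary values $M^\pm$ exist and $$M^+=M^-(E_+-I)(I-V_0).$$ At $k_j$ it has $\operatorname{Res}_{k=k_j}M=\lim_{k\to k_j}(k-k_j)M(x,k)=\big(C_je^{i(\lambda_{+,j}+\lambda_{-,j})x}M_2(x,k_j),\,0\big)$,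 where $M_2$ is the second column of $M$. 2. $N(x,k)=I+O(1/k)$ as $k\to\infty$, $k\in\mathbb C\setminus\Sigma_+$. On the interior of $\Sigma_+$ the boundary values $N^\pm$ and $E_+^-$ exist and $N^+=N^-\tilde V$ with $\tilde V=E_+^-(E_+-I)(I-V_0)E_+^{-1}$. 3. For $k\in\mathbb C\setminus\Sigma_+$, $k\ne k_1,\dots,k_J$, with absolutely convergent integrals, $$N(x,k)=I+\sum_{j=1}^J\frac{\operatorname{Res}_{k_j}M\;E_+^{-1}(k_j)}{k-k_j}-\frac1{2\pi i}\int_{\Sigma_+}\frac{[N^-(I-\tilde V)](x,\zeta)}{\zeta-k}\,d\zeta,$$ $$M(x,k)=E_+(k)+\sum_{j=1}^J\frac{\operatorname{Res}_{k_j}M\;E_+^{-1}(k_j)E_+(k)}{k-k_j}-\frac1{2\pi i}\int_{\Sigma_+}\frac{[M^-(E_+-I)V_0E_+^{-1}](x,\zeta)}{\zeta-k}\,d\zeta\;E_+(k).$$ 4. With an absolutely convergent integral, $$\begin{aligned}q(x,t)={}&q_+\Big(1+\sum_{j=1}^J\frac{C_j}{\lambda_{+,j}}e^{i(\lambda_{+,j}+\lambda_{-,j})x}M_{12}(x,k_j)\Big)\\&+\frac{i}{2\pi}\int_{\Sigma_+}\frac1{\lambda_+}\Big[\Big(\frac{iq_+}{k-\lambda_+}V_{0,11}-V_{0,12}\Big)q_+M^-_{12}(x,k)-\Big(\frac{iq_+}{k-\lambda_+}V_{0,21}-V_{0,22}\Big)q_+M^-_{11}(x,k)\Big]dk.\end{aligned}$$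 -/

import Mathlib

open Complex Filter Topology MeasureTheory Matrix

noncomputable section

namespace MKdV

/-- `q` is, at all times `t ∈ T`, a classical solution of the defocusing mKdV equation
`q_t - 6 q² q_x + q_xxx = 0` with `q → qm` as `x → -∞` and `q → qp` as `x → +∞`. The
boundary values are attained with an integrable first moment, and `q_x`, `q_xx` are integrable. -/
structure IsDefocusingSolution (q : ℝ → ℝ → ℝ) (qm qp : ℝ) (T : Set ℝ) : Prop where
  contDiff : ∀ t ∈ T, ContDiff ℝ 3 (fun x => q x t)
  equation : ∀ t ∈ T, ∀ x : ℝ, HasDerivAt (fun τ => q x τ)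
    (6 * q x t ^ 2 * deriv (fun y => q y t) x - iteratedDeriv 3 (fun y => q y t) x) t
  tendsto_left : ∀ t ∈ T, Tendsto (fun x => q x t) atBot (𝓝 qm)
  tendsto_right : ∀ t ∈ T, Tendsto (fun x => q x t) atTop (𝓝 qp)
  moment_left : ∀ t ∈ T, IntegrableOn (fun x => (1 + |x|) * (q x t - qm)) (Set.Iic 0)
  moment_right : ∀ t ∈ T, IntegrableOn (fun x => (1 + |x|) * (q x t - qp)) (Set.Ici 0)
  integrable_deriv : ∀ t ∈ T, Integrable (deriv fun x => q x t)
  integrable_deriv_two : ∀ t ∈ T, Integrable (iteratedDeriv 2 fun x => q x t)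

/-- The Pauli matrix `σ₃`. -/
def sigma3 : Matrix (Fin 2) (Fin 2) ℂ := !![1, 0; 0, -1]

/-- The matrix `Q` of the defocusing case. -/
def Qmat (v : ℝ) : Matrix (Fin 2) (Fin 2) ℂ := !![0, (v : ℂ); (v : ℂ), 0]

/-- The matrix `X = i k σ₃ + Q` of the spectral problem. -/
def laxX (v : ℝ) (k : ℂ) : Matrix (Fin 2) (Fin 2) ℂ := (I * k) • sigma3 + Qmat v

/-- The real set `(-∞, -a] ∪ [a, ∞)`; for `a = qm`, `a = qp` these are `Σ₋` and `Σ₊`. -/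
def cut (a : ℝ) : Set ℝ := {s | a ≤ |s|}

/-- The same set inside the complex plane. -/
def cutC (a : ℝ) : Set ℂ := {k | k.im = 0 ∧ a ≤ |k.re|}

open Classical in
/-- The branch of `λ = √(k² - a²)` (for `a > 0`) that is analytic off the cut, where
`Im λ > 0`, and that on the cut takes its boundary values from above. -/
def lam (a : ℝ) (k : ℂ) : ℂ :=
  if k ∈ cutC a then (((SignType.sign k.re : ℝ) * √(k.re ^ 2 - a ^ 2) : ℝ) : ℂ)
  else I * ((a : ℂ) ^ 2 - k ^ 2) ^ (1 / 2 : ℂ)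

/-- The eigenvector matrix `E = I + i / (k - λ) σ₃ Q_a`. -/
def E (a : ℝ) (k : ℂ) : Matrix (Fin 2) (Fin 2) ℂ :=
  1 + (I / (k - lam a k)) • (sigma3 * Qmat a)

/-- `γ = det E`. -/
def gam (a : ℝ) (k : ℂ) : ℂ := (E a k).det

/-- The `j`-th column of `φ e^{i λ x σ₃}`. -/
def normalize (a : ℝ) (k : ℂ) (j : Fin 2) (φ : ℝ → Fin 2 → ℂ) (x : ℝ) : Fin 2 → ℂ :=
  exp (I * lam a k * x * sigma3 j j) • φ x

/-- `φ` solves `φ_x = X φ` for the profile `u`, and behaves like the `j`-th column of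
`E e^{-i λ x σ₃}` at the end `l` of the line, where `u` has the limit `a`. -/
def IsJost (u : ℝ → ℝ) (a : ℝ) (l : Filter ℝ) (j : Fin 2) (k : ℂ) (φ : ℝ → Fin 2 → ℂ) : Prop :=
  (∀ x, HasDerivAt φ (laxX (u x) k *ᵥ φ x) x) ∧
    Tendsto (normalize a k j φ) l (𝓝 fun i => E a k i j)

open Classical in
/-- The `j`-th column of the Jost solution. It is used only where it exists and is unique:
at `-∞` with `j = 0` and at `+∞` with `j = 1` for all `k`, in the other two cases on the cut. -/
def jost (u : ℝ → ℝ) (a : ℝ) (l : Filter ℝ) (j : Fin 2) (k : ℂ) : ℝ → Fin 2 → ℂ :=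
  if h : ∃ φ, IsJost u a l j k φ then h.choose else 0

/-- `φ_{-,j+1}`. -/
def phiMinus (u : ℝ → ℝ) (qm : ℝ) (j : Fin 2) (k : ℂ) : ℝ → Fin 2 → ℂ := jost u qm atBot j k

/-- `φ_{+,j+1}`. -/
def phiPlus (u : ℝ → ℝ) (qp : ℝ) (j : Fin 2) (k : ℂ) : ℝ → Fin 2 → ℂ := jost u qp atTop j k

/-- `μ_{-,j+1}`. -/
def muMinus (u : ℝ → ℝ) (qm : ℝ) (j : Fin 2) (k : ℂ) : ℝ → Fin 2 → ℂ :=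
  normalize qm k j (phiMinus u qm j k)

/-- `μ_{+,j+1}`. -/
def muPlus (u : ℝ → ℝ) (qp : ℝ) (j : Fin 2) (k : ℂ) : ℝ → Fin 2 → ℂ :=
  normalize qp k j (phiPlus u qp j k)

/-- The Wronskian of two solutions of `φ_x = X φ`. It does not depend on `x`, as `tr X = 0`,
and is evaluated at `x = 0`. -/
def Wr (φ ψ : ℝ → Fin 2 → ℂ) : ℂ := φ 0 0 * ψ 0 1 - φ 0 1 * ψ 0 0

/-- Scattering coefficients, the entries of `S` in `φ₋ = φ₊ S`, as Wronskians. -/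
def s11 (u : ℝ → ℝ) (qm qp : ℝ) (k : ℂ) : ℂ :=
  Wr (phiMinus u qm 0 k) (phiPlus u qp 1 k) / gam qp k

def s12 (u : ℝ → ℝ) (qm qp : ℝ) (k : ℂ) : ℂ :=
  Wr (phiMinus u qm 1 k) (phiPlus u qp 1 k) / gam qp k

def s21 (u : ℝ → ℝ) (qm qp : ℝ) (k : ℂ) : ℂ :=
  Wr (phiPlus u qp 0 k) (phiMinus u qm 0 k) / gam qp k

def s22 (u : ℝ → ℝ) (qm qp : ℝ) (k : ℂ) : ℂ :=
  Wr (phiPlus u qp 0 k) (phiMinus u qm 1 k) / gam qp k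

/-- `ρ = s₂₁ / s₁₁`. -/
def rho (u : ℝ → ℝ) (qm qp : ℝ) (k : ℂ) : ℂ := s21 u qm qp k / s11 u qm qp k

/-- `ρ̃ = s₁₂ / s₂₂`. -/
def rhoT (u : ℝ → ℝ) (qm qp : ℝ) (k : ℂ) : ℂ := s12 u qm qp k / s22 u qm qp k

/-- `M = (μ_{-,1} / s₁₁, μ_{+,2})`. -/
def M (u : ℝ → ℝ) (qm qp : ℝ) (x : ℝ) (k : ℂ) : Matrix (Fin 2) (Fin 2) ℂ :=
  !![muMinus u qm 0 k x 0 / s11 u qm qp k, muPlus u qp 1 k x 0;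
     muMinus u qm 0 k x 1 / s11 u qm qp k, muPlus u qp 1 k x 1]

/-- `N = M E₊⁻¹`. -/
def N (u : ℝ → ℝ) (qm qp : ℝ) (x : ℝ) (k : ℂ) : Matrix (Fin 2) (Fin 2) ℂ :=
  M u qm qp x k * (E qp k)⁻¹

/-- `F` has a boundary value at the real point `s` from the upper half-plane. -/
def HasAbove (F : ℂ → Matrix (Fin 2) (Fin 2) ℂ) (s : ℝ) : Prop :=
  ∃ A, Tendsto F (𝓝[{z | 0 < z.im}] (s : ℂ)) (𝓝 A)

/-- `F` has a boundary value at the real point `s` from the lower half-plane. -/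
def HasBelow (F : ℂ → Matrix (Fin 2) (Fin 2) ℂ) (s : ℝ) : Prop :=
  ∃ A, Tendsto F (𝓝[{z | z.im < 0}] (s : ℂ)) (𝓝 A)

/-- The boundary value `F⁺(s)` from the upper half-plane. -/
def above (F : ℂ → Matrix (Fin 2) (Fin 2) ℂ) (s : ℝ) : Matrix (Fin 2) (Fin 2) ℂ :=
  limUnder (𝓝[{z | 0 < z.im}] (s : ℂ)) F

/-- The boundary value `F⁻(s)` from the lower half-plane. -/
def below (F : ℂ → Matrix (Fin 2) (Fin 2) ℂ) (s : ℝ) : Matrix (Fin 2) (Fin 2) ℂ :=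
  limUnder (𝓝[{z | z.im < 0}] (s : ℂ)) F

open Classical in
/-- The matrix `V₀` on `Σ₊ = Σ₋ ∪ Σ₀`; the two expressions agree at the common points `± qm`
of `Σ₋` and `Σ₀`. -/
def V0 (u : ℝ → ℝ) (qm qp : ℝ) (x s : ℝ) : Matrix (Fin 2) (Fin 2) ℂ :=
  let lm := lam qm s
  let lp := lam qp s
  let r := rho u qm qp s
  let r' := rhoT u qm qp s
  if s ∈ cut qm then
    !![1 - (1 - r * r') * exp (I * (lm - lp) * x), r' * exp (-2 * I * lp * x);
       -r * exp (2 * I * lm * x), 1 - exp (I * (lm - lp) * x)]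
  else
    !![1, 1 / r * exp (-2 * I * lp * x);
       -r, 1 - exp (-I * (lp + lm) * x)]

/-- The jump matrix `V = (E₊ - I)(I - V₀)` of `M`. -/
def V (u : ℝ → ℝ) (qm qp : ℝ) (x s : ℝ) : Matrix (Fin 2) (Fin 2) ℂ :=
  (E qp s - 1) * (1 - V0 u qm qp x s)

/-- The jump matrix `Ṽ = E₊⁻ V E₊⁻¹` of `N`. -/
def Vtilde (u : ℝ → ℝ) (qm qp : ℝ) (x s : ℝ) : Matrix (Fin 2) (Fin 2) ℂ :=
  below (E qp) s * V u qm qp x s * (E qp s)⁻¹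

/-- With `C = b / s₁₁'(κ)`, the matrix `(C e^{i(λ₊(κ) + λ₋(κ)) x} M₂(κ), 0)`. -/
def resM (u : ℝ → ℝ) (qm qp : ℝ) (C : ℂ) (x κ : ℝ) : Matrix (Fin 2) (Fin 2) ℂ :=
  let c := C * exp (I * (lam qp κ + lam qm κ) * x)
  !![c * M u qm qp x κ 0 1, 0; c * M u qm qp x κ 1 1, 0]

/-- The integrand over `Σ₊` in the formula for `q`. -/
def recIntegrand (u : ℝ → ℝ) (qm qp : ℝ) (x s : ℝ) : ℂ :=
  let e := I * qp / (s - lam qp s)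
  let W := V0 u qm qp x s
  let Mm := below (M u qm qp x) s
  1 / lam qp s *
    ((e * W 0 0 - W 0 1) * qp * Mm 0 1 - (e * W 1 0 - W 1 1) * qp * Mm 0 0)

end MKdV

end

/-!
The Riemann-Hilbert problem is studied in the closed upper half-plane, where `λ` is continuous and
has its boundary values from above on the cut. The symmetry `N(k̄) = σ₁ conj N(k) σ₁`
(`IsStep.N_conj`) carries every statement over to the lower half-plane, and shows that the boundary
value from below is `N⁻(s) = σ₁ conj N(s) σ₁` on the cut.

The Jost solutions solve Volterra equations whose kernel grows at most linearly, also at the branch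
points, so the first moment of the profile makes the Neumann series converge
(`isJost_exp_smul_jostMu`). The series is continuous in `k` on the closed upper half-plane and
holomorphic off the cut. A Wronskian argument gives uniqueness (`IsJost.unique`), which turns the
symmetries of the equation into symmetries of the Jost solutions. Off the real line, `s₁₁` has no
zeros, since a bound state would make `|φ₁|² - |φ₂|²` monotone with limit zero at both ends
(`IsStep.jostWr_ne_zero`). At a zero in the gap the two Jost solutions are proportional, which gives
the residue.

On the cut, the scattering relation expresses `M⁺` by `σ₁ conj M⁺ σ₁ = M⁻ (E₊ - 1)`, and this is the
jump relation (`IsStep.M_eq_conjFlip_mul`). In particular the integrands of both Plemelj formulas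
are the jump `N⁻ - N⁺`, away from the branch points.

For large `k` in the closed upper half-plane, two eliminations of the oscillating component put the
equation into a form with integrable coefficients of order `1 / k`
(`IsSmoothProfile.norm_le_of_large`). Hence `N = 1 + O(1 / k)` and
`N₁₂ = i (q - q₊) / (2 k) + O(1 / k²)`. This is where the integrability of `q_x` and `q_xx` enters.

Removing the poles from `N - 1` leaves a function `regN`, holomorphic in the upper half-plane, with
`|regN| |k² - q₊²|^{1/2}` bounded (`exists_bound_regN`). Cauchy's formula holds for such functions
(`cauchy_upper`): the value at `k0` is the Poisson integral of the boundary values, and the integral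
against the reflected pole vanishes. Applied to `regN` and its reflection it gives the Plemelj
representation (`plemelj`). The coefficient of `1 / k` in the representation of `N₁₂` along the
imaginary axis is the formula for `q` (`IsSmoothStep.reconstruction`); the integral in it converges
since the first-order terms cancel in the jump of `N₁₂`.
-/

open scoped ComplexConjugate

noncomputable section

namespace MKdV

/-! ### The spectral parameter `λ` -/

theorem mem_cutC_ofReal {a s : ℝ} : (s : ℂ) ∈ cutC a ↔ s ∈ cut a := by
  simp [cutC, cut]

theorem isClosed_cutC (a : ℝ) : IsClosed (cutC a) :=
  (isClosed_eq continuous_im continuous_const).inter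
    (isClosed_le continuous_const continuous_re.abs)

theorem isClosed_cut (a : ℝ) : IsClosed (cut a) :=
  isClosed_le continuous_const continuous_abs

/-- Off the cut, `a² - k²` avoids the branch cut of the principal square root. -/
theorem sub_sq_mem_slitPlane {a : ℝ} {k : ℂ} (hk : k ∉ cutC a) :
    (a : ℂ) ^ 2 - k ^ 2 ∈ slitPlane := by
  rw [mem_slitPlane_iff]
  by_contra! h
  obtain ⟨h1, h2⟩ := h
  have e1 : ((a : ℂ) ^ 2 - k ^ 2).re = a ^ 2 - (k.re ^ 2 - k.im ^ 2) := by
    simp [pow_two]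
  have e2 : ((a : ℂ) ^ 2 - k ^ 2).im = - (2 * k.re * k.im) := by
    simp [pow_two]; ring
  rw [e1] at h1; rw [e2] at h2
  apply hk
  have h3 : k.re = 0 ∨ k.im = 0 := by
    have : k.re * k.im = 0 := by linarith
    exact mul_eq_zero.mp this
  have him : k.im = 0 := by
    rcases h3 with h | h
    · rw [h] at h1
      nlinarith [sq_nonneg a, sq_nonneg k.im]
    · exact h
  refine ⟨him, ?_⟩
  rw [him] at h1
  exact (le_abs_self a).trans (sq_le_sq.mp (by nlinarith))

theorem lam_of_notMem {a : ℝ} {k : ℂ} (hk : k ∉ cutC a) :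
    lam a k = I * ((a : ℂ) ^ 2 - k ^ 2) ^ (1 / 2 : ℂ) := if_neg hk

theorem lam_ofReal {a s : ℝ} (hs : s ∈ cut a) :
    lam a s = (((SignType.sign s : ℝ) * √(s ^ 2 - a ^ 2) : ℝ) : ℂ) := by
  rw [lam, if_pos (mem_cutC_ofReal.2 hs)]; simp

theorem sq_le_sq_of_mem_cut {a s : ℝ} (ha : 0 ≤ a) (hs : s ∈ cut a) : a ^ 2 ≤ s ^ 2 := by
  have h : a ≤ |s| := hs
  rw [← sq_abs s]; gcongr

theorem eq_ofReal_of_mem_cutC {a : ℝ} {k : ℂ} (hk : k ∈ cutC a) :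
    k = (k.re : ℂ) ∧ k.re ∈ cut a := ⟨Complex.ext (by simp) (by simpa using hk.1), hk.2⟩

theorem lam_sq {a : ℝ} (ha : 0 < a) (k : ℂ) : lam a k ^ 2 = k ^ 2 - (a : ℂ) ^ 2 := by
  by_cases hk : k ∈ cutC a
  · obtain ⟨h1, h2⟩ := eq_ofReal_of_mem_cutC hk
    rw [h1, lam_ofReal h2]
    have hle := sq_le_sq_of_mem_cut ha.le h2
    have h0 : k.re ≠ 0 := by
      intro h; rw [h] at hle; nlinarith
    have hs : (SignType.sign k.re : ℝ) ^ 2 = 1 := by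
      rcases lt_or_gt_of_ne h0 with h | h
      · simp [h]
      · simp [h]
    have : ((SignType.sign k.re : ℝ) * √(k.re ^ 2 - a ^ 2)) ^ 2 = k.re ^ 2 - a ^ 2 := by
      rw [mul_pow, hs, Real.sq_sqrt (by linarith), one_mul]
    exact_mod_cast congrArg (fun x : ℝ => (x : ℂ)) this
  · rw [lam_of_notMem hk, mul_pow, I_sq, ← cpow_nat_mul]
    norm_num

theorem lam_im_pos {a : ℝ} {k : ℂ} (hk : k ∉ cutC a) : 0 < (lam a k).im := by
  have h := sub_sq_mem_slitPlane hk
  rw [lam_of_notMem hk, cpow_def_of_ne_zero (slitPlane_ne_zero h), mul_im]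
  simp only [I_re, I_im, zero_mul, one_mul, zero_add, exp_re]
  refine mul_pos (Real.exp_pos _) (Real.cos_pos_of_mem_Ioo ?_)
  have h1 : ((log ((a : ℂ) ^ 2 - k ^ 2)) * (1 / 2)).im = arg ((a : ℂ) ^ 2 - k ^ 2) / 2 := by
    rw [show (1 / 2 : ℂ) = ((1 / 2 : ℝ) : ℂ) by simp, im_mul_ofReal, log_im]; ring
  rw [h1]
  have h2 := neg_pi_lt_arg ((a : ℂ) ^ 2 - k ^ 2)
  have h3 := (mem_slitPlane_iff_arg.1 h).1
  have h4 : arg ((a : ℂ) ^ 2 - k ^ 2) < Real.pi := lt_of_le_of_ne (arg_le_pi _) h3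
  constructor <;> linarith

theorem lam_im_eq_zero {a : ℝ} {k : ℂ} (hk : k ∈ cutC a) : (lam a k).im = 0 := by
  rw [lam, if_pos hk]; exact ofReal_im _

theorem lam_im_nonneg (a : ℝ) (k : ℂ) : 0 ≤ (lam a k).im := by
  by_cases hk : k ∈ cutC a
  · exact (lam_im_eq_zero hk).ge
  · exact (lam_im_pos hk).le

theorem lam_ne_zero {a : ℝ} {k : ℂ} (hk : k ∉ cutC a) : lam a k ≠ 0 := fun h => by
  have := lam_im_pos hk
  rw [h] at this; simp at this

theorem lam_ne_zero_of_abs {a s : ℝ} (ha : 0 < a) (hs : |s| ≠ a) : lam a s ≠ 0 := fun h => by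
  have h2 := lam_sq ha s
  rw [h] at h2
  have h3 : s ^ 2 = a ^ 2 := by
    have : ((s : ℂ)) ^ 2 = (a : ℂ) ^ 2 := by linear_combination -h2
    exact_mod_cast this
  apply hs
  rw [← abs_of_pos ha]
  exact (sq_eq_sq_iff_abs_eq_abs _ _).1 h3

/-- The square root with positive imaginary part is unique. -/
theorem eq_lam_of_sq {a : ℝ} (ha : 0 < a) {k l : ℂ} (h : l ^ 2 = k ^ 2 - (a : ℂ) ^ 2)
    (hl : 0 < l.im) : l = lam a k := by
  have h1 : (l - lam a k) * (l + lam a k) = 0 := by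
    have := lam_sq ha k; linear_combination h - this
  rcases mul_eq_zero.1 h1 with h2 | h2
  · exact sub_eq_zero.1 h2
  · have h3 : l.im + (lam a k).im = 0 := by rw [← add_im, h2]; simp
    have := lam_im_nonneg a k
    linarith

theorem conj_mem_cutC {a : ℝ} {k : ℂ} : conj k ∈ cutC a ↔ k ∈ cutC a := by
  simp [cutC]

theorem lam_conj {a : ℝ} (ha : 0 < a) {k : ℂ} (hk : k ∉ cutC a) :
    lam a (conj k) = -conj (lam a k) := by
  symm
  apply eq_lam_of_sq ha
  · have := congrArg conj (lam_sq ha k)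
    simp only [map_pow, map_sub, conj_ofReal] at this
    rw [neg_sq, this]
  · simpa using lam_im_pos hk

theorem sub_mul_add_lam {a : ℝ} (ha : 0 < a) (k : ℂ) :
    (k - lam a k) * (k + lam a k) = (a : ℂ) ^ 2 := by
  have := lam_sq ha k; linear_combination -this

theorem sub_lam_ne_zero {a : ℝ} (ha : 0 < a) (k : ℂ) : k - lam a k ≠ 0 := fun h => by
  have := sub_mul_add_lam ha k
  rw [h, zero_mul] at this
  exact pow_ne_zero 2 (ofReal_ne_zero.2 ha.ne') this.symm

theorem add_lam_ne_zero {a : ℝ} (ha : 0 < a) (k : ℂ) : k + lam a k ≠ 0 := fun h => by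
  have := sub_mul_add_lam ha k
  rw [h, mul_zero] at this
  exact pow_ne_zero 2 (ofReal_ne_zero.2 ha.ne') this.symm

theorem differentiableAt_lam {a : ℝ} {k : ℂ} (hk : k ∉ cutC a) :
    DifferentiableAt ℂ (lam a) k := by
  have h1 : DifferentiableAt ℂ (fun k : ℂ => I * ((a : ℂ) ^ 2 - k ^ 2) ^ (1 / 2 : ℂ)) k := by
    refine DifferentiableAt.const_mul ?_ _
    exact DifferentiableAt.cpow_const (by fun_prop) (sub_sq_mem_slitPlane hk)
  refine h1.congr_of_eventuallyEq ?_
  filter_upwards [(isClosed_cutC a).isOpen_compl.mem_nhds hk] with w hw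
  exact lam_of_notMem hw

theorem differentiableOn_lam (a : ℝ) : DifferentiableOn ℂ (lam a) (cutC a)ᶜ :=
  fun _ hk => (differentiableAt_lam hk).differentiableWithinAt

/-- In the closed upper half-plane, `λ` and `k` enclose an angle of at most `π / 2`. -/
theorem re_mul_lam_nonneg {a : ℝ} (ha : 0 < a) {k : ℂ} (hk : 0 ≤ k.im) :
    0 ≤ k.re * (lam a k).re := by
  by_cases h : k ∈ cutC a
  · obtain ⟨h1, h2⟩ := eq_ofReal_of_mem_cutC h
    rw [h1, lam_ofReal h2, ofReal_re, ofReal_re]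
    rcases lt_trichotomy k.re 0 with h | h | h
    · simpa [h] using mul_nonpos_of_nonpos_of_nonneg h.le (Real.sqrt_nonneg (k.re ^ 2 - a ^ 2))
    · simp [h]
    · simp [h]
  · have h1 := lam_im_pos h
    have h2 := congrArg im (lam_sq ha k)
    simp only [pow_two, mul_im, sub_im, ofReal_im, ofReal_re] at h2
    have h3 : (lam a k).re * (lam a k).im = k.re * k.im := by linarith
    have h4 : (k.re * (lam a k).re) * (lam a k).im = k.re ^ 2 * k.im := by
      linear_combination k.re * h3
    by_contra! h5
    have : 0 ≤ k.re ^ 2 * k.im := by positivity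
    nlinarith

theorem re_mul_lam_eq_of_mem_cut {a s : ℝ} (hs : s ∈ cut a) :
    s * (lam a s).re = |s| * √(s ^ 2 - a ^ 2) := by
  rw [lam_ofReal hs, ofReal_re]
  rcases lt_trichotomy s 0 with h | h | h
  · simp [h, abs_of_neg h]
  · simp [h]
  · simp [h, abs_of_pos h]

/-- On the closed upper half-plane `λ` is continuous: its values on the cut are the boundary
values from above. -/
theorem continuousOn_lam {a : ℝ} (ha : 0 < a) : ContinuousOn (lam a) {k | 0 ≤ k.im} := by
  intro k0 hk0
  by_cases hc : k0 ∈ cutC a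
  swap
  · exact (differentiableAt_lam hc).continuousAt.continuousWithinAt
  obtain ⟨h1, h2⟩ := eq_ofReal_of_mem_cutC hc
  set s := k0.re with hs
  rw [h1]
  -- `|λ(k)² - λ(s)²| = |k² - s²|` tends to zero
  have hsq : Tendsto (fun k : ℂ => ‖k ^ 2 - (s : ℂ) ^ 2‖) (𝓝[{k | 0 ≤ k.im}] (s : ℂ)) (𝓝 0) := by
    have : Continuous fun k : ℂ => ‖k ^ 2 - (s : ℂ) ^ 2‖ := by fun_prop
    simpa using (this.tendsto (s : ℂ)).mono_left nhdsWithin_le_nhds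
  have hprod : ∀ k : ℂ, ‖lam a k - lam a s‖ * ‖lam a k + lam a s‖ = ‖k ^ 2 - (s : ℂ) ^ 2‖ := by
    intro k
    rw [← norm_mul]; congr 1
    have e1 := lam_sq ha k
    have e2 := lam_sq ha (s : ℂ)
    linear_combination e1 - e2
  have hs0 : 0 < |s| := lt_of_lt_of_le ha h2
  set l0 := √(s ^ 2 - a ^ 2) with hl0
  have hnorm : ‖lam a s‖ = l0 := by
    have h3 : (lam a s).im = 0 := lam_im_eq_zero (mem_cutC_ofReal.2 h2)
    have h4 : ‖lam a s‖ ^ 2 = l0 ^ 2 := by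
      rw [← norm_pow, lam_sq ha, hl0, Real.sq_sqrt (sub_nonneg.2 (sq_le_sq_of_mem_cut ha.le h2))]
      have : ((s : ℂ) ^ 2 - (a : ℂ) ^ 2) = ((s ^ 2 - a ^ 2 : ℝ) : ℂ) := by push_cast; ring
      rw [this, norm_real, Real.norm_of_nonneg (sub_nonneg.2 (sq_le_sq_of_mem_cut ha.le h2))]
    exact (sq_eq_sq₀ (norm_nonneg _) (Real.sqrt_nonneg _)).1 h4
  rw [ContinuousWithinAt, tendsto_iff_norm_sub_tendsto_zero]
  rcases (Real.sqrt_nonneg (s ^ 2 - a ^ 2)).eq_or_lt with h0 | h0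
  · -- at a branch point `λ(s) = 0`
    have hz : lam a s = 0 := by rw [← norm_eq_zero, hnorm, hl0, ← h0]
    have h3 : ∀ k : ℂ, ‖lam a k - lam a s‖ = √‖k ^ 2 - (s : ℂ) ^ 2‖ := by
      intro k
      rw [← hprod k, hz, sub_zero, add_zero, Real.sqrt_mul_self (norm_nonneg _)]
    simp only [h3]
    simpa using hsq.sqrt
  · -- elsewhere `λ(k)` stays away from `-λ(s)`, as it lies in the half-plane of `k`
    have hev : ∀ᶠ k in 𝓝[{k | 0 ≤ k.im}] (s : ℂ), l0 / 2 ≤ ‖lam a k + lam a s‖ := by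
      have hc1 : Tendsto (fun k : ℂ => k.re * s) (𝓝[{k | 0 ≤ k.im}] (s : ℂ)) (𝓝 (s * s)) := by
        have : Continuous fun k : ℂ => k.re * s := by fun_prop
        simpa using (this.tendsto (s : ℂ)).mono_left nhdsWithin_le_nhds
      have hss : 0 < s * s := by nlinarith [abs_pos.1 hs0, sq_nonneg s, sq_abs s]
      filter_upwards [hc1.eventually (lt_mem_nhds hss), self_mem_nhdsWithin] with k hk hk'
      have h5 := re_mul_lam_nonneg ha hk'
      have h6 := re_mul_lam_eq_of_mem_cut h2
      have h7 : 0 ≤ s * (lam a k).re := by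
        have : 0 ≤ (s * (lam a k).re) * (k.re * k.re) := by
          have : (s * (lam a k).re) * (k.re * k.re) = (k.re * s) * (k.re * (lam a k).re) := by ring
          rw [this]; positivity
        have hkk : 0 < k.re * k.re := by
          have : k.re ≠ 0 := by intro h; rw [h] at hk; simp at hk
          exact mul_self_pos.2 this
        by_contra! h; nlinarith
      have h8 : |s| * l0 ≤ s * ((lam a k) + lam a s).re := by
        rw [add_re, mul_add, h6]; linarith
      have h9 : s * ((lam a k) + lam a s).re ≤ |s| * ‖lam a k + lam a s‖ := by
        calc _ ≤ |s * ((lam a k) + lam a s).re| := le_abs_self _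
          _ = |s| * |((lam a k) + lam a s).re| := abs_mul _ _
          _ ≤ _ := by gcongr; exact abs_re_le_norm _
      have h10 : l0 ≤ ‖lam a k + lam a s‖ := le_of_mul_le_mul_left (h8.trans h9) hs0
      linarith [norm_nonneg (lam a k + lam a s)]
    have hlim : Tendsto (fun k : ℂ => ‖k ^ 2 - (s : ℂ) ^ 2‖ / (l0 / 2))
        (𝓝[{k | 0 ≤ k.im}] (s : ℂ)) (𝓝 0) := by simpa using hsq.div_const (l0 / 2)
    refine tendsto_of_tendsto_of_tendsto_of_le_of_le' tendsto_const_nhds hlim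
      (Eventually.of_forall fun _ => norm_nonneg _) ?_
    filter_upwards [hev] with k hk
    rw [le_div_iff₀ (half_pos h0), ← hprod k]
    gcongr

/-- In the closed upper half-plane `k + λ` is the large one of the two factors of `a²`. -/
theorem norm_le_norm_add_lam {a : ℝ} (ha : 0 < a) {k : ℂ} (hk : 0 ≤ k.im) :
    ‖k‖ ≤ ‖k + lam a k‖ := by
  have h1 := re_mul_lam_nonneg ha hk
  have h2 := mul_nonneg hk (lam_im_nonneg a k)
  refine (abs_le_of_sq_le_sq' ?_ (norm_nonneg _)).2
  rw [Complex.sq_norm, Complex.sq_norm, normSq_apply, normSq_apply, add_re, add_im]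
  nlinarith [sq_nonneg (lam a k).re, sq_nonneg (lam a k).im]

/-! ### Volterra operators on a half-line -/

section Volterra

open Set

/-- The derivative of the tail integral of a continuous function. -/
theorem hasDerivAt_integral_Ioi {F : Type*} [NormedAddCommGroup F] [NormedSpace ℝ F]
    [CompleteSpace F] {f : ℝ → F} (hf : Continuous f) {x0 x : ℝ} (hx : x0 < x)
    (hi : IntegrableOn f (Ioi x0)) :
    HasDerivAt (fun y => ∫ s in Ioi y, f s) (-f x) x := by
  have h1 : HasDerivAt (fun y => (∫ s in Ioi x0, f s) - ∫ s in x0..y, f s) (-f x) x := by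
    exact (intervalIntegral.integral_hasDerivAt_right (hf.intervalIntegrable _ _)
      (hf.stronglyMeasurableAtFilter _ _) hf.continuousAt).const_sub _
  refine h1.congr_of_eventuallyEq ?_
  filter_upwards [lt_mem_nhds hx] with y hy
  rw [← intervalIntegral.integral_interval_add_Ioi hi (hi.mono_set (Ioi_subset_Ioi hy.le))]
  abel

theorem tendsto_integral_Ioi_atTop {F : Type*} [NormedAddCommGroup F] [NormedSpace ℝ F]
    {f : ℝ → F} {x0 : ℝ} (hi : IntegrableOn f (Ioi x0)) :
    Tendsto (fun y => ∫ s in Ioi y, f s) atTop (𝓝 0) := by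
  have h1 := intervalIntegral_tendsto_integral_Ioi x0 hi tendsto_id
  have h2 : Tendsto (fun y => (∫ s in Ioi x0, f s) - ∫ s in x0..y, f s) atTop (𝓝 0) := by
    simpa using h1.const_sub (∫ s in Ioi x0, f s)
  refine h2.congr' ?_
  filter_upwards [eventually_ge_atTop x0] with y hy
  rw [← intervalIntegral.integral_interval_add_Ioi hi (hi.mono_set (Ioi_subset_Ioi hy))]
  abel

section tail

variable {g : ℝ → ℝ} {x0 : ℝ}

theorem integral_Ioi_anti (hg0 : ∀ s, 0 ≤ g s) (hi : IntegrableOn g (Ioi x0)) {x y : ℝ}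
    (hx : x0 ≤ x) (hxy : x ≤ y) : ∫ s in Ioi y, g s ≤ ∫ s in Ioi x, g s :=
  setIntegral_mono_set (hi.mono_set (Ioi_subset_Ioi hx)) (ae_of_all _ hg0)
    (Ioi_subset_Ioi hxy).eventuallyLE

theorem integrableOn_mul_tail_pow (hg : Continuous g) (hg0 : ∀ s, 0 ≤ g s)
    (hi : ∀ x, IntegrableOn g (Ioi x)) (x : ℝ) (n : ℕ) :
    IntegrableOn (fun s => g s * (∫ r in Ioi s, g r) ^ n) (Ioi x) := by
  have hc : Continuous fun s => ∫ r in Ioi s, g r := continuous_iff_continuousAt.2 fun s =>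
    (hasDerivAt_integral_Ioi hg (sub_one_lt s) (hi _)).continuousAt
  refine Integrable.mono' ((hi x).mul_const ((∫ r in Ioi x, g r) ^ n))
    (hg.mul (hc.pow n)).aestronglyMeasurable ?_
  filter_upwards [ae_restrict_mem measurableSet_Ioi] with s hs
  have h0 : 0 ≤ ∫ r in Ioi s, g r := setIntegral_nonneg measurableSet_Ioi fun r _ => hg0 r
  rw [Real.norm_of_nonneg (mul_nonneg (hg0 s) (pow_nonneg h0 n))]
  exact mul_le_mul_of_nonneg_left (pow_le_pow_left₀ h0
    (integral_Ioi_anti hg0 (hi x) le_rfl (le_of_lt hs)) n) (hg0 s)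

/-- The identity behind the factorials in the Neumann series: the tail integral of `g G ^ n`, with
`G` the tail integral of `g`, is `G ^ (n + 1) / (n + 1)`. -/
theorem integral_mul_tail_pow (hg : Continuous g) (hg0 : ∀ s, 0 ≤ g s)
    (hi : ∀ x, IntegrableOn g (Ioi x)) (x : ℝ) (n : ℕ) :
    ∫ s in Ioi x, g s * (∫ r in Ioi s, g r) ^ n = (∫ r in Ioi x, g r) ^ (n + 1) / (n + 1) := by
  have hd : ∀ y ∈ Ici x, HasDerivAt (fun y => -((∫ r in Ioi y, g r) ^ (n + 1) / (n + 1)))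
      (g y * (∫ r in Ioi y, g r) ^ n) y := by
    intro y _
    have h := (((hasDerivAt_integral_Ioi hg (sub_one_lt y) (hi _)).pow (n + 1)).div_const
      ((n : ℝ) + 1)).neg
    refine h.congr_deriv ?_
    have : (n : ℝ) + 1 ≠ 0 := by positivity
    simp only [Nat.add_sub_cancel]
    push_cast
    field_simp
  have ht : Tendsto (fun y => -((∫ r in Ioi y, g r) ^ (n + 1) / ((n : ℝ) + 1))) atTop (𝓝 0) := by
    have := (((tendsto_integral_Ioi_atTop (hi x)).pow (n + 1)).div_const ((n : ℝ) + 1)).neg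
    simpa using this
  rw [integral_Ioi_of_hasDerivAt_of_tendsto' hd (integrableOn_mul_tail_pow hg hg0 hi x n) ht]
  simp

end tail

variable {V : Type*} [NormedAddCommGroup V] [NormedSpace ℂ V]

/-- A convolution kernel on the negative half-line which grows at most linearly and whose
derivative `K'` is bounded. -/
structure IsVolterraKernel (K K' : ℝ → V →L[ℂ] V) (c : ℝ) : Prop where
  hasDerivAt : ∀ y, HasDerivAt K (K' y) y
  continuous_deriv : Continuous K'
  bound : ∀ y ≤ 0, ‖K y‖ ≤ c * (1 + |y|)
  bound_deriv : ∀ y ≤ 0, ‖K' y‖ ≤ c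

theorem IsVolterraKernel.continuous {K K' : ℝ → V →L[ℂ] V} {c : ℝ}
    (h : IsVolterraKernel K K' c) : Continuous K :=
  continuous_iff_continuousAt.2 fun y => (h.hasDerivAt y).continuousAt

theorem IsVolterraKernel.nonneg {K K' : ℝ → V →L[ℂ] V} {c : ℝ}
    (h : IsVolterraKernel K K' c) : 0 ≤ c := (norm_nonneg _).trans (h.bound_deriv 0 le_rfl)

/-- The Volterra operator `f ↦ -∫ₓ^∞ v(s) K(x - s) f(s) ds`. -/
def volterra (v : ℝ → ℝ) (K : ℝ → V →L[ℂ] V) (f : ℝ → V) (x : ℝ) : V :=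
  -∫ s in Ioi x, (v s : ℂ) • K (x - s) (f s)

/-- A potential, continuous and with a finite first moment at `+∞`. -/
structure IsShortRange (v : ℝ → ℝ) : Prop where
  continuous : Continuous v
  moment : ∀ x, IntegrableOn (fun s => (1 + |s|) * v s) (Ioi x)

/-- A majorant of `|v(s)| ‖K(x - s)‖` for `x0 ≤ x ≤ s`. -/
def majorant (v : ℝ → ℝ) (c x0 s : ℝ) : ℝ := c * (1 + |x0|) * ((1 + |s|) * |v s|)

namespace IsShortRange

variable {v : ℝ → ℝ}

theorem continuous_majorant (hv : IsShortRange v) (c x0 : ℝ) : Continuous (majorant v c x0) := by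
  have := hv.continuous
  unfold majorant; fun_prop

theorem integrableOn_majorant (hv : IsShortRange v) (c x0 x : ℝ) :
    IntegrableOn (majorant v c x0) (Ioi x) := by
  have h := (hv.moment x).norm.const_mul (c * (1 + |x0|))
  refine h.congr (ae_of_all _ fun s => ?_)
  simp only [majorant, norm_mul, Real.norm_eq_abs]
  rw [abs_of_nonneg (by positivity : 0 ≤ 1 + |s|)]

theorem integrableOn (hv : IsShortRange v) (x : ℝ) : IntegrableOn v (Ioi x) := by
  refine Integrable.mono (hv.moment x) hv.continuous.aestronglyMeasurable (ae_of_all _ fun s => ?_)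
  rw [norm_mul, Real.norm_of_nonneg (by positivity : 0 ≤ 1 + |s|)]
  exact le_mul_of_one_le_left (norm_nonneg _) (by linarith [abs_nonneg s])

end IsShortRange

theorem majorant_nonneg (v : ℝ → ℝ) {c : ℝ} (hc : 0 ≤ c) (x0 s : ℝ) : 0 ≤ majorant v c x0 s := by
  unfold majorant; positivity

section

variable {v : ℝ → ℝ} {K K' : ℝ → V →L[ℂ] V} {c : ℝ}

theorem IsVolterraKernel.norm_smul_le (hK : IsVolterraKernel K K' c) {x0 x s : ℝ} (hx : x0 ≤ x)
    (hs : x ≤ s) (w : V) : ‖(v s : ℂ) • K (x - s) w‖ ≤ majorant v c x0 s * ‖w‖ := by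
  have h1 : ‖K (x - s) w‖ ≤ c * ((1 + |x0|) * (1 + |s|)) * ‖w‖ := by
    refine (ContinuousLinearMap.le_opNorm _ _).trans ?_
    refine mul_le_mul_of_nonneg_right ((hK.bound _ (by linarith)).trans ?_) (norm_nonneg _)
    refine mul_le_mul_of_nonneg_left ?_ hK.nonneg
    rw [abs_of_nonpos (by linarith)]
    nlinarith [abs_nonneg x0, abs_nonneg s, le_abs_self s, neg_abs_le x0]
  rw [norm_smul, norm_real, Real.norm_eq_abs]
  calc |v s| * ‖K (x - s) w‖ ≤ |v s| * (c * ((1 + |x0|) * (1 + |s|)) * ‖w‖) := by gcongr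
    _ = _ := by unfold majorant; ring

theorem IsVolterraKernel.continuous_integrand (hK : IsVolterraKernel K K' c) (hv : IsShortRange v)
    {f : ℝ → V} (hf : Continuous f) (x : ℝ) :
    Continuous fun s => (v s : ℂ) • K (x - s) (f s) := by
  have h1 := hv.continuous
  have h2 := hK.continuous
  exact (continuous_ofReal.comp h1).smul
    ((h2.comp (continuous_const.sub continuous_id)).clm_apply hf)

theorem IsVolterraKernel.integrableOn (hK : IsVolterraKernel K K' c) (hv : IsShortRange v)
    {f : ℝ → V} (hf : Continuous f) {x B : ℝ} (hB : ∀ s, x ≤ s → ‖f s‖ ≤ B) :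
    IntegrableOn (fun s => (v s : ℂ) • K (x - s) (f s)) (Ioi x) := by
  refine Integrable.mono' ((hv.integrableOn_majorant c x x).mul_const B)
    (hK.continuous_integrand hv hf x).aestronglyMeasurable ?_
  filter_upwards [ae_restrict_mem measurableSet_Ioi] with s hs
  exact (hK.norm_smul_le le_rfl (le_of_lt hs) _).trans
    (mul_le_mul_of_nonneg_left (hB s (le_of_lt hs)) (majorant_nonneg v hK.nonneg x s))

/-- Differentiation of the Volterra operator with respect to the lower limit. -/
theorem hasDerivAt_volterra [CompleteSpace V] (hK : IsVolterraKernel K K' c) (hv : IsShortRange v)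
    {f : ℝ → V} (hf : Continuous f) (hB : ∀ x, ∃ B, ∀ s, x ≤ s → ‖f s‖ ≤ B) (x1 : ℝ) :
    HasDerivAt (volterra v K f)
      ((v x1 : ℂ) • K 0 (f x1) - ∫ s in Ioi x1, (v s : ℂ) • K' (x1 - s) (f s)) x1 := by
  let _ : NormedSpace ℝ V := NormedSpace.restrictScalars ℝ ℂ V
  set x0 := x1 - 1 with hx0
  obtain ⟨B, hB'⟩ := hB x0
  have hB0 : 0 ≤ B := (norm_nonneg _).trans (hB' x0 le_rfl)
  have hvc := hv.continuous
  -- the part of the kernel that is constant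
  have hcont0 : Continuous fun s => (v s : ℂ) • K 0 (f s) :=
    (continuous_ofReal.comp hvc).smul ((K 0).continuous.comp hf)
  have hint0 : IntegrableOn (fun s => (v s : ℂ) • K 0 (f s)) (Ioi x0) := by
    refine Integrable.mono' ((hv.integrableOn x0).norm.mul_const (‖K 0‖ * B))
      hcont0.aestronglyMeasurable ?_
    filter_upwards [ae_restrict_mem measurableSet_Ioi] with s hs
    rw [norm_smul, norm_real]
    gcongr
    exact ((K 0).le_opNorm _).trans
      (mul_le_mul_of_nonneg_left (hB' s (le_of_lt hs)) (norm_nonneg _))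
  have hd0 := hasDerivAt_integral_Ioi hcont0 (sub_one_lt x1) hint0
  -- the remaining part, which vanishes at the lower limit
  set L : ℝ → V →L[ℂ] V := fun y => K (min y 0) - K 0 with hL
  have hLc : Continuous L := (hK.continuous.comp (continuous_id.min continuous_const)).sub
    continuous_const
  have hLlip : ∀ y y', ‖L y - L y'‖ ≤ c * |y - y'| := by
    intro y y'
    have h := (convex_Iic (0 : ℝ)).norm_image_sub_le_of_norm_hasDerivWithin_le
      (f := K) (f' := K') (C := c) (s := Iic 0) (x := min y' 0) (y := min y 0)
      (fun z _ => (hK.hasDerivAt z).hasDerivWithinAt) (fun z hz => hK.bound_deriv z hz)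
      (mem_Iic.2 (min_le_right _ _)) (mem_Iic.2 (min_le_right _ _))
    have h2 : |min y 0 - min y' 0| ≤ |y - y'| := by
      simpa using abs_min_sub_min_le_max y 0 y' 0
    simp only [hL, sub_sub_sub_cancel_right]
    exact h.trans (mul_le_mul_of_nonneg_left h2 hK.nonneg)
  set F : ℝ → ℝ → V := fun x s => (v s : ℂ) • L (x - s) (f s) with hF
  set F' : ℝ → V := (Ioi x1).indicator fun s => (v s : ℂ) • K' (x1 - s) (f s) with hF'
  have hFc : ∀ x, Continuous (F x) := fun x => (continuous_ofReal.comp hvc).smul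
    ((hLc.comp (continuous_const.sub continuous_id)).clm_apply hf)
  have hF'c : Continuous fun s => (v s : ℂ) • K' (x1 - s) (f s) :=
    (continuous_ofReal.comp hvc).smul
      ((hK.continuous_deriv.comp (continuous_const.sub continuous_id)).clm_apply hf)
  have hFeq : ∀ x, x0 < x → ∀ s, x < s → F x s = (v s : ℂ) • K (x - s) (f s)
      - (v s : ℂ) • K 0 (f s) := by
    intro x _ s hs
    simp only [hF, hL, min_eq_left (by linarith : x - s ≤ 0), _root_.sub_apply,
      smul_sub]
  have hFzero : ∀ x s, s ≤ x → F x s = 0 := by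
    intro x s hs
    simp only [hF, hL, min_eq_right (by linarith : 0 ≤ x - s), sub_self,
      _root_.zero_apply, smul_zero]
  have hFint : ∀ x, x0 < x → ∫ s in Ioi x0, F x s =
      (∫ s in Ioi x, (v s : ℂ) • K (x - s) (f s)) - ∫ s in Ioi x, (v s : ℂ) • K 0 (f s) := by
    intro x hx
    rw [setIntegral_eq_of_subset_of_forall_sdiff_eq_zero measurableSet_Ioi
      (Ioi_subset_Ioi hx.le) (fun s hs => hFzero x s (not_lt.1 hs.2)),
      ← integral_sub (hK.integrableOn hv hf fun s hs => hB' s (hx.le.trans hs))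
        (hint0.mono_set (Ioi_subset_Ioi hx.le))]
    exact setIntegral_congr_fun measurableSet_Ioi fun s hs => hFeq x hx s hs
  have hFnorm : ∀ x s, x0 ≤ s → ∀ x', ‖F x s - F x' s‖ ≤ c * B * |v s| * |x - x'| := by
    intro x s hs x'
    simp only [hF]
    rw [← smul_sub, ← _root_.sub_apply, norm_smul, norm_real, Real.norm_eq_abs]
    have h1 : ‖(L (x - s) - L (x' - s)) (f s)‖ ≤ c * |x - x'| * B := by
      refine (ContinuousLinearMap.le_opNorm _ _).trans ?_
      refine mul_le_mul ?_ (hB' s hs) (norm_nonneg _) (mul_nonneg hK.nonneg (abs_nonneg _))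
      simpa using hLlip (x - s) (x' - s)
    calc _ ≤ |v s| * (c * |x - x'| * B) := by gcongr
      _ = _ := by ring
  have hdF := (hasDerivAt_integral_of_dominated_loc_of_lip (μ := volume.restrict (Ioi x0))
    (F := F) (F' := F') (x₀ := x1) (s := univ) (bound := fun s => c * B * |v s|) univ_mem
    (Eventually.of_forall fun x => (hFc x).aestronglyMeasurable) ?_
    ((hF'c.stronglyMeasurable.indicator measurableSet_Ioi).aestronglyMeasurable) ?_
    ((hv.integrableOn x0).norm.const_mul (c * B)) ?_).2
  · have hx01 : x0 < x1 := sub_one_lt x1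
    have h3 : HasDerivAt (fun x => -((∫ s in Ioi x0, F x s) + ∫ s in Ioi x, (v s : ℂ) • K 0 (f s)))
        (-((∫ s in Ioi x0, F' s) + -((v x1 : ℂ) • K 0 (f x1)))) x1 := (hdF.add hd0).neg
    have h4 : ∫ s in Ioi x0, F' s = ∫ s in Ioi x1, (v s : ℂ) • K' (x1 - s) (f s) := by
      rw [hF', setIntegral_indicator measurableSet_Ioi,
        inter_eq_self_of_subset_right (Ioi_subset_Ioi hx01.le)]
    rw [h4] at h3
    refine (h3.congr_of_eventuallyEq ?_).congr_deriv (by abel)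
    filter_upwards [lt_mem_nhds hx01] with x hx
    rw [volterra, hFint x hx, sub_add_cancel]
  · have h5 : IntegrableOn (F x1) (Ioi x1) :=
      ((hK.integrableOn hv hf fun s hs => hB' s ((sub_one_lt x1).le.trans hs)).sub
        (hint0.mono_set (Ioi_subset_Ioi (sub_one_lt x1).le))).congr_fun
        (fun s hs => (hFeq x1 (sub_one_lt x1) s hs).symm) measurableSet_Ioi
    exact h5.of_forall_sdiff_eq_zero measurableSet_Ioi fun s hs => hFzero x1 s (not_lt.1 hs.2)
  · filter_upwards [ae_restrict_mem measurableSet_Ioi] with s hs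
    refine LipschitzOnWith.of_dist_le_mul fun x _ x' _ => ?_
    rw [dist_eq_norm, dist_eq_norm, Real.coe_nnabs, abs_of_nonneg
      (mul_nonneg (mul_nonneg hK.nonneg hB0) (abs_nonneg _))]
    exact hFnorm x s (le_of_lt hs) x'
  · have hne : ∀ᵐ s ∂(volume.restrict (Ioi x0)), s ≠ x1 :=
      ae_restrict_of_ae (Measure.ae_ne volume x1)
    filter_upwards [hne] with s hs
    rcases lt_or_gt_of_ne hs with h | h
    · have : F' s = 0 := indicator_of_notMem (by simpa using h.le) _
      rw [this]
      refine (hasDerivAt_const x1 (0 : V)).congr_of_eventuallyEq ?_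
      filter_upwards [lt_mem_nhds h] with x hx using hFzero x s hx.le
    · have h6 : F' s = (v s : ℂ) • K' (x1 - s) (f s) := indicator_of_mem h _
      rw [h6]
      have h7 : HasDerivAt (fun x : ℝ => K (x - s)) (K' (x1 - s)) x1 := by
        exact HasDerivAt.comp_sub_const x1 s (hK.hasDerivAt (x1 - s))
      have h8 : HasDerivAt (fun x : ℝ => (v s : ℂ) • K (x - s) (f s) - (v s : ℂ) • K 0 (f s))
          ((v s : ℂ) • K' (x1 - s) (f s)) x1 := by
        have h9 := (((ContinuousLinearMap.apply ℂ V (f s)).restrictScalars ℝ).hasFDerivAt).comp_hasDerivAt x1 h7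
        exact (h9.const_smul (v s : ℂ)).sub_const _
      refine h8.congr_of_eventuallyEq ?_
      filter_upwards [gt_mem_nhds h, lt_mem_nhds (sub_one_lt x1)] with x hx hx'
      exact hFeq x hx' s hx

end

end Volterra

/-! ### The Neumann series of a Volterra equation -/

section VolterraSolution

open Set

variable {V : Type*} [NormedAddCommGroup V] [NormedSpace ℂ V]

/-- The iterates of the Volterra operator on a constant. -/
def volterraIter (v : ℝ → ℝ) (K : ℝ → V →L[ℂ] V) (w : V) : ℕ → ℝ → V
  | 0 => fun _ => w
  | n + 1 => volterra v K (volterraIter v K w n)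

/-- The Neumann series solving the Volterra equation `f = w - ∫ₓ^∞ v(s) K(x - s) f(s) ds`. -/
def volterraSol (v : ℝ → ℝ) (K : ℝ → V →L[ℂ] V) (w : V) (x : ℝ) : V :=
  ∑' n, volterraIter v K w n x

/-- The tail integral of the majorant; its powers divided by factorials dominate the Neumann
series. -/
def majorantTail (v : ℝ → ℝ) (c x0 x : ℝ) : ℝ := ∫ s in Ioi x, majorant v c x0 s

variable {v : ℝ → ℝ} {K K' : ℝ → V →L[ℂ] V} {c : ℝ}

theorem majorantTail_nonneg (v : ℝ → ℝ) (hc : 0 ≤ c) (x0 x : ℝ) : 0 ≤ majorantTail v c x0 x :=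
  setIntegral_nonneg measurableSet_Ioi fun s _ => majorant_nonneg v hc x0 s

theorem majorantTail_anti (hv : IsShortRange v) (hc : 0 ≤ c) (x0 : ℝ) {x y : ℝ} (h : x ≤ y) :
    majorantTail v c x0 y ≤ majorantTail v c x0 x :=
  integral_Ioi_anti (majorant_nonneg v hc x0) (hv.integrableOn_majorant c x0 x) le_rfl h

/-- Each application of the Volterra operator gains one power of the tail integral over a factorial. -/
theorem IsVolterraKernel.norm_volterra_le (hK : IsVolterraKernel K K' c) (hv : IsShortRange v)
    {f : ℝ → V} {x0 x W : ℝ} {n : ℕ} (hx : x0 ≤ x)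
    (hf : ∀ s, x ≤ s → ‖f s‖ ≤ W * (majorantTail v c x0 s ^ n / n.factorial)) :
    ∫ s in Ioi x, ‖(v s : ℂ) • K (x - s) (f s)‖ ≤
      W * (majorantTail v c x0 x ^ (n + 1) / (n + 1).factorial) := by
  have hg := hv.continuous_majorant c x0
  have hg0 := majorant_nonneg v hK.nonneg x0
  have hi := hv.integrableOn_majorant c x0
  have h1 := integral_mul_tail_pow hg hg0 hi x n
  calc _ ≤ ∫ s in Ioi x, (W / n.factorial) *
        (majorant v c x0 s * (∫ r in Ioi s, majorant v c x0 r) ^ n) := by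
        refine integral_mono_of_nonneg (ae_of_all _ fun s => norm_nonneg _)
          ((integrableOn_mul_tail_pow hg hg0 hi x n).const_mul _) ?_
        filter_upwards [ae_restrict_mem measurableSet_Ioi] with s hs
        refine (hK.norm_smul_le hx (le_of_lt hs) _).trans
          ((mul_le_mul_of_nonneg_left (hf s (le_of_lt hs)) (hg0 s)).trans_eq ?_)
        simp only [majorantTail]; ring
    _ = _ := by
        rw [integral_const_mul, h1, Nat.factorial_succ]
        simp only [majorantTail]
        push_cast
        field_simp

theorem continuous_volterraIter_and_norm_le [CompleteSpace V] (hK : IsVolterraKernel K K' c)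
    (hv : IsShortRange v) (w : V) (n : ℕ) :
    Continuous (volterraIter v K w n) ∧ ∀ x0 x, x0 ≤ x →
      ‖volterraIter v K w n x‖ ≤ ‖w‖ * (majorantTail v c x0 x ^ n / n.factorial) := by
  induction n with
  | zero => exact ⟨continuous_const, fun x0 x _ => by simp [volterraIter]⟩
  | succ n ih =>
    obtain ⟨ih1, ih2⟩ := ih
    refine ⟨continuous_iff_continuousAt.2 fun x =>
      (hasDerivAt_volterra hK hv ih1 (fun x => ⟨‖w‖ * (majorantTail v c x x ^ n / n.factorial),
        fun s hs => (ih2 x s hs).trans ?_⟩) x).continuousAt, fun x0 x hx => ?_⟩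
    · have h1 := majorantTail_anti hv hK.nonneg x hs
      have h2 := majorantTail_nonneg v hK.nonneg x s
      gcongr
    · rw [volterraIter, volterra, norm_neg]
      exact (norm_integral_le_integral_norm _).trans
        (hK.norm_volterra_le hv hx fun s hs => ih2 x0 s (hx.trans hs))

theorem norm_volterraIter_le [CompleteSpace V] (hK : IsVolterraKernel K K' c) (hv : IsShortRange v)
    (w : V) (n : ℕ) {x0 x : ℝ} (hx : x0 ≤ x) : ‖volterraIter v K w n x‖ ≤
      ‖w‖ * (majorantTail v c x0 x0 ^ n / n.factorial) := by
  refine ((continuous_volterraIter_and_norm_le hK hv w n).2 x0 x hx).trans ?_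
  have h1 := majorantTail_anti hv hK.nonneg x0 hx
  have h2 := majorantTail_nonneg v hK.nonneg x0 x
  gcongr

theorem summable_majorant_series (W G : ℝ) :
    Summable fun n : ℕ => W * (G ^ n / n.factorial) := (Real.summable_pow_div_factorial G).mul_left W

theorem continuous_volterraSol [CompleteSpace V] (hK : IsVolterraKernel K K' c)
    (hv : IsShortRange v) (w : V) : Continuous (volterraSol v K w) := by
  refine continuous_iff_continuousAt.2 fun x => ?_
  have : ContinuousOn (volterraSol v K w) (Ici (x - 1)) :=
    continuousOn_tsum (fun n => (continuous_volterraIter_and_norm_le hK hv w n).1.continuousOn)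
      (summable_majorant_series ‖w‖ (majorantTail v c (x - 1) (x - 1)))
      fun n y hy => norm_volterraIter_le hK hv w n hy
  exact this.continuousAt (Ici_mem_nhds (sub_one_lt x))

theorem norm_volterraSol_le [CompleteSpace V] (hK : IsVolterraKernel K K' c) (hv : IsShortRange v)
    (w : V) {x0 x : ℝ} (hx : x0 ≤ x) :
    ‖volterraSol v K w x‖ ≤ ∑' n : ℕ, ‖w‖ * (majorantTail v c x0 x0 ^ n / n.factorial) :=
  tsum_of_norm_bounded (summable_majorant_series _ _).hasSum
    fun n => norm_volterraIter_le hK hv w n hx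

theorem volterraSol_eq [CompleteSpace V] (hK : IsVolterraKernel K K' c) (hv : IsShortRange v)
    (w : V) (x : ℝ) : volterraSol v K w x = w + volterra v K (volterraSol v K w) x := by
  have hsum : ∀ s, x ≤ s → Summable fun n => volterraIter v K w n s := fun s hs =>
    Summable.of_norm_bounded (summable_majorant_series ‖w‖ (majorantTail v c x x))
      fun n => norm_volterraIter_le hK hv w n hs
  have h1 := hasSum_integral_of_summable_integral_norm (μ := volume.restrict (Ioi x))
    (F := fun n s => (v s : ℂ) • K (x - s) (volterraIter v K w n s))
    (fun n => hK.integrableOn hv (continuous_volterraIter_and_norm_le hK hv w n).1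
      fun s hs => norm_volterraIter_le hK hv w n hs)
    (Summable.of_nonneg_of_le (fun n => integral_nonneg fun s => norm_nonneg _)
      (fun n => hK.norm_volterra_le hv le_rfl
        fun s hs => (continuous_volterraIter_and_norm_le hK hv w n).2 x s hs)
      ((summable_nat_add_iff 1).2 (summable_majorant_series ‖w‖ (majorantTail v c x x))))
  have h2 : ∫ s in Ioi x, ∑' n, (v s : ℂ) • K (x - s) (volterraIter v K w n s) =
      ∫ s in Ioi x, (v s : ℂ) • K (x - s) (volterraSol v K w s) := by
    refine setIntegral_congr_fun measurableSet_Ioi fun s hs => ?_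
    have h3 := hsum s (le_of_lt hs)
    simp only [volterraSol]
    rw [ContinuousLinearMap.map_tsum _ h3, Summable.tsum_const_smul]
    exact h3.map (K (x - s)) (K (x - s)).continuous
  rw [h2] at h1
  rw [volterraSol, (hsum x le_rfl).tsum_eq_zero_add, volterra, ← h1.tsum_eq, ← tsum_neg]
  rfl

theorem tendsto_volterraSol [CompleteSpace V] (hK : IsVolterraKernel K K' c)
    (hv : IsShortRange v) (w : V) : Tendsto (volterraSol v K w) atTop (𝓝 w) := by
  have h1 : Tendsto (fun x => w + volterra v K (volterraSol v K w) x) atTop (𝓝 (w + 0)) := by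
    refine tendsto_const_nhds.add ?_
    set B := ∑' n : ℕ, ‖w‖ * (majorantTail v c 0 0 ^ n / n.factorial)
    refine squeeze_zero_norm' (a := fun x => (∫ s in Ioi x, majorant v c 0 s) * B) ?_ ?_
    · filter_upwards [eventually_ge_atTop 0] with x hx
      rw [volterra, norm_neg, ← integral_mul_const]
      refine norm_integral_le_of_norm_le ((hv.integrableOn_majorant c 0 x).mul_const B) ?_
      filter_upwards [ae_restrict_mem measurableSet_Ioi] with s hs
      exact (hK.norm_smul_le hx (le_of_lt hs) _).trans (mul_le_mul_of_nonneg_left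
        (norm_volterraSol_le hK hv w (hx.trans (le_of_lt hs))) (majorant_nonneg v hK.nonneg 0 s))
    · simpa using (tendsto_integral_Ioi_atTop (hv.integrableOn_majorant c 0 0)).mul_const B
  rw [add_zero] at h1
  exact h1.congr fun x => (volterraSol_eq hK hv w x).symm

theorem hasDerivAt_volterraSol [CompleteSpace V] (hK : IsVolterraKernel K K' c)
    (hv : IsShortRange v) (w : V) (x : ℝ) :
    HasDerivAt (volterraSol v K w) ((v x : ℂ) • K 0 (volterraSol v K w x) -
      ∫ s in Ioi x, (v s : ℂ) • K' (x - s) (volterraSol v K w s)) x := by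
  have h := (hasDerivAt_volterra hK hv (continuous_volterraSol hK hv w)
    (fun x => ⟨_, fun s hs => norm_volterraSol_le hK hv w hs⟩) x).const_add w
  exact h.congr_of_eventuallyEq (Eventually.of_forall fun y => volterraSol_eq hK hv w y)

end VolterraSolution

section Parameter

open Set

variable {V : Type*} [NormedAddCommGroup V] [NormedSpace ℂ V]

/-- Holomorphy of an integral depending on a parameter: domination of the integrand suffices,
as Cauchy's estimate dominates its derivative. -/
theorem differentiableOn_integral_of_dominated [CompleteSpace V] {α : Type*} [MeasurableSpace α]
    {μ : Measure α} {F : ℂ → α → V} {S : Set ℂ} (hS : IsOpen S) {b : α → ℝ}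
    (hmeas : ∀ p ∈ S, AEStronglyMeasurable (F p) μ)
    (hb : ∀ᵐ a ∂μ, ∀ p ∈ S, ‖F p a‖ ≤ b a) (hbi : Integrable b μ)
    (hd : ∀ᵐ a ∂μ, DifferentiableOn ℂ (fun p => F p a) S) :
    DifferentiableOn ℂ (fun p => ∫ a, F p a ∂μ) S := by
  intro p0 hp0
  obtain ⟨r, hr, hball⟩ := Metric.isOpen_iff.1 hS p0 hp0
  have hr2 : 0 < r / 2 := half_pos hr
  have hsub : ∀ p ∈ Metric.ball p0 (r / 2), Metric.ball p (r / 2) ⊆ S := fun p hp =>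
    (Metric.ball_subset_ball' (by have := Metric.mem_ball.1 hp; linarith)).trans hball
  have hsub' : Metric.ball p0 (r / 2) ⊆ S :=
    (Metric.ball_subset_ball (by linarith)).trans hball
  refine (hasDerivAt_integral_of_dominated_loc_of_deriv_le (μ := μ) (F := F)
    (F' := fun p a => deriv (fun p => F p a) p) (bound := fun a => b a / (r / 4))
    (Metric.ball_mem_nhds p0 hr2) ?_ ?_ ?_ ?_ (hbi.div_const _) ?_).2.differentiableAt
    |>.differentiableWithinAt
  · filter_upwards [Metric.ball_mem_nhds p0 hr2] with p hp using hmeas p (hsub' hp)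
  · exact hbi.mono' (hmeas p0 hp0) (hb.mono fun a ha => ha p0 hp0)
  · -- the derivative is a limit of difference quotients
    set h : ℕ → ℂ := fun n => p0 + ((r / 2 : ℝ) : ℂ) * ((1 / ((n : ℝ) + 2) : ℝ) : ℂ) with hh
    have hlim : Tendsto h atTop (𝓝 p0) := by
      have h1 : Tendsto (fun n : ℕ => (1 / ((n : ℝ) + 2) : ℝ)) atTop (𝓝 0) :=
        tendsto_const_nhds.div_atTop (tendsto_natCast_atTop_atTop.atTop_add tendsto_const_nhds)
      have h2 := ((continuous_ofReal.tendsto 0).comp h1).const_mul (((r / 2 : ℝ) : ℂ))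
      simpa [hh] using h2.const_add p0
    have hne : ∀ n, h n ≠ p0 := fun n hn => by
      have : ((r / 2 : ℝ) : ℂ) * ((1 / ((n : ℝ) + 2) : ℝ) : ℂ) ≠ 0 :=
        mul_ne_zero (ofReal_ne_zero.2 hr2.ne') (ofReal_ne_zero.2 (by positivity))
      exact this (by simpa [hh] using hn)
    have hin : ∀ n, h n ∈ S := fun n => hball (by
      rw [Metric.mem_ball, dist_eq_norm, hh]
      simp only [add_sub_cancel_left]
      rw [← ofReal_mul, norm_real, Real.norm_of_nonneg (by positivity)]
      have : 1 / ((n : ℝ) + 2) ≤ 1 := by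
        rw [div_le_one (by positivity)]; linarith [(Nat.cast_nonneg n : (0 : ℝ) ≤ n)]
      nlinarith)
    refine aestronglyMeasurable_of_tendsto_ae atTop
      (f := fun n a => slope (fun p => F p a) p0 (h n)) (fun n => ?_) ?_
    · simp only [slope_def_module]
      exact ((hmeas _ (hin n)).sub (hmeas _ hp0)).const_smul _
    · filter_upwards [hd] with a ha
      have h1 := ((ha.differentiableAt (hS.mem_nhds hp0)).hasDerivAt)
      exact (hasDerivAt_iff_tendsto_slope.1 h1).comp
        (tendsto_nhdsWithin_iff.2 ⟨hlim, Eventually.of_forall hne⟩)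
  · filter_upwards [hb, hd] with a ha had p hp
    have hcl : Metric.closedBall p (r / 4) ⊆ S :=
      (Metric.closedBall_subset_ball (by linarith)).trans (hsub p hp)
    refine Complex.norm_deriv_le_of_forall_mem_sphere_norm_le (by positivity) ?_
      fun z hz => ha z (hcl (Metric.sphere_subset_closedBall hz))
    exact (had.mono hcl).diffContOnCl_ball Subset.rfl
  · filter_upwards [hd] with a ha p hp
    exact (ha.differentiableAt (hS.mem_nhds (hsub' hp))).hasDerivAt

variable [CompleteSpace V] {v : ℝ → ℝ} {K K' : ℂ → ℝ → V →L[ℂ] V} {w : ℂ → V} {c W : ℝ}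
  {S : Set ℂ}

theorem aestronglyMeasurable_volterraIter (hv : IsShortRange v)
    (hK : ∀ p ∈ S, IsVolterraKernel (K p) (K' p) c) (n : ℕ) (x : ℝ) {p : ℂ} (hp : p ∈ S) :
    AEStronglyMeasurable (fun s => (v s : ℂ) • K p (x - s) (volterraIter v (K p) (w p) n s))
      (volume.restrict (Ioi x)) :=
  ((hK p hp).continuous_integrand hv
    (continuous_volterraIter_and_norm_le (hK p hp) hv (w p) n).1 x).aestronglyMeasurable

theorem norm_integrand_volterraIter_le (hv : IsShortRange v)
    (hK : ∀ p ∈ S, IsVolterraKernel (K p) (K' p) c) (hw : ∀ p ∈ S, ‖w p‖ ≤ W) (n : ℕ) {x s : ℝ}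
    (hs : x ≤ s) {p : ℂ} (hp : p ∈ S) :
    ‖(v s : ℂ) • K p (x - s) (volterraIter v (K p) (w p) n s)‖ ≤
      majorant v c x s * (W * (majorantTail v c x x ^ n / n.factorial)) := by
  have h1 := majorant_nonneg v (hK p hp).nonneg x s
  have h2 := majorantTail_nonneg v (hK p hp).nonneg x x
  refine ((hK p hp).norm_smul_le le_rfl hs _).trans (mul_le_mul_of_nonneg_left ?_ h1)
  refine (norm_volterraIter_le (hK p hp) hv (w p) n hs).trans ?_
  have := hw p hp
  gcongr

theorem continuousOn_volterraIter (hv : IsShortRange v)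
    (hK : ∀ p ∈ S, IsVolterraKernel (K p) (K' p) c) (hw : ∀ p ∈ S, ‖w p‖ ≤ W)
    (hKc : ∀ y, ContinuousOn (fun p => K p y) S) (hwc : ContinuousOn w S) (n : ℕ) (x : ℝ) :
    ContinuousOn (fun p => volterraIter v (K p) (w p) n x) S := by
  induction n generalizing x with
  | zero => exact hwc
  | succ n ih =>
    refine ContinuousOn.neg (continuousOn_of_dominated
      (bound := fun s => majorant v c x s * (W * (majorantTail v c x x ^ n / n.factorial)))
      (fun p hp => aestronglyMeasurable_volterraIter hv hK n x hp) (fun p hp => ?_)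
      ((hv.integrableOn_majorant c x x).mul_const _) (ae_of_all _ fun s => ?_))
    · filter_upwards [ae_restrict_mem measurableSet_Ioi] with s hs
      exact norm_integrand_volterraIter_le hv hK hw n (le_of_lt hs) hp
    · exact continuousOn_const.smul ((hKc _).clm_apply (ih s))

theorem differentiableOn_volterraIter (hv : IsShortRange v)
    (hK : ∀ p ∈ S, IsVolterraKernel (K p) (K' p) c) (hw : ∀ p ∈ S, ‖w p‖ ≤ W) (hS : IsOpen S)
    (hKc : ∀ y, DifferentiableOn ℂ (fun p => K p y) S) (hwc : DifferentiableOn ℂ w S)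
    (n : ℕ) (x : ℝ) : DifferentiableOn ℂ (fun p => volterraIter v (K p) (w p) n x) S := by
  induction n generalizing x with
  | zero => exact hwc
  | succ n ih =>
    refine DifferentiableOn.neg (differentiableOn_integral_of_dominated hS
      (b := fun s => majorant v c x s * (W * (majorantTail v c x x ^ n / n.factorial)))
      (fun p hp => aestronglyMeasurable_volterraIter hv hK n x hp) ?_
      ((hv.integrableOn_majorant c x x).mul_const _) (ae_of_all _ fun s => ?_))
    · filter_upwards [ae_restrict_mem measurableSet_Ioi] with s hs p hp
      exact norm_integrand_volterraIter_le hv hK hw n (le_of_lt hs) hp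
    · exact ((hKc _).clm_apply (ih s)).const_smul _

theorem norm_volterraIter_le_of_bound (hv : IsShortRange v)
    (hK : ∀ p ∈ S, IsVolterraKernel (K p) (K' p) c) (hw : ∀ p ∈ S, ‖w p‖ ≤ W) (n : ℕ) (x : ℝ)
    {p : ℂ} (hp : p ∈ S) : ‖volterraIter v (K p) (w p) n x‖ ≤
      W * (majorantTail v c x x ^ n / n.factorial) := by
  refine (norm_volterraIter_le (hK p hp) hv (w p) n le_rfl).trans ?_
  have h2 := majorantTail_nonneg v (hK p hp).nonneg x x
  have := hw p hp
  gcongr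

theorem continuousOn_volterraSol (hv : IsShortRange v)
    (hK : ∀ p ∈ S, IsVolterraKernel (K p) (K' p) c) (hw : ∀ p ∈ S, ‖w p‖ ≤ W)
    (hKc : ∀ y, ContinuousOn (fun p => K p y) S) (hwc : ContinuousOn w S) (x : ℝ) :
    ContinuousOn (fun p => volterraSol v (K p) (w p) x) S :=
  continuousOn_tsum (fun n => continuousOn_volterraIter hv hK hw hKc hwc n x)
    (summable_majorant_series W (majorantTail v c x x))
    fun n _ hp => norm_volterraIter_le_of_bound hv hK hw n x hp

theorem differentiableOn_volterraSol (hv : IsShortRange v)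
    (hK : ∀ p ∈ S, IsVolterraKernel (K p) (K' p) c) (hw : ∀ p ∈ S, ‖w p‖ ≤ W) (hS : IsOpen S)
    (hKc : ∀ y, DifferentiableOn ℂ (fun p => K p y) S) (hwc : DifferentiableOn ℂ w S) (x : ℝ) :
    DifferentiableOn ℂ (fun p => volterraSol v (K p) (w p) x) S :=
  differentiableOn_tsum_of_summable_norm
    (summable_majorant_series W (majorantTail v c x x))
    (fun n => differentiableOn_volterraIter hv hK hw hS hKc hwc n x) hS
    fun n _ hp => norm_volterraIter_le_of_bound hv hK hw n x hp

end Parameter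

/-! ### Existence and uniqueness of the Jost solutions -/

theorem E_eq (a : ℝ) (k : ℂ) :
    E a k = !![1, I * a / (k - lam a k); -(I * a / (k - lam a k)), 1] := by
  ext i j
  fin_cases i <;> fin_cases j <;> simp [E, sigma3, Qmat] <;> ring

theorem gam_eq {a : ℝ} (ha : 0 < a) (k : ℂ) : gam a k = -2 * lam a k / (k - lam a k) := by
  have h := sub_lam_ne_zero ha k
  have h2 := sub_mul_add_lam ha k
  rw [gam, E_eq, det_fin_two_of]
  field_simp
  linear_combination ((a : ℂ) ^ 2) * I_sq + h2

theorem laxX_mulVec (v : ℝ) (k : ℂ) (φ : Fin 2 → ℂ) :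
    laxX v k *ᵥ φ = ![I * k * φ 0 + v * φ 1, v * φ 0 - I * k * φ 1] := by
  ext i
  fin_cases i <;> simp [laxX, sigma3, Qmat, Matrix.mulVec, dotProduct, Fin.sum_univ_two]
  ring

/-- `φ` solves `φ_x = X φ` for the profile `u`. -/
def IsSol (u : ℝ → ℝ) (k : ℂ) (φ : ℝ → Fin 2 → ℂ) : Prop :=
  ∀ x, HasDerivAt φ (laxX (u x) k *ᵥ φ x) x

theorem isSol_iff {u : ℝ → ℝ} {k : ℂ} {φ : ℝ → Fin 2 → ℂ} :
    IsSol u k φ ↔ ∀ x, HasDerivAt (fun y => φ y 0) (I * k * φ x 0 + u x * φ x 1) x ∧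
      HasDerivAt (fun y => φ y 1) (u x * φ x 0 - I * k * φ x 1) x := by
  refine forall_congr' fun x => ?_
  rw [laxX_mulVec, hasDerivAt_pi, Fin.forall_fin_two]
  simp

section Uniqueness

variable {u : ℝ → ℝ} {k : ℂ} {φ ψ : ℝ → Fin 2 → ℂ}

theorem IsSol.wronskian_eq (hφ : IsSol u k φ) (hψ : IsSol u k ψ) (x : ℝ) :
    φ x 0 * ψ x 1 - φ x 1 * ψ x 0 = Wr φ ψ := by
  rw [isSol_iff] at hφ hψ
  have hd : ∀ y, HasDerivAt (fun y => φ y 0 * ψ y 1 - φ y 1 * ψ y 0) 0 y := fun y => by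
    refine (((hφ y).1.fun_mul (hψ y).2).fun_sub ((hφ y).2.fun_mul (hψ y).1)).congr_deriv ?_
    ring
  exact is_const_of_deriv_eq_zero (fun y => (hd y).differentiableAt) (fun y => (hd y).deriv) x 0

theorem IsSol.sub_smul (hφ : IsSol u k φ) (hψ : IsSol u k ψ) (c : ℂ) :
    IsSol u k fun x => ψ x - c • φ x := fun x => by
  refine ((hψ x).fun_sub ((hφ x).fun_const_smul c)).congr_deriv ?_
  rw [Matrix.mulVec_sub, Matrix.mulVec_smul]

theorem isSol_zero : IsSol u k fun _ => 0 := fun x => by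
  rw [Matrix.mulVec_zero]; exact hasDerivAt_const x 0

theorem IsSol.eq_zero {B : ℝ} (hu : ∀ x, |u x| ≤ B) (hφ : IsSol u k φ) {x0 : ℝ}
    (h0 : φ x0 = 0) (x : ℝ) : φ x = 0 := by
  have hB : 0 ≤ B := (abs_nonneg _).trans (hu 0)
  have hlip : ∀ t : ℝ, LipschitzOnWith (Real.toNNReal (‖k‖ + B))
      (fun w : Fin 2 → ℂ => laxX (u t) k *ᵥ w) Set.univ := by
    intro t
    refine LipschitzOnWith.of_dist_le_mul fun w _ w' _ => ?_
    rw [dist_eq_norm, dist_eq_norm, ← Matrix.mulVec_sub, laxX_mulVec,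
      Real.coe_toNNReal _ (by positivity)]
    set d := w - w'
    refine (pi_norm_le_iff_of_nonneg (by positivity)).2 fun i => ?_
    have h1 : ‖d 0‖ ≤ ‖d‖ := norm_le_pi_norm d 0
    have h2 : ‖d 1‖ ≤ ‖d‖ := norm_le_pi_norm d 1
    have h3 : ∀ p q : ℂ, ‖p‖ ≤ ‖d‖ → ‖q‖ ≤ ‖d‖ → ‖I * k * p‖ + ‖(u t : ℂ) * q‖ ≤
        (‖k‖ + B) * ‖d‖ := by
      intro p q hp hq
      rw [norm_mul, norm_mul, norm_I, one_mul, norm_mul, norm_real, Real.norm_eq_abs, add_mul]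
      have := hu t
      gcongr
    fin_cases i
    · exact (norm_add_le _ _).trans (h3 _ _ h1 h2)
    · exact (norm_sub_le _ _).trans ((add_comm _ _).trans_le (h3 _ _ h2 h1))
  have := ODE_solution_unique_univ (v := fun t w => laxX (u t) k *ᵥ w) (s := fun _ => Set.univ)
    (g := fun _ => 0) (t₀ := x0) hlip (fun t => ⟨hφ t, trivial⟩)
    (fun t => ⟨isSol_zero t, trivial⟩) h0
  exact congrFun this x

/-- Solutions with vanishing Wronskian are proportional. -/
theorem IsSol.exists_smul {B : ℝ} (hu : ∀ x, |u x| ≤ B) (hφ : IsSol u k φ) (hψ : IsSol u k ψ)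
    (hW : Wr φ ψ = 0) {x0 : ℝ} (h0 : φ x0 ≠ 0) : ∃ c : ℂ, ∀ x, ψ x = c • φ x := by
  have hw := hφ.wronskian_eq hψ x0
  rw [hW] at hw
  obtain ⟨c, hc⟩ : ∃ c : ℂ, ψ x0 = c • φ x0 := by
    by_cases h : φ x0 0 = 0
    · have h1 : φ x0 1 ≠ 0 := fun h1 => h0 (by ext i; fin_cases i <;> simp [h, h1])
      have h2 : ψ x0 0 = 0 := by
        rw [h, zero_mul, zero_sub, neg_eq_zero, mul_eq_zero] at hw
        exact hw.resolve_left h1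
      refine ⟨ψ x0 1 / φ x0 1, ?_⟩
      ext i; fin_cases i <;> simp [h, h2, h1]
    · refine ⟨ψ x0 0 / φ x0 0, ?_⟩
      ext i; fin_cases i
      · simp [h]
      · simp; field_simp; linear_combination hw
  exact ⟨c, fun x => sub_eq_zero.1
    ((hφ.sub_smul hψ c).eq_zero hu (x0 := x0) (by simp [hc]) x)⟩

theorem normalize_eq_exp_smul (a : ℝ) (k : ℂ) (j : Fin 2) (φ : ℝ → Fin 2 → ℂ) (x : ℝ) :
    φ x = exp (-(I * lam a k * x * sigma3 j j)) • normalize a k j φ x := by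
  rw [normalize, smul_smul, ← exp_add, neg_add_cancel, exp_zero, one_smul]

theorem E_diag (a : ℝ) (k : ℂ) (j : Fin 2) : E a k j j = 1 := by
  rw [E_eq]; fin_cases j <;> simp

/-- Jost solutions are unique, for those columns that do not grow: the Wronskian of two of them
tends to zero, so they are proportional. -/
theorem IsJost.unique {B a : ℝ} (hu : ∀ x, |u x| ≤ B) {l : Filter ℝ} [l.NeBot] {j : Fin 2}
    (hφ : IsJost u a l j k φ) (hψ : IsJost u a l j k ψ)
    (hb : ∀ᶠ x : ℝ in l, ‖exp (-(I * lam a k * x * sigma3 j j))‖ ≤ 1) : φ = ψ := by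
  obtain ⟨hφ1, hφ2⟩ := hφ
  obtain ⟨hψ1, hψ2⟩ := hψ
  have hφc := tendsto_pi_nhds.1 hφ2
  have hψc := tendsto_pi_nhds.1 hψ2
  have hW : Wr φ ψ = 0 := by
    have h1 : Tendsto (fun x => normalize a k j φ x 0 * normalize a k j ψ x 1 -
        normalize a k j φ x 1 * normalize a k j ψ x 0) l (𝓝 0) := by
      have := ((hφc 0).mul (hψc 1)).sub ((hφc 1).mul (hψc 0))
      simpa [mul_comm] using this
    have h2 : Tendsto (fun _ : ℝ => Wr φ ψ) l (𝓝 0) := by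
      refine squeeze_zero_norm' ?_ (tendsto_zero_iff_norm_tendsto_zero.1 h1)
      filter_upwards [hb] with x hx
      rw [← IsSol.wronskian_eq hφ1 hψ1 x]
      set e := exp (-(I * lam a k * x * sigma3 j j)) with he
      have h3 : φ x 0 * ψ x 1 - φ x 1 * ψ x 0 = e * e * (normalize a k j φ x 0 *
          normalize a k j ψ x 1 - normalize a k j φ x 1 * normalize a k j ψ x 0) := by
        rw [normalize_eq_exp_smul a k j φ x, normalize_eq_exp_smul a k j ψ x]
        simp only [Pi.smul_apply, smul_eq_mul, ← he]
        ring
      rw [h3, norm_mul, norm_mul]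
      have : ‖e‖ * ‖e‖ ≤ 1 := mul_le_one₀ hx (norm_nonneg _) hx
      exact mul_le_of_le_one_left (norm_nonneg _) this
    exact tendsto_nhds_unique tendsto_const_nhds h2
  have hne : ∀ᶠ x in l, normalize a k j φ x j ≠ 0 :=
    (hφc j).eventually_ne (by rw [E_diag]; exact one_ne_zero)
  obtain ⟨x0, hx0⟩ := hne.exists
  have hφ0 : φ x0 ≠ 0 := fun h => hx0 (by simp [normalize, h])
  obtain ⟨c, hc⟩ := IsSol.exists_smul hu hφ1 hψ1 hW hφ0
  have hc1 : c = 1 := by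
    have h4 : Tendsto (fun x => normalize a k j ψ x j) l (𝓝 (c * E a k j j)) := by
      refine ((hφc j).const_mul c).congr fun x => ?_
      simp only [normalize, hc x, Pi.smul_apply, smul_eq_mul]; ring
    have := tendsto_nhds_unique h4 (hψc j)
    rwa [E_diag, mul_one] at this
  funext x
  rw [hc x, hc1, one_smul]

end Uniqueness

/-- The phase factors of the columns which do not grow. -/
theorem norm_exp_phase_le {a : ℝ} {k : ℂ} {x : ℝ} {j : Fin 2}
    (h : (lam a k).im * x * (if j = 0 then 1 else -1) ≤ 0) :
    ‖exp (-(I * lam a k * x * sigma3 j j))‖ ≤ 1 := by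
  rw [norm_exp, Real.exp_le_one_iff]
  fin_cases j <;> simp [sigma3] at h ⊢ <;> linarith

theorem jost_eq {u : ℝ → ℝ} {B a : ℝ} (hu : ∀ x, |u x| ≤ B) {l : Filter ℝ} [l.NeBot] {j : Fin 2}
    {k : ℂ} {φ : ℝ → Fin 2 → ℂ} (hφ : IsJost u a l j k φ)
    (hb : ∀ᶠ x : ℝ in l, ‖exp (-(I * lam a k * x * sigma3 j j))‖ ≤ 1) : jost u a l j k = φ := by
  have h : ∃ φ, IsJost u a l j k φ := ⟨φ, hφ⟩
  rw [jost, dif_pos h]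
  exact IsJost.unique hu h.choose_spec hφ hb

section Kernel

/-- The linear map of a matrix, as a continuous linear map of `ℂ²`. -/
def matCLM (A : Matrix (Fin 2) (Fin 2) ℂ) : (Fin 2 → ℂ) →L[ℂ] (Fin 2 → ℂ) :=
  (Matrix.mulVecLin A).toContinuousLinearMap

/-- The exchange of the components of `ℂ²`. -/
def swapCLM : (Fin 2 → ℂ) →L[ℂ] (Fin 2 → ℂ) := matCLM !![0, 1; 1, 0]

/-- `X_a - i l`, the generator of the unperturbed evolution of a normalized Jost solution. -/
def genCLM (a : ℝ) (k l : ℂ) : (Fin 2 → ℂ) →L[ℂ] (Fin 2 → ℂ) :=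
  (I * k) • matCLM sigma3 + (a : ℂ) • swapCLM - (I * l) • ContinuousLinearMap.id ℂ _

theorem swapCLM_apply (v : Fin 2 → ℂ) : swapCLM v = ![v 1, v 0] := by
  ext i; fin_cases i <;> simp [swapCLM, matCLM, Matrix.mulVec, dotProduct, Fin.sum_univ_two]

theorem genCLM_apply (a : ℝ) (k l : ℂ) (v : Fin 2 → ℂ) : genCLM a k l v =
    ![I * (k - l) * v 0 + a * v 1, a * v 0 - I * (k + l) * v 1] := by
  ext i
  fin_cases i <;> simp [genCLM, swapCLM, matCLM, sigma3, dotProduct,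
    Fin.sum_univ_two] <;> ring

/-- `(1 - e^{-2ily}) / (2il)`, extended analytically to `l = 0`. -/
def phaseInt (l : ℂ) (y : ℝ) : ℂ := y * dslope exp 0 (-(2 * I * l * y))

theorem two_I_mul_phaseInt (l : ℂ) (y : ℝ) :
    2 * I * l * phaseInt l y = 1 - exp (-(2 * I * l * y)) := by
  have h := sub_smul_dslope exp 0 (-(2 * I * l * y))
  rw [smul_eq_mul, sub_zero, exp_zero] at h
  rw [phaseInt]; linear_combination -h

theorem hasDerivAt_phaseInt (l : ℂ) (y : ℝ) :
    HasDerivAt (phaseInt l) (exp (-(2 * I * l * y))) y := by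
  by_cases hl : l = 0
  · have : phaseInt l = fun y : ℝ => (y : ℂ) := by
      funext y; simp [phaseInt, hl, dslope_same]
    rw [this, hl]
    simpa using (hasDerivAt_id y).ofReal_comp
  · have hne : 2 * I * l ≠ 0 := by simp [hl]
    have h1 : phaseInt l = fun y : ℝ => (1 - exp (-(2 * I * l * y))) / (2 * I * l) := by
      funext y; rw [← two_I_mul_phaseInt]; field_simp
    rw [h1]
    have h2 : HasDerivAt (fun y : ℝ => -(2 * I * l * (y : ℂ))) (-(2 * I * l)) y := by
      simpa using ((hasDerivAt_id y).ofReal_comp.const_mul (2 * I * l)).fun_neg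
    refine ((h2.cexp.const_sub 1).div_const (2 * I * l)).congr_deriv ?_
    field_simp

theorem differentiable_phaseInt (y : ℝ) : Differentiable ℂ fun l => phaseInt l y := by
  have h : Differentiable ℂ (dslope exp 0) := by
    rw [← differentiableOn_univ]
    exact (differentiableOn_dslope univ_mem).2 differentiable_exp.differentiableOn
  unfold phaseInt
  exact (h.comp (by fun_prop : Differentiable ℂ fun l : ℂ => -(2 * I * l * y))).const_mul _

theorem re_phase_nonpos {l : ℂ} (hl : 0 ≤ l.im) {y : ℝ} (hy : y ≤ 0) :
    (-(2 * I * l * y)).re ≤ 0 := by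
  have : (-(2 * I * l * y)).re = 2 * (l.im * y) := by simp; ring
  rw [this]; nlinarith

theorem norm_phase_le {l : ℂ} (hl : 0 ≤ l.im) {y : ℝ} (hy : y ≤ 0) :
    ‖exp (-(2 * I * l * y))‖ ≤ 1 := by
  rw [norm_exp, Real.exp_le_one_iff]; exact re_phase_nonpos hl hy

theorem norm_phaseInt_le {l : ℂ} (hl : 0 ≤ l.im) {y : ℝ} (hy : y ≤ 0) :
    ‖phaseInt l y‖ ≤ |y| := by
  have h1 : ∀ b : ℂ, b.re ≤ 0 → ‖dslope exp 0 b‖ ≤ 1 := by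
    intro b hb
    by_cases h0 : b = 0
    · simp [h0, dslope_same]
    · have h2 := (convex_halfSpace_re_le (0 : ℝ)).norm_image_sub_le_of_norm_deriv_le (𝕜 := ℂ)
        (f := exp) (C := 1) (x := 0) (y := b) (fun z _ => differentiable_exp z)
        (fun z hz => by
          rw [Complex.deriv_exp, norm_exp, Real.exp_le_one_iff]; exact hz) (by simp) hb
      have h3 := sub_smul_dslope exp 0 b
      rw [← h3, norm_smul] at h2
      have h4 : 0 < ‖b - 0‖ := by simpa using h0
      rw [mul_comm] at h2
      exact le_of_mul_le_mul_right h2 h4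
  rw [phaseInt, norm_mul, norm_real, Real.norm_eq_abs]
  exact mul_le_of_le_one_right (abs_nonneg _) (h1 _ (re_phase_nonpos hl hy))

/-- The kernel `e^{(X_a - i l) y} σ₁` of the Volterra equation of a normalized Jost solution. -/
def jostKernel (a : ℝ) (k l : ℂ) (y : ℝ) : (Fin 2 → ℂ) →L[ℂ] (Fin 2 → ℂ) :=
  swapCLM + phaseInt l y • (genCLM a k l ∘L swapCLM)

/-- The derivative of `jostKernel`. -/
def jostKernelDeriv (a : ℝ) (k l : ℂ) (y : ℝ) : (Fin 2 → ℂ) →L[ℂ] (Fin 2 → ℂ) :=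
  exp (-(2 * I * l * y)) • (genCLM a k l ∘L swapCLM)

theorem isVolterraKernel_jostKernel (a : ℝ) {k l : ℂ} (hl : 0 ≤ l.im) {c : ℝ}
    (hc : ‖swapCLM‖ + ‖genCLM a k l ∘L swapCLM‖ ≤ c) :
    IsVolterraKernel (jostKernel a k l) (jostKernelDeriv a k l) c where
  hasDerivAt y := ((hasDerivAt_phaseInt l y).smul_const _).const_add _
  continuous_deriv := by
    have : Continuous fun y : ℝ => exp (-(2 * I * l * y)) := by fun_prop
    exact this.smul continuous_const
  bound y hy := by
    have h1 := norm_nonneg (swapCLM)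
    have h2 := norm_nonneg (genCLM a k l ∘L swapCLM)
    calc ‖jostKernel a k l y‖ ≤ ‖swapCLM‖ + |y| * ‖genCLM a k l ∘L swapCLM‖ := by
          refine (norm_add_le _ _).trans ?_
          rw [norm_smul]
          have := norm_phaseInt_le hl hy
          gcongr
      _ ≤ c * (1 + |y|) := by nlinarith [abs_nonneg y]
  bound_deriv y hy := by
    have h1 := norm_nonneg (swapCLM)
    have h2 := norm_nonneg (genCLM a k l ∘L swapCLM)
    rw [jostKernelDeriv, norm_smul]
    nlinarith [norm_phase_le hl hy, norm_nonneg (exp (-(2 * I * l * y)))]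

end Kernel

/-- A bounded profile which approaches `a` at `+∞` with an integrable first moment. -/
structure IsProfile (u : ℝ → ℝ) (a : ℝ) : Prop where
  bounded : ∃ B, ∀ x, |u x| ≤ B
  shortRange : IsShortRange fun x => u x - a

/-- The normalized Jost solution `μ_{+,2}`, as the solution of its Volterra equation. -/
def jostMu (u : ℝ → ℝ) (a : ℝ) (k : ℂ) : ℝ → Fin 2 → ℂ :=
  volterraSol (fun x => u x - a) (jostKernel a k (lam a k)) fun i => E a k i 1

theorem genCLM_jostKernel {a : ℝ} (ha : 0 < a) (k : ℂ) (y : ℝ) (v : Fin 2 → ℂ) :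
    genCLM a k (lam a k) (jostKernel a k (lam a k) y v) =
      jostKernelDeriv a k (lam a k) y v := by
  have h1 := lam_sq ha k
  have h2 := two_I_mul_phaseInt (lam a k) y
  set p := phaseInt (lam a k) y
  set l := lam a k
  have h3 : exp (-(2 * I * l * y)) = 1 - 2 * I * l * p := by rw [h2]; ring
  simp only [jostKernel, jostKernelDeriv, h3, _root_.add_apply, _root_.smul_apply,
    ContinuousLinearMap.comp_apply, swapCLM_apply, genCLM_apply]
  ext i
  fin_cases i
  · simp
    linear_combination (p * v 1) * (k ^ 2 - l ^ 2) * I_sq + (p * v 1) * h1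
  · simp
    linear_combination (p * v 0) * (k ^ 2 - l ^ 2) * I_sq + (p * v 0) * h1

/-- The column of `E` is an eigenvector of `X_a`, so the unperturbed evolution fixes it. -/
theorem genCLM_E {a : ℝ} (ha : 0 < a) (k : ℂ) :
    genCLM a k (lam a k) (fun i => E a k i 1) = 0 := by
  have h := sub_lam_ne_zero ha k
  have h2 := sub_mul_add_lam ha k
  rw [genCLM_apply]
  ext i
  fin_cases i
  · simp [E_eq]; field_simp; linear_combination (a : ℂ) * I_sq
  · simp [E_eq]; field_simp; linear_combination -I * h2

theorem isVolterraKernel_jost (a : ℝ) (k : ℂ) :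
    IsVolterraKernel (jostKernel a k (lam a k)) (jostKernelDeriv a k (lam a k))
      (‖swapCLM‖ + ‖genCLM a k (lam a k) ∘L swapCLM‖) :=
  isVolterraKernel_jostKernel a (lam_im_nonneg a k) le_rfl

section Jost

variable {u : ℝ → ℝ} {a : ℝ}

theorem hasDerivAt_jostMu (hu : IsProfile u a) (ha : 0 < a) (k : ℂ) (x : ℝ) :
    HasDerivAt (jostMu u a k) (((u x - a : ℝ) : ℂ) • swapCLM (jostMu u a k x) +
      genCLM a k (lam a k) (jostMu u a k x)) x := by
  have hK := isVolterraKernel_jost a k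
  have hv := hu.shortRange
  have h := hasDerivAt_volterraSol hK hv (fun i => E a k i 1) x
  have h0 : jostKernel a k (lam a k) 0 = swapCLM := by
    ext v i
    simp [jostKernel, phaseInt]
  have h1 : genCLM a k (lam a k) (jostMu u a k x) = -∫ s in Set.Ioi x, ((u s - a : ℝ) : ℂ) •
      jostKernelDeriv a k (lam a k) (x - s) (jostMu u a k s) := by
    have h2 := volterraSol_eq hK hv (fun i => E a k i 1) x
    rw [jostMu, h2, map_add, genCLM_E ha, zero_add, volterra, map_neg,
      ← ContinuousLinearMap.integral_comp_comm]
    · congr 2 with s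
      rw [map_smul, genCLM_jostKernel ha]
    · exact hK.integrableOn hv (continuous_volterraSol hK hv _)
        fun s hs => norm_volterraSol_le hK hv _ hs
  rw [h1, ← sub_eq_add_neg]
  rw [h0] at h
  exact h

/-- Existence of the Jost solution `φ_{+,2}`. -/
theorem isJost_exp_smul_jostMu (hu : IsProfile u a) (ha : 0 < a) (k : ℂ) :
    IsJost u a atTop 1 k fun x => exp (I * lam a k * x) • jostMu u a k x := by
  constructor
  · intro x
    have h1 : HasDerivAt (fun x : ℝ => exp (I * lam a k * x))
        (exp (I * lam a k * x) * (I * lam a k)) x := by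
      have h2 : HasDerivAt (fun y : ℝ => I * lam a k * (y : ℂ)) (I * lam a k) x := by
        simpa using (hasDerivAt_id x).ofReal_comp.const_mul (I * lam a k)
      exact h2.cexp
    refine (h1.smul (hasDerivAt_jostMu hu ha k x)).congr_deriv ?_
    rw [laxX_mulVec, genCLM_apply, swapCLM_apply]
    ext i
    fin_cases i <;> simp <;> ring
  · have h := tendsto_volterraSol (isVolterraKernel_jost a k) hu.shortRange fun i => E a k i 1
    refine h.congr fun x => ?_
    rw [normalize, smul_smul, ← exp_add]
    simp [sigma3, jostMu]

theorem eventually_phase_atTop (a : ℝ) (k : ℂ) :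
    ∀ᶠ x : ℝ in atTop, ‖exp (-(I * lam a k * x * sigma3 1 1))‖ ≤ 1 := by
  filter_upwards [eventually_ge_atTop 0] with x hx
  refine norm_exp_phase_le ?_
  have := mul_nonneg (lam_im_nonneg a k) hx
  simpa

theorem phiPlus_one_eq_of_isJost (hu : IsProfile u a) {k : ℂ} {φ : ℝ → Fin 2 → ℂ}
    (h : IsJost u a atTop 1 k φ) : phiPlus u a 1 k = φ := by
  obtain ⟨B, hB⟩ := hu.bounded
  exact jost_eq hB h (eventually_phase_atTop a k)

theorem phiPlus_one_eq (hu : IsProfile u a) (ha : 0 < a) (k : ℂ) :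
    phiPlus u a 1 k = fun x : ℝ => exp (I * lam a k * x) • jostMu u a k x :=
  phiPlus_one_eq_of_isJost hu (isJost_exp_smul_jostMu hu ha k)

theorem isJost_phiPlus_one (hu : IsProfile u a) (ha : 0 < a) (k : ℂ) :
    IsJost u a atTop 1 k (phiPlus u a 1 k) := by
  rw [phiPlus_one_eq hu ha k]; exact isJost_exp_smul_jostMu hu ha k

theorem muPlus_one_eq (hu : IsProfile u a) (ha : 0 < a) (k : ℂ) :
    muPlus u a 1 k = jostMu u a k := by
  funext x
  rw [muPlus, phiPlus_one_eq hu ha, normalize, smul_smul, ← exp_add]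
  simp [sigma3]

theorem continuousOn_genCLM {S : Set ℂ} (hS : ContinuousOn (lam a) S) :
    ContinuousOn (fun k => genCLM a k (lam a k)) S := by
  unfold genCLM; fun_prop

theorem continuousOn_E_col {S : Set ℂ} (ha : 0 < a) (hS : ContinuousOn (lam a) S) :
    ContinuousOn (fun k => fun i => E a k i 1) S := by
  refine continuousOn_pi.2 fun i => ?_
  have h : ContinuousOn (fun k => I * a / (k - lam a k)) S :=
    continuousOn_const.div (continuousOn_id.sub hS) fun k _ => sub_lam_ne_zero ha k
  fin_cases i
  · simpa [E_eq] using h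
  · simp [E_eq, continuousOn_const]

theorem differentiableOn_E_col {S : Set ℂ} (ha : 0 < a) (hS : DifferentiableOn ℂ (lam a) S) :
    DifferentiableOn ℂ (fun k => fun i => E a k i 1) S := by
  refine differentiableOn_pi.2 fun i => ?_
  have h : DifferentiableOn ℂ (fun k => I * a / (k - lam a k)) S :=
    (differentiableOn_const _).div (differentiableOn_id.sub hS) fun k _ => sub_lam_ne_zero ha k
  fin_cases i
  · simpa [E_eq] using h
  · simp [E_eq, differentiableOn_const]

theorem continuousOn_jostMu (hu : IsProfile u a) (ha : 0 < a) {S : Set ℂ}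
    (hS : ContinuousOn (lam a) S) (x : ℝ) : ContinuousOn (fun k => jostMu u a k x) S := by
  intro k0 hk0
  have hg := continuousOn_genCLM hS
  have hgn : ContinuousOn (fun k => ‖genCLM a k (lam a k) ∘L swapCLM‖) S :=
    (hg.clm_comp continuousOn_const).norm
  have hE := continuousOn_E_col ha hS
  set c := ‖genCLM a k0 (lam a k0) ∘L swapCLM‖ + 1
  set W := ‖fun i => E a k0 i 1‖ + 1
  set S' := {k | k ∈ S ∧ ‖genCLM a k (lam a k) ∘L swapCLM‖ ≤ c ∧ ‖fun i => E a k i 1‖ ≤ W}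
  have hS' : S' ∈ 𝓝[S] k0 := by
    filter_upwards [self_mem_nhdsWithin, (hgn k0 hk0).eventually (gt_mem_nhds (lt_add_one _)),
      (hE.norm k0 hk0).eventually (gt_mem_nhds (lt_add_one _))] with k h1 h2 h3
    exact ⟨h1, h2.le, h3.le⟩
  have hSS : S' ⊆ S := fun k hk => hk.1
  have hc : ContinuousOn (fun k => jostMu u a k x) S' := by
    refine continuousOn_volterraSol hu.shortRange (c := ‖swapCLM‖ + c) (W := W)
      (fun k hk => isVolterraKernel_jostKernel a (lam_im_nonneg a k)
        (by have := hk.2.1; gcongr)) (fun k hk => hk.2.2) (fun y => ?_) (hE.mono hSS) x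
    refine continuousOn_const.add (ContinuousOn.fun_smul ?_ ((hg.mono hSS).clm_comp continuousOn_const))
    exact (differentiable_phaseInt y).continuous.comp_continuousOn (hS.mono hSS)
  exact (hc k0 (mem_of_mem_nhdsWithin hk0 hS')).mono_of_mem_nhdsWithin hS'

theorem differentiableOn_jostMu (hu : IsProfile u a) (ha : 0 < a) (x : ℝ) :
    DifferentiableOn ℂ (fun k => jostMu u a k x) (cutC a)ᶜ := by
  intro k0 hk0
  set S := (cutC a)ᶜ
  have hSo : IsOpen S := (isClosed_cutC a).isOpen_compl
  have hS : DifferentiableOn ℂ (lam a) S := differentiableOn_lam a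
  have hg : DifferentiableOn ℂ (fun k => genCLM a k (lam a k)) S := by
    unfold genCLM; fun_prop
  have hgn : ContinuousOn (fun k => ‖genCLM a k (lam a k) ∘L swapCLM‖) S :=
    (hg.continuousOn.clm_comp continuousOn_const).norm
  have hE := differentiableOn_E_col ha hS
  set c := ‖genCLM a k0 (lam a k0) ∘L swapCLM‖ + 1
  set W := ‖fun i => E a k0 i 1‖ + 1
  obtain ⟨S', hS'sub, hS'o, hk0'⟩ := mem_nhds_iff.1 <| show
      {k | k ∈ S ∧ ‖genCLM a k (lam a k) ∘L swapCLM‖ ≤ c ∧ ‖fun i => E a k i 1‖ ≤ W} ∈ 𝓝 k0 by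
    have hn : 𝓝[S] k0 = 𝓝 k0 := hSo.nhdsWithin_eq hk0
    rw [← hn]
    filter_upwards [self_mem_nhdsWithin, (hgn k0 hk0).eventually (gt_mem_nhds (lt_add_one _)),
      (hE.continuousOn.norm k0 hk0).eventually (gt_mem_nhds (lt_add_one _))] with k h1 h2 h3
    exact ⟨h1, h2.le, h3.le⟩
  have hSS : S' ⊆ S := fun k hk => (hS'sub hk).1
  have hd : DifferentiableOn ℂ (fun k => jostMu u a k x) S' := by
    refine differentiableOn_volterraSol hu.shortRange (c := ‖swapCLM‖ + c) (W := W)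
      (fun k hk => isVolterraKernel_jostKernel a (lam_im_nonneg a k)
        (by have := (hS'sub hk).2.1; gcongr)) (fun k hk => (hS'sub hk).2.2) hS'o
        (fun y => ?_) (hE.mono hSS) x
    refine (differentiableOn_const _).add (DifferentiableOn.fun_smul ?_
      ((hg.mono hSS).clm_comp (differentiableOn_const _)))
    exact (differentiable_phaseInt y).comp_differentiableOn (hS.mono hSS)
  exact (hd.differentiableAt (hS'o.mem_nhds hk0')).differentiableWithinAt

end Jost

/-! ### Symmetries of the Jost solutions and their Wronskian -/

section Symmetries

variable {u : ℝ → ℝ} {a : ℝ}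

theorem IsJost.exists_ne_zero {l : Filter ℝ} [l.NeBot] {j : Fin 2} {k : ℂ} {φ : ℝ → Fin 2 → ℂ}
    (h : IsJost u a l j k φ) : ∃ x, φ x ≠ 0 := by
  have hne : ∀ᶠ x in l, normalize a k j φ x j ≠ 0 :=
    (tendsto_pi_nhds.1 h.2 j).eventually_ne (by rw [E_diag]; exact one_ne_zero)
  obtain ⟨x, hx⟩ := hne.exists
  exact ⟨x, fun h => hx (by simp [normalize, h])⟩

/-- The rotated reflection `φ ↦ (φ₂, -φ₁)(-x)`, which turns Jost solutions at `+∞` into Jost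
solutions at `-∞` of the reflected profile. -/
def reflect (φ : ℝ → Fin 2 → ℂ) (x : ℝ) : Fin 2 → ℂ := ![φ (-x) 1, -φ (-x) 0]

theorem isJost_reflect {k : ℂ} {φ : ℝ → Fin 2 → ℂ}
    (h : IsJost (fun x => u (-x)) a atTop 1 k φ) : IsJost u a atBot 0 k (reflect φ) := by
  obtain ⟨h1, h2⟩ := h
  constructor
  · refine isSol_iff.2 fun x => ?_
    obtain ⟨d0, d1⟩ := isSol_iff.1 h1 (-x)
    rw [neg_neg] at d0 d1
    have e0 : HasDerivAt (fun y => φ (-y) 0) (-(I * k * φ (-x) 0 + u x * φ (-x) 1)) x :=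
      (HasDerivAt.scomp x d0 (hasDerivAt_neg' x)).congr_deriv (neg_one_smul ℝ _)
    have e1 : HasDerivAt (fun y => φ (-y) 1) (-(u x * φ (-x) 0 - I * k * φ (-x) 1)) x :=
      (HasDerivAt.scomp x d1 (hasDerivAt_neg' x)).congr_deriv (neg_one_smul ℝ _)
    refine ⟨e1.congr_deriv ?_, e0.fun_neg.congr_deriv ?_⟩
    · simp [reflect]; ring
    · simp [reflect]; ring
  · have h3 := tendsto_pi_nhds.1 (h2.comp tendsto_neg_atBot_atTop)
    refine tendsto_pi_nhds.2 fun i => ?_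
    fin_cases i
    · refine ((h3 1).congr fun x => ?_).trans (by simp [E_eq])
      simp [normalize, reflect, sigma3]
    · refine ((h3 0).neg.congr fun x => ?_).trans (by simp [E_eq])
      simp [normalize, reflect, sigma3]

theorem eventually_phase_atBot (a : ℝ) (k : ℂ) :
    ∀ᶠ x : ℝ in atBot, ‖exp (-(I * lam a k * x * sigma3 0 0))‖ ≤ 1 := by
  filter_upwards [eventually_le_atBot 0] with x hx
  refine norm_exp_phase_le ?_
  simpa using mul_nonpos_of_nonneg_of_nonpos (lam_im_nonneg a k) hx

/-- A bounded profile which approaches `a` at `-∞` with an integrable first moment. -/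
def IsLeftProfile (u : ℝ → ℝ) (a : ℝ) : Prop := IsProfile (fun x => u (-x)) a

theorem IsLeftProfile.bounded (hu : IsLeftProfile u a) : ∃ B, ∀ x, |u x| ≤ B := by
  obtain ⟨B, hB⟩ := IsProfile.bounded hu
  exact ⟨B, fun x => by simpa using hB (-x)⟩

theorem isJost_phiMinus_zero (hu : IsLeftProfile u a) (ha : 0 < a) (k : ℂ) :
    IsJost u a atBot 0 k (phiMinus u a 0 k) := by
  obtain ⟨B, hB⟩ := hu.bounded
  have h := isJost_reflect (isJost_phiPlus_one hu ha k)
  rwa [phiMinus, jost_eq hB h (eventually_phase_atBot a k)]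

theorem phiMinus_zero_eq (hu : IsLeftProfile u a) (ha : 0 < a) (k : ℂ) :
    phiMinus u a 0 k = reflect (phiPlus (fun x => u (-x)) a 1 k) := by
  obtain ⟨B, hB⟩ := hu.bounded
  exact jost_eq hB (isJost_reflect (isJost_phiPlus_one hu ha k)) (eventually_phase_atBot a k)

theorem muMinus_zero_eq (hu : IsLeftProfile u a) (ha : 0 < a) (k : ℂ) :
    muMinus u a 0 k = reflect (jostMu (fun x => u (-x)) a k) := by
  funext x
  rw [muMinus, phiMinus_zero_eq hu ha, phiPlus_one_eq hu ha, normalize]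
  ext i
  fin_cases i <;> simp [reflect, sigma3, ← mul_assoc, ← exp_add]

/-- `φ ↦ σ₁ φ̄`. -/
def conjSwap (v : Fin 2 → ℂ) : Fin 2 → ℂ := ![conj (v 1), conj (v 0)]

theorem IsSol.conjSwap {k : ℂ} {φ : ℝ → Fin 2 → ℂ} (h : IsSol u k φ) :
    IsSol u (conj k) fun x => conjSwap (φ x) := by
  refine isSol_iff.2 fun x => ?_
  obtain ⟨h0, h1⟩ := isSol_iff.1 h x
  have e0 := conjCLE.toContinuousLinearMap.hasFDerivAt.comp_hasDerivAt x h0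
  have e1 := conjCLE.toContinuousLinearMap.hasFDerivAt.comp_hasDerivAt x h1
  refine ⟨HasDerivAt.congr_deriv (f := fun y => conj (φ y 1)) e1 ?_,
    HasDerivAt.congr_deriv (f := fun y => conj (φ y 0)) e0 ?_⟩
  · simp [MKdV.conjSwap]; ring
  · simp [MKdV.conjSwap]; ring

theorem tendsto_conjSwap {l : Filter ℝ} {f : ℝ → Fin 2 → ℂ} {v : Fin 2 → ℂ}
    (h : Tendsto f l (𝓝 v)) : Tendsto (fun x => conjSwap (f x)) l (𝓝 (conjSwap v)) := by
  have h' := tendsto_pi_nhds.1 h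
  refine tendsto_pi_nhds.2 fun i => ?_
  fin_cases i
  · exact (continuous_conj.tendsto _).comp (h' 1)
  · exact (continuous_conj.tendsto _).comp (h' 0)

theorem conj_lam_of_mem_cutC {k : ℂ} (hk : k ∈ cutC a) : conj (lam a k) = lam a k :=
  conj_eq_iff_im.2 (lam_im_eq_zero hk)

theorem conj_of_mem_cutC {k : ℂ} (hk : k ∈ cutC a) : conj k = k := conj_eq_iff_im.2 hk.1

/-- On the cut, complex conjugation exchanges the columns of a Jost solution. -/
theorem IsJost.conjSwap_cut {l : Filter ℝ} {j j' : Fin 2} (hj : j' = 1 - j) {k : ℂ}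
    {φ : ℝ → Fin 2 → ℂ} (hk : k ∈ cutC a) (h : IsJost u a l j k φ) :
    IsJost u a l j' k fun x => conjSwap (φ x) := by
  subst hj
  have hl := conj_lam_of_mem_cutC hk
  have hk' := conj_of_mem_cutC hk
  refine ⟨?_, ?_⟩
  · have := IsSol.conjSwap h.1
    rwa [hk'] at this
  · have h2 := tendsto_conjSwap h.2
    have e1 : (fun i => E a k i (1 - j)) = conjSwap fun i => E a k i j := by
      ext i
      fin_cases i <;> fin_cases j <;>
        simp [conjSwap, E_eq, hl, hk'] <;> ring
    rw [e1]
    refine h2.congr fun x => ?_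
    ext i
    fin_cases i <;> fin_cases j <;>
      simp [conjSwap, normalize, sigma3, ← Complex.exp_conj, hl]

theorem eventually_phase_of_mem_cutC {k : ℂ} (hk : k ∈ cutC a) (l : Filter ℝ) (j : Fin 2) :
    ∀ᶠ x : ℝ in l, ‖exp (-(I * lam a k * x * sigma3 j j))‖ ≤ 1 :=
  Eventually.of_forall fun x => norm_exp_phase_le (by rw [lam_im_eq_zero hk]; simp)

theorem phiPlus_zero_eq (hu : IsProfile u a) (ha : 0 < a) {k : ℂ} (hk : k ∈ cutC a) :
    phiPlus u a 0 k = fun x => conjSwap (phiPlus u a 1 k x) := by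
  obtain ⟨B, hB⟩ := hu.bounded
  have h := (isJost_phiPlus_one hu ha k).conjSwap_cut (j' := 0) (by decide) hk
  rw [phiPlus]
  exact jost_eq hB h (eventually_phase_of_mem_cutC hk _ _)

theorem phiMinus_one_eq (hu : IsLeftProfile u a) (ha : 0 < a) {k : ℂ} (hk : k ∈ cutC a) :
    phiMinus u a 1 k = fun x => conjSwap (phiMinus u a 0 k x) := by
  obtain ⟨B, hB⟩ := hu.bounded
  have h := (isJost_phiMinus_zero hu ha k).conjSwap_cut (j' := 1) (by decide) hk
  rw [phiMinus]
  exact jost_eq hB h (eventually_phase_of_mem_cutC hk _ _)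

/-- The factor relating the Jost solutions at `k` and `k̄`. -/
theorem conj_col_factor (ha : 0 < a) {k : ℂ} (hk : k ∉ cutC a) :
    I * a / (conj k - lam a (conj k)) * conj (I * a / (k - lam a k)) = 1 := by
  rw [lam_conj ha hk]
  have h1 := sub_lam_ne_zero ha k
  have h2 := add_lam_ne_zero ha k
  have h3 := congrArg conj (sub_mul_add_lam ha k)
  have h4 : conj k - conj (lam a k) ≠ 0 := by
    rw [← map_sub]; exact (map_ne_zero _).2 h1
  have h5 : conj k + conj (lam a k) ≠ 0 := by
    rw [← map_add]; exact (map_ne_zero _).2 h2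
  simp only [map_mul, map_sub, map_add, map_div₀, conj_I, conj_ofReal, map_pow] at h3 ⊢
  rw [sub_neg_eq_add]
  field_simp
  linear_combination -h3 - (a : ℂ) ^ 2 * I_sq

/-- Off the cut `λ(k̄) = -conj λ(k)`, so that `σ₁ conj φ_{+,2}(k)` decays like `φ_{+,2}(k̄)`. -/
theorem phiPlus_one_conj (hu : IsProfile u a) (ha : 0 < a) {k : ℂ} (hk : k ∉ cutC a) :
    phiPlus u a 1 (conj k) = fun x =>
      (I * a / (conj k - lam a (conj k))) • conjSwap (phiPlus u a 1 k x) := by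
  have h := isJost_phiPlus_one hu ha k
  set c := I * a / (conj k - lam a (conj k)) with hc
  have hfac := conj_col_factor ha hk
  refine phiPlus_one_eq_of_isJost hu ⟨?_, ?_⟩
  · intro x
    refine ((IsSol.conjSwap h.1 x).fun_const_smul c).congr_deriv ?_
    rw [Matrix.mulVec_smul]
  · have h2 := (tendsto_conjSwap h.2).const_smul c
    have e1 : (fun i => E a (conj k) i 1) = c • conjSwap fun i => E a k i 1 := by
      ext i
      fin_cases i
      · simp [conjSwap, E_eq, hc]
      · simpa [conjSwap, E_eq, hc] using hfac.symm
    rw [e1]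
    refine h2.congr fun x => ?_
    ext i
    fin_cases i <;>
      simp [conjSwap, normalize, sigma3, ← Complex.exp_conj, lam_conj ha hk] <;> ring_nf

theorem muPlus_one_conj (hu : IsProfile u a) (ha : 0 < a) {k : ℂ} (hk : k ∉ cutC a) (x : ℝ) :
    muPlus u a 1 (conj k) x =
      (I * a / (conj k - lam a (conj k))) • conjSwap (muPlus u a 1 k x) := by
  rw [muPlus, phiPlus_one_conj hu ha hk, muPlus]
  ext i
  fin_cases i <;> simp [conjSwap, normalize, sigma3, ← Complex.exp_conj, lam_conj ha hk] <;> ring_nf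

theorem muMinus_zero_conj (hu : IsLeftProfile u a) (ha : 0 < a) {k : ℂ} (hk : k ∉ cutC a) (x : ℝ) :
    muMinus u a 0 (conj k) x =
      (-(I * a / (conj k - lam a (conj k)))) • conjSwap (muMinus u a 0 k x) := by
  have h := muPlus_one_conj hu ha hk (-x)
  rw [muPlus_one_eq hu ha, muPlus_one_eq hu ha] at h
  rw [muMinus_zero_eq hu ha, muMinus_zero_eq hu ha, reflect, reflect, h]
  ext i
  fin_cases i <;> simp [conjSwap]

end Symmetries

section Spectrum

variable {u : ℝ → ℝ} {qm qp : ℝ}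

theorem tendsto_phase_atTop {a : ℝ} {k : ℂ} (hk : k ∉ cutC a) :
    Tendsto (fun x : ℝ => exp (I * lam a k * x)) atTop (𝓝 0) := by
  rw [tendsto_exp_nhds_zero_iff]
  have : (fun x : ℝ => (I * lam a k * x).re) = fun x : ℝ => -(lam a k).im * x := by
    funext x; simp
  rw [this]
  exact tendsto_id.const_mul_atTop_of_neg (neg_lt_zero.2 (lam_im_pos hk))

theorem tendsto_phiPlus_one {a : ℝ} (hu : IsProfile u a) (ha : 0 < a) {k : ℂ} (hk : k ∉ cutC a) :
    Tendsto (phiPlus u a 1 k) atTop (𝓝 0) := by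
  rw [phiPlus_one_eq hu ha]
  have h := (isJost_phiPlus_one hu ha k).2
  have h2 : Tendsto (jostMu u a k) atTop _ := h.congr fun x => congrFun (muPlus_one_eq hu ha k) x
  simpa using (tendsto_phase_atTop hk).smul h2

theorem tendsto_phiMinus_zero {a : ℝ} (hu : IsLeftProfile u a) (ha : 0 < a) {k : ℂ}
    (hk : k ∉ cutC a) : Tendsto (phiMinus u a 0 k) atBot (𝓝 0) := by
  rw [phiMinus_zero_eq hu ha]
  have h := tendsto_pi_nhds.1 ((tendsto_phiPlus_one hu ha hk).comp tendsto_neg_atBot_atTop)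
  refine tendsto_pi_nhds.2 fun i => ?_
  fin_cases i
  · simpa [reflect] using h 1
  · simpa [reflect] using (h 0).neg

/-- A bound state at a non-real `k` is impossible: `|φ₁|² - |φ₂|²` would be strictly monotone and
vanish at both ends of the line. -/
theorem IsSol.eq_zero_of_decay {k : ℂ} (hk : k.im ≠ 0) {φ : ℝ → Fin 2 → ℂ} (h : IsSol u k φ)
    (hl : Tendsto φ atBot (𝓝 0)) (hr : Tendsto φ atTop (𝓝 0)) (x : ℝ) : φ x = 0 := by
  rw [isSol_iff] at h
  have hn : ∀ (f : ℝ → ℂ) (f' : ℂ) (y : ℝ), HasDerivAt f f' y →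
      HasDerivAt (fun y => normSq (f y)) (2 * ((f y).re * f'.re + (f y).im * f'.im)) y := by
    intro f f' y hf
    have e1 := reCLM.hasFDerivAt.comp_hasDerivAt y hf
    have e2 := imCLM.hasFDerivAt.comp_hasDerivAt y hf
    have e3 := (e1.mul e1).add (e2.mul e2)
    refine HasDerivAt.congr_deriv (f := fun y => normSq (f y)) (e3.congr_of_eventuallyEq
      (Eventually.of_forall fun z => ?_)) ?_
    · simp [normSq_apply]
    · simp; ring
  set f : ℝ → ℝ := fun y => k.im * (normSq (φ y 0) - normSq (φ y 1)) with hf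
  have hd : ∀ y, HasDerivAt f (-2 * k.im ^ 2 * (normSq (φ y 0) + normSq (φ y 1))) y := by
    intro y
    refine (((hn _ _ y (h y).1).fun_sub (hn _ _ y (h y).2)).const_mul k.im).congr_deriv ?_
    simp [normSq_apply]; ring
  have hanti : Antitone f := by
    refine antitone_of_deriv_nonpos (fun y => (hd y).differentiableAt) fun y => ?_
    rw [(hd y).deriv]
    have := normSq_nonneg (φ y 0)
    have := normSq_nonneg (φ y 1)
    have := sq_nonneg k.im
    nlinarith [mul_nonneg this (add_nonneg (normSq_nonneg (φ y 0)) (normSq_nonneg (φ y 1)))]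
  have hlim : ∀ l : Filter ℝ, Tendsto φ l (𝓝 0) → Tendsto f l (𝓝 0) := by
    intro l hφ
    have h' := tendsto_pi_nhds.1 hφ
    have e0 := (continuous_normSq.tendsto _).comp (h' 0)
    have e1 := (continuous_normSq.tendsto _).comp (h' 1)
    simpa using (e0.sub e1).const_mul k.im
  have hzero : f = fun _ => 0 := by
    funext y
    exact le_antisymm (hanti.ge_of_tendsto (hlim _ hl) y) (hanti.le_of_tendsto (hlim _ hr) y)
  have h0 := (hd x).unique (by rw [hzero]; exact hasDerivAt_const x 0)
  have h1 : normSq (φ x 0) + normSq (φ x 1) = 0 := by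
    have : -2 * k.im ^ 2 ≠ 0 := by positivity
    exact (mul_eq_zero.1 h0).resolve_left this
  have h2 := normSq_nonneg (φ x 0)
  have h3 := normSq_nonneg (φ x 1)
  ext i
  fin_cases i
  · exact normSq_eq_zero.1 (by linarith : normSq (φ x 0) = 0)
  · exact normSq_eq_zero.1 (by linarith : normSq (φ x 1) = 0)

/-- The Wronskian of `φ_{-,1}` and `φ_{+,2}`. -/
def jostWr (u : ℝ → ℝ) (qm qp : ℝ) (k : ℂ) : ℂ := Wr (phiMinus u qm 0 k) (phiPlus u qp 1 k)

/-- A profile which approaches `qm` at `-∞` and `qp` at `+∞`, with `0 < qp < qm`. -/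
structure IsStep (u : ℝ → ℝ) (qm qp : ℝ) : Prop where
  pos : 0 < qp
  lt : qp < qm
  left : IsLeftProfile u qm
  right : IsProfile u qp

theorem IsStep.pos' (h : IsStep u qm qp) : 0 < qm := h.pos.trans h.lt

theorem cutC_anti {a b : ℝ} (h : a ≤ b) : cutC b ⊆ cutC a := fun _ hk => ⟨hk.1, h.trans hk.2⟩

theorem IsStep.notMem (h : IsStep u qm qp) {k : ℂ} (hk : k ∉ cutC qp) : k ∉ cutC qm :=
  fun h' => hk (cutC_anti h.lt.le h')

/-- At a zero of the Wronskian the two Jost solutions are proportional. -/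
theorem IsStep.exists_smul_of_jostWr_eq_zero (h : IsStep u qm qp) {k : ℂ}
    (hW : jostWr u qm qp k = 0) :
    ∃ c : ℂ, ∀ x, phiMinus u qm 0 k x = c • phiPlus u qp 1 k x := by
  obtain ⟨B, hB⟩ := h.right.bounded
  have h1 := isJost_phiPlus_one h.right h.pos k
  have h2 := isJost_phiMinus_zero h.left h.pos' k
  obtain ⟨x0, hx0⟩ := h1.exists_ne_zero
  refine IsSol.exists_smul hB h1.1 h2.1 ?_ hx0
  rw [jostWr, Wr] at hW
  rw [Wr]; linear_combination -hW

/-- Off the real line both Jost solutions decay at their ends, so a zero of the Wronskian would be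
a bound state. -/
theorem IsStep.jostWr_ne_zero (h : IsStep u qm qp) {k : ℂ} (hk : k.im ≠ 0) :
    jostWr u qm qp k ≠ 0 := by
  intro hW
  obtain ⟨c, hc⟩ := h.exists_smul_of_jostWr_eq_zero hW
  have hkp : k ∉ cutC qp := fun h => hk h.1
  have h2 := isJost_phiMinus_zero h.left h.pos' k
  obtain ⟨x0, hx0⟩ := h2.exists_ne_zero
  refine hx0 (IsSol.eq_zero_of_decay hk h2.1 (tendsto_phiMinus_zero h.left h.pos' (h.notMem hkp))
    ?_ x0)
  have h3 := (tendsto_phiPlus_one h.right h.pos hkp).const_smul c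
  rw [smul_zero] at h3
  exact h3.congr fun x => (hc x).symm

theorem jostWr_eq (u : ℝ → ℝ) (qm qp : ℝ) (k : ℂ) :
    jostWr u qm qp k = muMinus u qm 0 k 0 0 * muPlus u qp 1 k 0 1 -
      muMinus u qm 0 k 0 1 * muPlus u qp 1 k 0 0 := by
  simp [jostWr, Wr, muMinus, muPlus, normalize]

theorem continuousOn_muPlus {a : ℝ} (hu : IsProfile u a) (ha : 0 < a) (x : ℝ) :
    ContinuousOn (fun k => muPlus u a 1 k x) {k | 0 ≤ k.im} :=
  (continuousOn_jostMu hu ha (continuousOn_lam ha) x).congr fun k _ =>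
    congrFun (muPlus_one_eq hu ha k) x

theorem differentiableOn_muPlus {a : ℝ} (hu : IsProfile u a) (ha : 0 < a) (x : ℝ) :
    DifferentiableOn ℂ (fun k => muPlus u a 1 k x) (cutC a)ᶜ :=
  (differentiableOn_jostMu hu ha x).congr fun k _ => congrFun (muPlus_one_eq hu ha k) x

theorem continuousOn_muMinus {a : ℝ} (hu : IsLeftProfile u a) (ha : 0 < a) (x : ℝ) :
    ContinuousOn (fun k => muMinus u a 0 k x) {k | 0 ≤ k.im} := by
  have h := continuousOn_pi.1 (continuousOn_jostMu hu ha (continuousOn_lam ha) (-x))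
  have : (fun k => muMinus u a 0 k x) = fun k => reflect (jostMu (fun x => u (-x)) a k) x :=
    funext fun k => congrFun (muMinus_zero_eq hu ha k) x
  rw [this]
  refine continuousOn_pi.2 fun i => ?_
  fin_cases i
  · exact h 1
  · exact (h 0).neg

theorem differentiableOn_muMinus {a : ℝ} (hu : IsLeftProfile u a) (ha : 0 < a) (x : ℝ) :
    DifferentiableOn ℂ (fun k => muMinus u a 0 k x) (cutC a)ᶜ := by
  have h := differentiableOn_pi.1 (differentiableOn_jostMu hu ha (-x))
  have : (fun k => muMinus u a 0 k x) = fun k => reflect (jostMu (fun x => u (-x)) a k) x :=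
    funext fun k => congrFun (muMinus_zero_eq hu ha k) x
  rw [this]
  refine differentiableOn_pi.2 fun i => ?_
  fin_cases i
  · exact h 1
  · exact (h 0).neg

theorem IsStep.continuousOn_jostWr (h : IsStep u qm qp) :
    ContinuousOn (jostWr u qm qp) {k | 0 ≤ k.im} := by
  have e1 := continuousOn_pi.1 (continuousOn_muMinus h.left h.pos' 0)
  have e2 := continuousOn_pi.1 (continuousOn_muPlus h.right h.pos 0)
  exact (((e1 0).mul (e2 1)).sub ((e1 1).mul (e2 0))).congr fun k _ => jostWr_eq u qm qp k

theorem IsStep.differentiableOn_jostWr (h : IsStep u qm qp) :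
    DifferentiableOn ℂ (jostWr u qm qp) (cutC qp)ᶜ := by
  have e1 := differentiableOn_pi.1 ((differentiableOn_muMinus h.left h.pos' 0).mono
    (Set.compl_subset_compl.2 (cutC_anti h.lt.le)))
  have e2 := differentiableOn_pi.1 (differentiableOn_muPlus h.right h.pos 0)
  exact (((e1 0).mul (e2 1)).sub ((e1 1).mul (e2 0))).congr fun k _ => jostWr_eq u qm qp k

end Spectrum

/-! ### Large parameter asymptotics of a Jost solution -/

section LargeParameter

open Set

/-- A solution of `η' = c η + f` with `Re c ≥ 0` that vanishes at `+∞` is bounded by the tail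
integral of `|f|`. -/
theorem norm_le_integral_of_dissipative {η c f : ℝ → ℂ} {g : ℝ → ℝ} {x : ℝ}
    (hη : ∀ y, HasDerivAt η (c y * η y + f y) y) (hc : Continuous c) (hf : Continuous f)
    (hre : ∀ y, 0 ≤ (c y).re) (hlim : Tendsto η atTop (𝓝 0)) (hg : IntegrableOn g (Ioi x))
    (hfg : ∀ y, x ≤ y → ‖f y‖ ≤ g y) {y : ℝ} (hy : x ≤ y) :
    ‖η y‖ ≤ ∫ s in Ioi x, g s := by
  -- the integrating factor does not grow, as `Re c ≥ 0`
  set P : ℝ → ℂ := fun t => ∫ s in y..t, c s with hP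
  have hPd : ∀ t, HasDerivAt P (c t) t := fun t =>
    intervalIntegral.integral_hasDerivAt_right (hc.intervalIntegrable _ _)
      (hc.stronglyMeasurableAtFilter _ _) hc.continuousAt
  have hPc : Continuous P := continuous_iff_continuousAt.2 fun t => (hPd t).continuousAt
  have hPre : ∀ t, y ≤ t → ‖exp (-P t)‖ ≤ 1 := by
    intro t ht
    rw [norm_exp, Real.exp_le_one_iff, neg_re, neg_nonpos]
    have : (P t).re = ∫ s in y..t, (c s).re :=
      (reCLM.intervalIntegral_comp_comm (hc.intervalIntegrable y t)).symm
    rw [this]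
    exact intervalIntegral.integral_nonneg ht fun s _ => hre s
  set w : ℝ → ℂ := fun t => exp (-P t) * η t with hw
  have hwd : ∀ t, HasDerivAt w (exp (-P t) * f t) t := by
    intro t
    refine ((hPd t).fun_neg.cexp.fun_mul (hη t)).congr_deriv ?_
    ring
  have hwlim : Tendsto w atTop (𝓝 0) := by
    refine squeeze_zero_norm' ?_ (tendsto_zero_iff_norm_tendsto_zero.1 hlim)
    filter_upwards [eventually_ge_atTop y] with t ht
    rw [hw, norm_mul]
    exact mul_le_of_le_one_left (norm_nonneg _) (hPre t ht)
  have hbound : ∀ᵐ t ∂(volume.restrict (Ioi y)), ‖exp (-P t) * f t‖ ≤ g t := by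
    filter_upwards [ae_restrict_mem measurableSet_Ioi] with t ht
    rw [norm_mul]
    exact (mul_le_of_le_one_left (norm_nonneg _) (hPre t (le_of_lt ht))).trans
      (hfg t (hy.trans (le_of_lt ht)))
  have hgy : IntegrableOn g (Ioi y) := hg.mono_set (Ioi_subset_Ioi hy)
  have hint : IntegrableOn (fun t => exp (-P t) * f t) (Ioi y) :=
    Integrable.mono' hgy (by fun_prop : Continuous fun t => exp (-P t) * f t).aestronglyMeasurable
      hbound
  have h1 := integral_Ioi_of_hasDerivAt_of_tendsto' (fun t _ => hwd t) hint hwlim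
  have h2 : w y = η y := by simp [hw, hP]
  have h3 : ‖η y‖ = ‖∫ t in Ioi y, exp (-P t) * f t‖ := by rw [h1, h2, zero_sub, norm_neg]
  rw [h3]
  refine (norm_integral_le_of_norm_le hgy hbound).trans ?_
  refine setIntegral_mono_set hg ?_ (Ioi_subset_Ioi hy).eventuallyLE
  filter_upwards [ae_restrict_mem measurableSet_Ioi] with t ht
  exact (norm_nonneg _).trans (hfg t (le_of_lt ht))

theorem exists_forall_norm_le_of_tendsto {f : ℝ → ℂ} (hf : Continuous f) {l : ℂ}
    (hl : Tendsto f atTop (𝓝 l)) (x : ℝ) : ∃ M, ∀ y, x ≤ y → ‖f y‖ ≤ M := by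
  obtain ⟨N, hN⟩ := eventually_atTop.1 (hl.norm.eventually (gt_mem_nhds (lt_add_one ‖l‖)))
  obtain ⟨M, hM⟩ := (isCompact_Icc (a := x) (b := N)).exists_bound_of_continuousOn hf.continuousOn
  refine ⟨max M (‖l‖ + 1), fun y hy => ?_⟩
  rcases le_total y N with h | h
  · exact (hM y ⟨hy, h⟩).trans (le_max_left _ _)
  · exact (hN y h).le.trans (le_max_right _ _)

/-- A profile with two derivatives `u1`, `u2`, which are integrable. -/
structure IsSmoothProfile (u u1 u2 : ℝ → ℝ) (a : ℝ) : Prop extends IsProfile u a where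
  deriv_one : ∀ x, HasDerivAt u (u1 x) x
  deriv_two : ∀ x, HasDerivAt u1 (u2 x) x
  continuous_two : Continuous u2
  integrable_one : Integrable u1
  integrable_two : Integrable u2

section

variable {u u1 u2 : ℝ → ℝ} {a : ℝ}

theorem IsSmoothProfile.continuous (h : IsSmoothProfile u u1 u2 a) : Continuous u :=
  continuous_iff_continuousAt.2 fun x => (h.deriv_one x).continuousAt

theorem IsSmoothProfile.continuous_one (h : IsSmoothProfile u u1 u2 a) : Continuous u1 :=
  continuous_iff_continuousAt.2 fun x => (h.deriv_two x).continuousAt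

theorem IsSmoothProfile.tendsto_one (h : IsSmoothProfile u u1 u2 a) : Tendsto u1 atTop (𝓝 0) :=
  tendsto_zero_of_hasDerivAt_of_integrableOn_Ioi (a := 0) (fun x _ => h.deriv_two x)
    h.integrable_two.integrableOn h.integrable_one.integrableOn

theorem IsSmoothProfile.tendsto (h : IsSmoothProfile u u1 u2 a) : Tendsto u atTop (𝓝 a) := by
  have h1 : Tendsto (fun x => u x - a) atTop (𝓝 0) :=
    tendsto_zero_of_hasDerivAt_of_integrableOn_Ioi (a := 0)
      (fun x _ => (h.deriv_one x).sub_const a) h.integrable_one.integrableOn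
      (h.shortRange.integrableOn 0)
  simpa using h1.add_const a

theorem IsSmoothProfile.bounded_one (h : IsSmoothProfile u u1 u2 a) (x : ℝ) :
    |u1 x| ≤ ∫ s, |u2 s| := by
  have h1 := integral_Ioi_of_hasDerivAt_of_tendsto' (a := x) (fun y _ => h.deriv_two y)
    h.integrable_two.integrableOn h.tendsto_one
  have h2 : |u1 x| = ‖∫ s in Ioi x, u2 s‖ := by
    rw [h1, zero_sub, norm_neg, Real.norm_eq_abs]
  rw [h2]
  exact (norm_integral_le_integral_norm _).trans (setIntegral_le_integral h.integrable_two.norm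
    (ae_of_all _ fun s => norm_nonneg _))

/-- The size of the coefficients of the diagonalized system. -/
def roughness (u u1 u2 : ℝ → ℝ) (a s : ℝ) : ℝ := |u2 s| + |u s - a| + |u1 s|

theorem IsSmoothProfile.integrableOn_roughness (h : IsSmoothProfile u u1 u2 a) (x : ℝ) :
    IntegrableOn (roughness u u1 u2 a) (Ioi x) :=
  ((h.integrable_two.abs.integrableOn).add (h.shortRange.integrableOn x).norm).add
    h.integrable_one.abs.integrableOn

/-- Bounds for the two coefficients of `ν'` after the first elimination. -/
theorem norm_elim_coeff_le {v v1 v2 B : ℝ} {ε : ℂ} (hB : 1 ≤ B) (hv : |v| ≤ B) (ha : |a| ≤ B)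
    (hv1 : |v1| ≤ B) (he : 4 * B * ‖ε‖ ≤ 1) :
    ‖ε ^ 2 * (-v2 + v * (v ^ 2 - a ^ 2) + I * ε * v1 * (2 * v ^ 2 - a ^ 2) - ε ^ 2 * v * v1 ^ 2)‖ ≤
      2 * B ^ 2 * ‖ε‖ ^ 2 * (|v2| + |v - a| + |v1|) := by
  set e := ‖ε‖ with he'
  have he0 : 0 ≤ e := norm_nonneg _
  have he4 : e ≤ 1 / 4 := by nlinarith
  have hB0 : 0 ≤ B := by linarith
  have e1 : ‖(v : ℂ)‖ ≤ B := by rwa [norm_real]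
  have e2 : ‖(a : ℂ)‖ ≤ B := by rwa [norm_real]
  have e3 : ‖(v1 : ℂ)‖ = |v1| := norm_real _
  have e4 : ‖(v : ℂ) ^ 2 - (a : ℂ) ^ 2‖ ≤ 2 * B * |v - a| := by
    have : (v : ℂ) ^ 2 - (a : ℂ) ^ 2 = (v + a) * ((v - a : ℝ) : ℂ) := by push_cast; ring
    rw [this, norm_mul, norm_real, Real.norm_eq_abs]
    gcongr
    exact (norm_add_le _ _).trans (by linarith)
  have e5 : ‖2 * (v : ℂ) ^ 2 - (a : ℂ) ^ 2‖ ≤ 3 * B ^ 2 := by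
    refine (norm_sub_le _ _).trans ?_
    rw [norm_mul, norm_pow, norm_pow, norm_ofNat]
    have := pow_le_pow_left₀ (norm_nonneg _) e1 2
    have := pow_le_pow_left₀ (norm_nonneg _) e2 2
    linarith
  have t1 : ‖-(v2 : ℂ) + v * (v ^ 2 - a ^ 2) + I * ε * v1 * (2 * v ^ 2 - a ^ 2)
      - ε ^ 2 * v * v1 ^ 2‖ ≤ |v2| + B * (2 * B * |v - a|) + e * |v1| * (3 * B ^ 2)
        + e ^ 2 * B * (|v1| * B) := by
    refine (norm_sub_le _ _).trans (add_le_add ((norm_add_le _ _).trans (add_le_add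
      ((norm_add_le _ _).trans (add_le_add ?_ ?_)) ?_)) ?_)
    · rw [norm_neg, norm_real, Real.norm_eq_abs]
    · rw [norm_mul]; gcongr
    · rw [norm_mul, norm_mul, norm_mul, norm_I, one_mul, e3]; gcongr
    · rw [norm_mul, norm_mul, norm_pow, norm_pow, e3, pow_two |v1|]; gcongr
  rw [norm_mul, norm_pow]
  calc e ^ 2 * _ ≤ e ^ 2 * (|v2| + B * (2 * B * |v - a|) + e * |v1| * (3 * B ^ 2)
        + e ^ 2 * B * (|v1| * B)) := by gcongr
    _ ≤ e ^ 2 * (2 * B ^ 2 * (|v2| + |v - a| + |v1|)) := by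
        refine mul_le_mul_of_nonneg_left ?_ (by positivity)
        have f1 : |v2| ≤ 2 * B ^ 2 * |v2| := le_mul_of_one_le_left (abs_nonneg _) (by nlinarith)
        have f2 : e * |v1| * (3 * B ^ 2) + e ^ 2 * B * (|v1| * B) ≤ 2 * B ^ 2 * |v1| := by
          have : (3 * e + e ^ 2) ≤ 2 := by nlinarith
          have h0 : 0 ≤ B ^ 2 * |v1| := by positivity
          nlinarith
        linarith
    _ = _ := by ring

set_option maxHeartbeats 1600000 in
/-- The large parameter asymptotics of a normalized Jost solution. Eliminating the oscillating
component twice makes all coefficients integrable; the solution is then close to its limit at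
`+∞`. Here `ζ` stands for `k + λ`, so that `a ^ 2 * ε = k - λ`, and `(n0, n1)` is the Jost solution
divided by its large factor. -/
theorem IsSmoothProfile.norm_le_of_large {B x : ℝ} (h : IsSmoothProfile u u1 u2 a) (hB : 1 ≤ B)
    (hu : ∀ y, |u y| ≤ B) (ha : |a| ≤ B) (hu1 : ∀ y, |u1 y| ≤ B) {ζ ε : ℂ} (hζ : ζ * ε = 1)
    (him : 0 ≤ ζ.im) {n0 n1 : ℝ → ℂ}
    (d0 : ∀ y, HasDerivAt n0 (I * a ^ 2 * ε * n0 y + u y * n1 y) y)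
    (d1 : ∀ y, HasDerivAt n1 (-I * ζ * n1 y + u y * n0 y) y)
    (l0 : Tendsto n0 atTop (𝓝 1)) (l1 : Tendsto n1 atTop (𝓝 (-I * a * ε)))
    (he : 4 * B * ‖ε‖ ≤ 1) {G : ℝ} (hG : ∫ s in Ioi x, roughness u u1 u2 a s = G)
    (he2 : 16 * B * ‖ε‖ * G ≤ 1) :
    ‖n0 x - 1‖ ≤ 16 * B * G * ‖ε‖ ∧
      ‖n1 x + I * u x * ε‖ ≤ (2 * B + 22 * B ^ 2 * G) * ‖ε‖ ^ 2 := by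
  set e := ‖ε‖ with hedef
  set g := roughness u u1 u2 a with hg
  have he0 : 0 ≤ e := norm_nonneg _
  have hB0 : 0 ≤ B := by linarith
  have he4 : e ≤ 1 / 4 := by nlinarith
  have hBe : B * e ≤ 1 / 4 := by linarith
  have hζ0 : ζ ≠ 0 := left_ne_zero_of_mul_eq_one hζ
  have hε0 : ε ≠ 0 := right_ne_zero_of_mul_eq_one hζ
  have hepos : 0 < e := norm_pos_iff.2 hε0
  have hζn : ‖ζ‖ * e = 1 := by rw [hedef, ← norm_mul, hζ, norm_one]
  have hg0 : ∀ s, 0 ≤ g s := fun s => by simp only [hg, roughness]; positivity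
  have hgi := h.integrableOn_roughness x
  have hG0 : 0 ≤ G := hG ▸ setIntegral_nonneg measurableSet_Ioi fun s _ => hg0 s
  have huc := h.continuous
  have hu1c := h.continuous_one
  have hu2c := h.continuous_two
  have hn0c : Continuous n0 := continuous_iff_continuousAt.2 fun y => (d0 y).continuousAt
  have hn1c : Continuous n1 := continuous_iff_continuousAt.2 fun y => (d1 y).continuousAt
  have hud : ∀ y, HasDerivAt (fun y => (u y : ℂ)) (u1 y) y := fun y => (h.deriv_one y).ofReal_comp
  have hu1d : ∀ y, HasDerivAt (fun y => (u1 y : ℂ)) (u2 y) y :=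
    fun y => (h.deriv_two y).ofReal_comp
  -- first elimination: `η` is the component transversal to the slow direction
  set r : ℝ → ℂ := fun y => -I * u y * ε + u1 y * ε ^ 2 with hr
  set η : ℝ → ℂ := fun y => n1 y - r y * n0 y with hη
  set c : ℝ → ℂ := fun y => -I * ζ + I * u y ^ 2 * ε with hc
  set b : ℝ → ℂ := fun y => ε ^ 2 * (-u2 y + u y * (u y ^ 2 - a ^ 2)
    + I * ε * u1 y * (2 * u y ^ 2 - a ^ 2) - ε ^ 2 * u y * u1 y ^ 2) with hb
  have hηd : ∀ y, HasDerivAt η (c y * η y + (b y * n0 y - u y * u1 y * ε ^ 2 * η y)) y := by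
    intro y
    have hrd : HasDerivAt r (-I * u1 y * ε + u2 y * ε ^ 2) y :=
      ((((hud y).const_mul (-I)).mul_const ε).fun_add ((hu1d y).mul_const (ε ^ 2)))
    refine ((d1 y).fun_sub (hrd.fun_mul (d0 y))).congr_deriv ?_
    simp only [hη, hc, hb, hr]
    linear_combination (n0 y * u y * I ^ 2 - n0 y * I * u1 y * ε) * hζ
      + (n0 y * u y + (n0 y * u y * a ^ 2 * ε ^ 2) - u y ^ 3 * n0 y * ε ^ 2) * I_sq
  have hcre : ∀ y, 0 ≤ (c y).re := by
    intro y
    have hεim : ε.im ≤ 0 := by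
      have h1 := congrArg (fun z => (z * conj ε)) hζ
      simp only [mul_assoc, mul_conj, one_mul] at h1
      have h2 := congrArg im h1
      rw [im_mul_ofReal, conj_im] at h2
      have := mul_nonneg him (normSq_nonneg ε)
      linarith
    have : (c y).re = ζ.im - u y ^ 2 * ε.im := by
      simp [hc, pow_two]
      ring
    rw [this]
    nlinarith [sq_nonneg (u y)]
  have hun : ∀ y, ‖(u y : ℂ)‖ ≤ B := fun y => by rw [norm_real]; exact hu y
  have hu1n : ∀ y, ‖(u1 y : ℂ)‖ = |u1 y| := fun y => norm_real _
  have hcn : ∀ y, 1 ≤ 2 * e * ‖c y‖ := by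
    intro y
    have h1 : ‖ζ‖ ≤ ‖c y‖ + B ^ 2 * e := by
      have h2 : -I * ζ = c y - I * u y ^ 2 * ε := by simp only [hc]; ring
      have h3 : ‖ζ‖ = ‖-I * ζ‖ := by rw [norm_mul, norm_neg, norm_I, one_mul]
      rw [h3, h2]
      refine (norm_sub_le _ _).trans ?_
      rw [norm_mul, norm_mul, norm_I, one_mul, norm_pow]
      have := hun y
      gcongr
    have h4 : (B * e) * (B * e) ≤ 1 / 4 * (1 / 4) := mul_le_mul hBe hBe (by positivity) (by norm_num)
    have h5 : ‖ζ‖ * e ≤ (‖c y‖ + B ^ 2 * e) * e := mul_le_mul_of_nonneg_right h1 he0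
    nlinarith
  have hc0 : ∀ y, c y ≠ 0 := fun y h0 => by
    have := hcn y
    rw [h0, norm_zero, mul_zero] at this
    linarith
  have hcinv : ∀ y, ‖(c y)⁻¹‖ ≤ 2 * e := by
    intro y
    rw [norm_inv, inv_le_iff_one_le_mul₀ (norm_pos_iff.2 (hc0 y))]
    exact hcn y
  -- second elimination: the contribution of `η` to the slow direction
  set s : ℝ → ℂ := fun y => -u y * (c y)⁻¹ with hs
  set s' : ℝ → ℂ := fun y => -u1 y * (c y)⁻¹ + u y * (2 * I * u y * u1 y * ε) * (c y)⁻¹ ^ 2 with hs'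
  have hsd : ∀ y, HasDerivAt s (s' y) y := by
    intro y
    have hcd : HasDerivAt c (2 * I * u y * u1 y * ε) y := by
      refine (((((hud y).fun_pow 2).const_mul I).mul_const ε).const_add (-I * ζ)).congr_deriv ?_
      simp only [Nat.cast_ofNat, Nat.add_one_sub_one, pow_one]; ring
    refine ((hud y).fun_neg.fun_mul (hcd.fun_inv (hc0 y))).congr_deriv ?_
    have := hc0 y
    simp only [hs']
    field_simp
  set α : ℝ → ℂ := fun y => n0 y + s y * η y with hα
  set A : ℝ → ℂ := fun y => -I * (u y ^ 2 - a ^ 2) * ε + u y * u1 y * ε ^ 2 with hA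
  set fη : ℝ → ℂ := fun y => b y * n0 y - u y * u1 y * ε ^ 2 * η y with hfη
  set fα : ℝ → ℂ := fun y => A y * n0 y + s' y * η y + s y * fη y with hfα
  have hαd : ∀ y, HasDerivAt (fun y => α y - 1) (0 * (α y - 1) + fα y) y := by
    intro y
    refine (((d0 y).fun_add ((hsd y).fun_mul (hηd y))).sub_const 1).congr_deriv ?_
    have hsc : s y * c y = -u y := by simp only [hs]; rw [inv_mul_cancel_right₀ (hc0 y)]
    have hn1 : n1 y = η y + r y * n0 y := by simp only [hη]; ring
    rw [hn1]
    simp only [hfα, hA, hr]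
    linear_combination η y * hsc
  have hηc : Continuous η := continuous_iff_continuousAt.2 fun y => (hηd y).continuousAt
  have hcc : Continuous c := by simp only [hc]; fun_prop
  have hcic : Continuous fun y => (c y)⁻¹ := hcc.inv₀ hc0
  have hbc : Continuous b := by simp only [hb]; fun_prop
  have hfηc : Continuous fη := by simp only [hfη]; fun_prop
  have hfαc : Continuous fα := by simp only [hfα, hA, hs, hs']; fun_prop
  -- limits at infinity
  have hulim : Tendsto (fun y => (u y : ℂ)) atTop (𝓝 (a : ℂ)) :=
    (continuous_ofReal.tendsto a).comp h.tendsto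
  have hu1lim : Tendsto (fun y => (u1 y : ℂ)) atTop (𝓝 ((0 : ℝ) : ℂ)) :=
    (continuous_ofReal.tendsto 0).comp h.tendsto_one
  have hrlim : Tendsto r atTop (𝓝 (-I * a * ε)) := by
    simpa [hr] using ((hulim.const_mul (-I)).mul_const ε).add (hu1lim.mul_const (ε ^ 2))
  have hηlim : Tendsto η atTop (𝓝 0) := by
    simpa using l1.sub (hrlim.mul l0)
  have hsn : ∀ y, ‖s y‖ ≤ 2 * B * e := by
    intro y
    simp only [hs]
    rw [norm_mul, norm_neg]
    calc _ ≤ B * (2 * e) := mul_le_mul (hun y) (hcinv y) (norm_nonneg _) hB0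
      _ = _ := by ring
  have hαlim : Tendsto (fun y => α y - 1) atTop (𝓝 0) := by
    have h1 : Tendsto (fun y => s y * η y) atTop (𝓝 0) := by
      refine squeeze_zero_norm (a := fun y => 2 * B * e * ‖η y‖) (fun y => ?_) ?_
      · rw [norm_mul]; exact mul_le_mul_of_nonneg_right (hsn y) (norm_nonneg _)
      · simpa using (tendsto_zero_iff_norm_tendsto_zero.1 hηlim).const_mul (2 * B * e)
    simpa using (l0.add h1).sub_const 1
  -- the supremum of the unknowns
  obtain ⟨m, hm0, hmn0, hmη, hmin⟩ : ∃ m, 0 ≤ m ∧ (∀ y, x ≤ y → ‖n0 y‖ ≤ m) ∧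
      (∀ y, x ≤ y → ‖η y‖ ≤ m) ∧
      ∀ m', (∀ y, x ≤ y → ‖n0 y‖ ≤ m' ∧ ‖η y‖ ≤ m') → m ≤ m' := by
    obtain ⟨M0, hM0⟩ := exists_forall_norm_le_of_tendsto hn0c l0 x
    obtain ⟨M1, hM1⟩ := exists_forall_norm_le_of_tendsto hηc hηlim x
    set S : Ici x → ℝ := fun y => max ‖n0 y‖ ‖η y‖ with hS
    have hbdd : BddAbove (Set.range S) := by
      refine ⟨max M0 M1, ?_⟩
      rintro _ ⟨y, rfl⟩
      exact max_le_max (hM0 y y.2) (hM1 y y.2)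
    have : Nonempty (Ici x) := ⟨⟨x, self_mem_Ici⟩⟩
    refine ⟨⨆ y, S y, ?_, fun y hy => ?_, fun y hy => ?_, fun m' hm' => ?_⟩
    · exact (norm_nonneg (n0 x)).trans
        ((le_max_left _ _).trans (le_ciSup hbdd ⟨x, self_mem_Ici⟩))
    · exact (le_max_left _ _).trans (le_ciSup hbdd ⟨y, hy⟩)
    · exact (le_max_right _ _).trans (le_ciSup hbdd ⟨y, hy⟩)
    · exact ciSup_le fun y => max_le (hm' y y.2).1 (hm' y y.2).2
  -- the source terms of both components are bounded by `m` times an integrable function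
  have hfηn : ∀ y, x ≤ y → ‖fη y‖ ≤ 3 * B ^ 2 * e ^ 2 * m * g y := by
    intro y hy
    have h1 := norm_elim_coeff_le (v2 := u2 y) hB (hu y) ha (hu1 y) he
    have h2 : ‖(u y : ℂ) * u1 y * ε ^ 2‖ ≤ B ^ 2 * e ^ 2 * g y := by
      rw [norm_mul, norm_mul, norm_pow, hu1n]
      have h3 : |u1 y| ≤ g y := by
        simp only [hg, roughness]; linarith [abs_nonneg (u2 y), abs_nonneg (u y - a)]
      calc ‖(u y : ℂ)‖ * |u1 y| * e ^ 2 ≤ B ^ 2 * g y * e ^ 2 := by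
            have := hun y
            have hBB : B ≤ B ^ 2 := by nlinarith
            have := hg0 y
            gcongr
            linarith
        _ = _ := by ring
    calc ‖fη y‖ ≤ ‖b y‖ * ‖n0 y‖ + ‖(u y : ℂ) * u1 y * ε ^ 2‖ * ‖η y‖ := by
          refine (norm_sub_le _ _).trans ?_
          rw [norm_mul, norm_mul _ (η y)]
      _ ≤ (2 * B ^ 2 * e ^ 2 * g y) * m + (B ^ 2 * e ^ 2 * g y) * m := by
          have := hmn0 y hy
          have := hmη y hy
          have := hg0 y
          gcongr
          exact h1
      _ = _ := by ring
  have hfαn : ∀ y, x ≤ y → ‖fα y‖ ≤ 7 * B * e * m * g y := by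
    intro y hy
    have hgy := hg0 y
    have h1 : |u1 y| ≤ g y := by
      simp only [hg, roughness]; linarith [abs_nonneg (u2 y), abs_nonneg (u y - a)]
    have h1' : |u y - a| + |u1 y| ≤ g y := by
      simp only [hg, roughness]; linarith [abs_nonneg (u2 y)]
    have h2 : ‖A y‖ ≤ 2 * B * e * g y := by
      have h3 : A y = -I * ((u y + a) * ((u y - a : ℝ) : ℂ)) * ε + u y * u1 y * ε ^ 2 := by
        simp only [hA]; push_cast; ring
      rw [h3]
      refine (norm_add_le _ _).trans ?_
      rw [norm_mul, norm_mul, norm_neg, norm_I, one_mul, norm_mul, norm_real, norm_mul, norm_mul,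
        norm_pow, hu1n, Real.norm_eq_abs]
      have h4 : ‖(u y : ℂ) + a‖ ≤ 2 * B := by
        refine (norm_add_le _ _).trans ?_
        rw [norm_real a, Real.norm_eq_abs]
        linarith [hun y]
      calc _ ≤ 2 * B * |u y - a| * e + B * |u1 y| * e ^ 2 := by
            have := hun y
            gcongr
        _ ≤ 2 * B * e * (|u y - a| + |u1 y|) := by
            have : B * |u1 y| * e ^ 2 ≤ 2 * B * e * |u1 y| := by
              have h5 : 0 ≤ B * |u1 y| * e := by positivity
              nlinarith
            linarith
        _ ≤ _ := by gcongr
    have h3 : ‖s' y‖ ≤ 3 * e * g y := by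
      simp only [hs']
      refine (norm_add_le _ _).trans ?_
      rw [norm_mul, norm_neg, hu1n, norm_mul, norm_pow, norm_mul, norm_mul, norm_mul, norm_mul,
        norm_mul, norm_ofNat, norm_I, mul_one, hu1n]
      have h4 := hcinv y
      have h5 := hun y
      calc _ ≤ |u1 y| * (2 * e) + B * (2 * B * |u1 y| * e) * (2 * e) ^ 2 := by gcongr
        _ = e * |u1 y| * (2 + 8 * (B * e) * (B * e)) := by ring
        _ ≤ e * |u1 y| * 3 := by
            have h6 : (B * e) * (B * e) ≤ 1 / 4 * (1 / 4) :=
              mul_le_mul hBe hBe (by positivity) (by norm_num)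
            gcongr
            linarith
        _ ≤ e * g y * 3 := by gcongr
        _ = _ := by ring
    calc ‖fα y‖ ≤ ‖A y‖ * ‖n0 y‖ + ‖s' y‖ * ‖η y‖ + ‖s y‖ * ‖fη y‖ := by
          refine (norm_add_le _ _).trans (add_le_add ((norm_add_le _ _).trans ?_) ?_)
          · rw [norm_mul, norm_mul]
          · rw [norm_mul]
      _ ≤ (2 * B * e * g y) * m + (3 * e * g y) * m
            + (2 * B * e) * (3 * B ^ 2 * e ^ 2 * m * g y) := by
          have := hmn0 y hy
          have := hmη y hy
          have := hsn y
          have := hfηn y hy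
          gcongr
      _ = e * m * g y * (2 * B + 3 + 6 * B * (B * e) * (B * e)) := by ring
      _ ≤ e * m * g y * (7 * B) := by
          have h6 : (B * e) * (B * e) ≤ 1 / 4 * (1 / 4) :=
            mul_le_mul hBe hBe (by positivity) (by norm_num)
          gcongr
          nlinarith
      _ = _ := by ring
  have hηb : ∀ y, x ≤ y → ‖η y‖ ≤ 3 * B ^ 2 * e ^ 2 * m * G := by
    intro y hy
    have h1 := norm_le_integral_of_dissipative (g := fun y => 3 * B ^ 2 * e ^ 2 * m * g y) hηd hcc
      hfηc hcre hηlim (hgi.const_mul _) hfηn hy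
    rwa [integral_const_mul, hG] at h1
  have hαb : ∀ y, x ≤ y → ‖α y - 1‖ ≤ 7 * B * e * m * G := by
    intro y hy
    have h1 := norm_le_integral_of_dissipative (g := fun y => 7 * B * e * m * g y) hαd
      continuous_const hfαc (fun _ => by simp) hαlim (hgi.const_mul _) hfαn hy
    rwa [integral_const_mul, hG] at h1
  have hn0b : ∀ y, x ≤ y → ‖n0 y - 1‖ ≤ 8 * B * e * m * G := by
    intro y hy
    have h1 : n0 y - 1 = (α y - 1) - s y * η y := by simp only [hα]; ring
    rw [h1]
    refine (norm_sub_le _ _).trans ?_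
    rw [norm_mul]
    calc _ ≤ 7 * B * e * m * G + (2 * B * e) * (3 * B ^ 2 * e ^ 2 * m * G) :=
          add_le_add (hαb y hy) (mul_le_mul (hsn y) (hηb y hy) (norm_nonneg _) (by positivity))
      _ = B * e * m * G * (7 + 6 * (B * e) * (B * e)) := by ring
      _ ≤ B * e * m * G * 8 := by
          have h6 : (B * e) * (B * e) ≤ 1 / 4 * (1 / 4) :=
            mul_le_mul hBe hBe (by positivity) (by norm_num)
          gcongr
          linarith
      _ = _ := by ring
  have hBeG : B * e * G ≤ 1 / 16 := by linarith
  have hBeG0 : 0 ≤ B * e * G := by positivity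
  -- the a priori bound closes, as the perturbation is at most `m / 2`
  have hm2 : m ≤ 2 := by
    have h1 : m ≤ 1 + m / 2 := by
      refine hmin _ fun y hy => ⟨?_, ?_⟩
      · have h2 : ‖n0 y‖ ≤ ‖n0 y - 1‖ + 1 := by
          have h3 := norm_add_le (n0 y - 1) 1
          rwa [sub_add_cancel, norm_one] at h3
        have h3 := hn0b y hy
        have h4 : 8 * B * e * m * G = 8 * (B * e * G) * m := by ring
        nlinarith
      · have h3 := hηb y hy
        have h4 : 3 * B ^ 2 * e ^ 2 * m * G = 3 * ((B * e) * (B * e * G)) * m := by ring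
        have h5 : (B * e) * (B * e * G) ≤ 1 / 4 * (1 / 16) :=
          mul_le_mul hBe hBeG hBeG0 (by norm_num)
        nlinarith
    linarith
  have hfirst : ‖n0 x - 1‖ ≤ 16 * B * G * e := by
    calc _ ≤ 8 * B * e * m * G := hn0b x le_rfl
      _ ≤ 8 * B * e * 2 * G := by gcongr
      _ = _ := by ring
  refine ⟨hfirst, ?_⟩
  have h1 : n1 x + I * u x * ε = u1 x * ε ^ 2 * n0 x + η x - I * u x * ε * (n0 x - 1) := by
    simp only [hη, hr]; ring
  rw [h1]
  refine (norm_sub_le _ _).trans ((add_le_add_left (norm_add_le _ _) _).trans ?_)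
  rw [norm_mul, norm_mul, norm_pow, hu1n, norm_mul, norm_mul, norm_mul, norm_I, one_mul]
  have e1 : |u1 x| * e ^ 2 * ‖n0 x‖ ≤ B * e ^ 2 * 2 := by
    have := hu1 x
    have := (hmn0 x le_rfl).trans hm2
    gcongr
  have e2 : ‖η x‖ ≤ 3 * B ^ 2 * e ^ 2 * 2 * G := (hηb x le_rfl).trans (by gcongr)
  have e3 : ‖(u x : ℂ)‖ * e * ‖n0 x - 1‖ ≤ B * e * (16 * B * G * e) := by
    have := hun x
    gcongr
  have e4 : B * e ^ 2 * 2 + 3 * B ^ 2 * e ^ 2 * 2 * G + B * e * (16 * B * G * e)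
    = (2 * B + 22 * B ^ 2 * G) * e ^ 2 := by ring
  linarith

/-- The asymptotics of `μ_{+,2}`, divided by the large factor `i (k + λ) / a`, uniformly in the
closed upper half-plane. -/
theorem IsSmoothProfile.muPlus_asymptotics (h : IsSmoothProfile u u1 u2 a) (ha : 0 < a) (x : ℝ) :
    ∃ C R : ℝ, 0 < R ∧ ∀ k : ℂ, 0 ≤ k.im → R ≤ ‖k‖ →
      ‖-I * a / (k + lam a k) * muPlus u a 1 k x 0 - 1‖ ≤ C * ‖k‖⁻¹ ∧
      ‖-I * a / (k + lam a k) * muPlus u a 1 k x 1 + I * u x / (k + lam a k)‖ ≤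
        C * ‖k‖⁻¹ ^ 2 := by
  obtain ⟨B0, hB0⟩ := h.bounded
  set B := max 1 (max B0 (max a (∫ s, |u2 s|))) with hBdef
  have hB1 : 1 ≤ B := le_max_left _ _
  have hBu : ∀ y, |u y| ≤ B := fun y => (hB0 y).trans
    ((le_max_left _ _).trans (le_max_right _ _))
  have hBa : |a| ≤ B := by
    rw [abs_of_pos ha]
    exact (le_max_left _ _).trans ((le_max_right _ _).trans (le_max_right _ _))
  have hBu1 : ∀ y, |u1 y| ≤ B := fun y => (h.bounded_one y).trans
    ((le_max_right _ _).trans ((le_max_right _ _).trans (le_max_right _ _)))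
  set G := ∫ s in Ioi x, roughness u u1 u2 a s with hG
  have hG0 : 0 ≤ G := setIntegral_nonneg measurableSet_Ioi fun s _ => by
    simp only [roughness]; positivity
  set R := 16 * B * (G + 1) with hR
  have hR0 : 0 < R := by positivity
  refine ⟨16 * B * G + (2 * B + 22 * B ^ 2 * G), R, hR0, fun k hk hRk => ?_⟩
  set ζ := k + lam a k with hζ
  have hζ0 : ζ ≠ 0 := add_lam_ne_zero ha k
  have hle : ‖k‖ ≤ ‖ζ‖ := norm_le_norm_add_lam ha hk
  have hk0 : 0 < ‖k‖ := hR0.trans_le hRk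
  have hεk : ‖ζ⁻¹‖ ≤ ‖k‖⁻¹ := by rw [norm_inv]; exact inv_anti₀ hk0 hle
  have hRε : R * ‖ζ⁻¹‖ ≤ 1 := by
    calc R * ‖ζ⁻¹‖ ≤ ‖k‖ * ‖k‖⁻¹ := by gcongr
      _ = 1 := mul_inv_cancel₀ hk0.ne'
  have him : 0 ≤ ζ.im := by
    rw [hζ, add_im]; exact add_nonneg hk (lam_im_nonneg a k)
  have hd := fun y => hasDerivAt_jostMu h.toIsProfile ha k y
  have hmu := muPlus_one_eq h.toIsProfile ha k
  have hkl : k - lam a k = a ^ 2 * ζ⁻¹ := by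
    rw [← sub_mul_add_lam ha k, ← hζ, mul_assoc, mul_inv_cancel₀ hζ0, mul_one]
  have hlim := tendsto_pi_nhds.1 (isJost_phiPlus_one h.toIsProfile ha k).2
  have hlim' : ∀ i, Tendsto (fun y => jostMu u a k y i) atTop (𝓝 (E a k i 1)) := by
    intro i
    refine (hlim i).congr fun y => ?_
    rw [← hmu]; rfl
  have key := h.norm_le_of_large (x := x) hB1 hBu hBa hBu1 (ζ := ζ) (ε := ζ⁻¹)
    (n0 := fun y => -I * a * ζ⁻¹ * jostMu u a k y 0) (n1 := fun y => -I * a * ζ⁻¹ * jostMu u a k y 1)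
    (mul_inv_cancel₀ hζ0) him ?_ ?_ ?_ ?_ ?_ hG.symm ?_
  · obtain ⟨k1, k2⟩ := key
    rw [hmu]
    have hinv0 : 0 ≤ ‖k‖⁻¹ := by positivity
    have hζn0 := norm_nonneg ζ⁻¹
    constructor
    · rw [div_eq_mul_inv]
      refine k1.trans ?_
      have : 0 ≤ (2 * B + 22 * B ^ 2 * G) * ‖k‖⁻¹ := by positivity
      have : 16 * B * G * ‖ζ⁻¹‖ ≤ 16 * B * G * ‖k‖⁻¹ := by gcongr
      linarith
    · rw [div_eq_mul_inv, div_eq_mul_inv]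
      refine k2.trans ?_
      have : 0 ≤ 16 * B * G * ‖k‖⁻¹ ^ 2 := by positivity
      have : (2 * B + 22 * B ^ 2 * G) * ‖ζ⁻¹‖ ^ 2 ≤ (2 * B + 22 * B ^ 2 * G) * ‖k‖⁻¹ ^ 2 := by gcongr
      linarith
  · intro y
    refine ((hasDerivAt_pi.1 (hd y) 0).const_mul (-I * a * ζ⁻¹)).congr_deriv ?_
    simp only [genCLM_apply, swapCLM_apply, hkl]
    simp
    ring
  · intro y
    refine ((hasDerivAt_pi.1 (hd y) 1).const_mul (-I * a * ζ⁻¹)).congr_deriv ?_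
    simp only [genCLM_apply, swapCLM_apply, ← hζ]
    simp
    ring
  · have h1 := (hlim' 0).const_mul (-I * a * ζ⁻¹)
    have h2 : -I * a * ζ⁻¹ * E a k 0 1 = 1 := by
      have ha' : (a : ℂ) ≠ 0 := ofReal_ne_zero.2 ha.ne'
      simp only [E_eq, of_apply, cons_val', cons_val_one, cons_val_zero, cons_val_fin_one]
      rw [hkl]; field_simp; simp
    rwa [h2] at h1
  · have h1 := (hlim' 1).const_mul (-I * a * ζ⁻¹)
    rwa [E_diag, mul_one] at h1
  · have : 4 * B * ‖ζ⁻¹‖ ≤ R * ‖ζ⁻¹‖ := by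
      gcongr; rw [hR]; nlinarith
    linarith
  · have : 16 * B * ‖ζ⁻¹‖ * G ≤ R * ‖ζ⁻¹‖ := by
      have : 0 ≤ B * ‖ζ⁻¹‖ := by positivity
      rw [hR]; nlinarith
    linarith

end

end LargeParameter

/-! ### Behaviour of `N` at infinity -/

section UpperHalfPlane

open Asymptotics

variable {u u1 u2 v1 v2 : ℝ → ℝ} {a qm qp : ℝ}

/-- `k → ∞` in the closed upper half-plane. -/
def atInfty : Filter ℂ := Bornology.cobounded ℂ ⊓ 𝓟 {k | 0 ≤ k.im}

theorem isBigO_atInfty {f : ℂ → ℂ} {n : ℕ} {C R : ℝ}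
    (h : ∀ k : ℂ, 0 ≤ k.im → R ≤ ‖k‖ → ‖f k‖ ≤ C * ‖k‖⁻¹ ^ n) :
    f =O[atInfty] fun k => k⁻¹ ^ n := by
  refine IsBigO.of_bound C ?_
  refine eventually_inf_principal.2 ?_
  filter_upwards [tendsto_norm_cobounded_atTop.eventually_ge_atTop R] with k hk him
  rw [norm_pow, norm_inv]
  exact h k him hk

theorem isBigO_atInfty_iff {f : ℂ → ℂ} {n : ℕ} : (f =O[atInfty] fun k => k⁻¹ ^ n) ↔
    ∃ C R, ∀ k : ℂ, 0 ≤ k.im → R ≤ ‖k‖ → ‖f k‖ ≤ C * ‖k‖⁻¹ ^ n := by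
  refine ⟨fun h => ?_, fun ⟨C, R, h⟩ => isBigO_atInfty h⟩
  obtain ⟨C, hC⟩ := h.bound
  have h1 := eventually_inf_principal.1 hC
  rw [← comap_norm_atTop, eventually_comap] at h1
  obtain ⟨R, hR⟩ := eventually_atTop.1 h1
  refine ⟨C, R, fun k hk hRk => ?_⟩
  have := hR ‖k‖ hRk k rfl hk
  rwa [norm_pow, norm_inv] at this

theorem isBigO_inv_pow_of_le {n m : ℕ} (h : n ≤ m) :
    (fun k : ℂ => k⁻¹ ^ m) =O[atInfty] fun k => k⁻¹ ^ n := by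
  refine isBigO_atInfty (C := 1) (R := 1) fun k _ hk => ?_
  rw [norm_pow, norm_inv, one_mul]
  exact pow_le_pow_of_le_one (by positivity) (inv_le_one_of_one_le₀ hk) h

theorem isBigO_inv_add_lam (ha : 0 < a) :
    (fun k => (k + lam a k)⁻¹) =O[atInfty] fun k => k⁻¹ ^ 1 := by
  refine isBigO_atInfty (C := 1) (R := 1) fun k hk h1 => ?_
  rw [norm_inv, one_mul, pow_one]
  exact inv_anti₀ (by linarith) (norm_le_norm_add_lam ha hk)

theorem sub_lam_eq (ha : 0 < a) (k : ℂ) : k - lam a k = a ^ 2 * (k + lam a k)⁻¹ := by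
  rw [← sub_mul_add_lam ha k, mul_assoc, mul_inv_cancel₀ (add_lam_ne_zero ha k), mul_one]

theorem isBigO_sub_lam (ha : 0 < a) :
    (fun k => k - lam a k) =O[atInfty] fun k => k⁻¹ ^ 1 :=
  ((isBigO_inv_add_lam ha).const_mul_left ((a : ℂ) ^ 2)).congr_left fun k => (sub_lam_eq ha k).symm

theorem norm_le_two_mul_norm_lam (ha : 0 < a) {k : ℂ} (hk : 0 ≤ k.im) (h : 2 * a ≤ ‖k‖) :
    ‖k‖ ≤ 2 * ‖lam a k‖ := by
  have h1 : ‖k‖ ≤ ‖lam a k‖ + ‖k - lam a k‖ := by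
    have := norm_add_le (lam a k) (k - lam a k)
    rwa [add_sub_cancel] at this
  have h0 : 0 < ‖k‖ := by linarith
  have h2 : ‖k - lam a k‖ ≤ ‖k‖ / 4 := by
    rw [sub_lam_eq ha, norm_mul, norm_inv, norm_pow, norm_real, Real.norm_eq_abs, sq_abs]
    have h3 : ‖k + lam a k‖⁻¹ ≤ ‖k‖⁻¹ := inv_anti₀ h0 (norm_le_norm_add_lam ha hk)
    calc a ^ 2 * ‖k + lam a k‖⁻¹ ≤ (‖k‖ / 2) ^ 2 * ‖k‖⁻¹ := by gcongr; linarith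
      _ = ‖k‖ / 4 := by field_simp; ring
  linarith

theorem isBigO_inv_lam (ha : 0 < a) :
    (fun k => (lam a k)⁻¹) =O[atInfty] fun k => k⁻¹ ^ 1 := by
  refine isBigO_atInfty (C := 2) (R := 2 * a) fun k hk h1 => ?_
  have h2 := norm_le_two_mul_norm_lam ha hk h1
  have h0 : 0 < ‖k‖ := by linarith
  have h3 : 0 < ‖lam a k‖ := by linarith
  rw [norm_inv, pow_one, inv_eq_one_div, ← div_eq_mul_inv, div_le_div_iff₀ h3 h0]
  linarith

theorem eventually_atInfty_ne_zero : ∀ᶠ k in atInfty, k ≠ 0 :=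
  ((tendsto_norm_cobounded_atTop.eventually_gt_atTop 0).mono
    fun _ hk => norm_pos_iff.1 hk).filter_mono inf_le_left

theorem eventually_atInfty_im : ∀ᶠ k in atInfty, 0 ≤ k.im :=
  (eventually_principal.2 fun _ h => h).filter_mono inf_le_right

theorem eventually_atInfty_lam_ne_zero (ha : 0 < a) : ∀ᶠ k in atInfty, lam a k ≠ 0 := by
  filter_upwards [(tendsto_norm_cobounded_atTop.eventually_ge_atTop (2 * a)).filter_mono inf_le_left,
    eventually_atInfty_im] with k hk him h0
  have := norm_le_two_mul_norm_lam ha him hk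
  rw [h0, norm_zero] at this
  linarith

theorem isBigO_inv_add_lam_sub (ha : 0 < a) :
    (fun k => (k + lam a k)⁻¹ - (2 * k)⁻¹) =O[atInfty] fun k => k⁻¹ ^ 2 := by
  have h : (fun k => (k - lam a k) * (k + lam a k)⁻¹ * (2⁻¹ * k⁻¹ ^ 1)) =O[atInfty] fun k =>
      k⁻¹ ^ 1 * k⁻¹ ^ 1 * k⁻¹ ^ 1 :=
    ((isBigO_sub_lam ha).mul (isBigO_inv_add_lam ha)).mul ((isBigO_refl _ _).const_mul_left _)
  refine (h.congr' ?_ ?_).trans (isBigO_inv_pow_of_le (m := 3) (by norm_num))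
  · filter_upwards [eventually_atInfty_ne_zero] with k hk
    have := add_lam_ne_zero ha k
    field_simp; ring
  · exact Eventually.of_forall fun k => by ring

theorem isBigO_inv_lam_sub (ha : 0 < a) :
    (fun k => (lam a k)⁻¹ - k⁻¹) =O[atInfty] fun k => k⁻¹ ^ 2 := by
  have h : (fun k => (k - lam a k) * (lam a k)⁻¹ * k⁻¹ ^ 1) =O[atInfty] fun k =>
      k⁻¹ ^ 1 * k⁻¹ ^ 1 * k⁻¹ ^ 1 :=
    ((isBigO_sub_lam ha).mul (isBigO_inv_lam ha)).mul (isBigO_refl _ _)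
  refine (h.congr' ?_ ?_).trans (isBigO_inv_pow_of_le (m := 3) (by norm_num))
  · filter_upwards [eventually_atInfty_ne_zero, eventually_atInfty_lam_ne_zero ha] with k hk hl
    field_simp
  · exact Eventually.of_forall fun k => by ring

/-- `μ_{+,2}` divided by `i (k + λ₊) / q₊`, which is bounded for large `k`. -/
def hatPlus (u : ℝ → ℝ) (qp x : ℝ) (k : ℂ) : Fin 2 → ℂ :=
  (-I * qp * (k + lam qp k)⁻¹) • muPlus u qp 1 k x

/-- `μ_{-,1}` divided by `i (k + λ₋) / q₋`, which is bounded for large `k`. -/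
def hatMinus (u : ℝ → ℝ) (qm x : ℝ) (k : ℂ) : Fin 2 → ℂ :=
  (-I * qm * (k + lam qm k)⁻¹) • muMinus u qm 0 k x

/-- The Wronskian of `φ_{-,1}` and `φ_{+,2}` after division by the large factors. -/
def hatWr (u : ℝ → ℝ) (qm qp : ℝ) (k : ℂ) : ℂ :=
  hatMinus u qm 0 k 0 * hatPlus u qp 0 k 1 - hatMinus u qm 0 k 1 * hatPlus u qp 0 k 0

theorem IsSmoothProfile.hatPlus_zero (h : IsSmoothProfile u u1 u2 qp) (ha : 0 < qp) (x : ℝ) :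
    (fun k => hatPlus u qp x k 0 - 1) =O[atInfty] fun k => k⁻¹ ^ 1 := by
  obtain ⟨C, R, _, hC⟩ := h.muPlus_asymptotics ha x
  refine isBigO_atInfty (C := C) (R := R) fun k hk hR => ?_
  simpa [hatPlus, div_eq_mul_inv] using (hC k hk hR).1

theorem IsSmoothProfile.hatPlus_one (h : IsSmoothProfile u u1 u2 qp) (ha : 0 < qp) (x : ℝ) :
    (fun k => hatPlus u qp x k 1 + I * u x * (k + lam qp k)⁻¹) =O[atInfty] fun k => k⁻¹ ^ 2 := by
  obtain ⟨C, R, _, hC⟩ := h.muPlus_asymptotics ha x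
  refine isBigO_atInfty (C := C) (R := R) fun k hk hR => ?_
  simpa [hatPlus, div_eq_mul_inv] using (hC k hk hR).2

theorem hatMinus_eq (h : IsLeftProfile u a) (ha : 0 < a) (x : ℝ) (k : ℂ) :
    hatMinus u a x k = ![hatPlus (fun x => u (-x)) a (-x) k 1,
      -hatPlus (fun x => u (-x)) a (-x) k 0] := by
  rw [hatMinus, hatPlus, muMinus_zero_eq h ha, muPlus_one_eq h ha, reflect]
  ext i
  fin_cases i <;> simp

/-- A smooth profile at the left end of the line; `v1`, `v2` are the derivatives of its reflection
`x ↦ u (-x)`. -/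
def IsSmoothLeftProfile (u v1 v2 : ℝ → ℝ) (a : ℝ) : Prop :=
  IsSmoothProfile (fun x => u (-x)) v1 v2 a

theorem IsSmoothLeftProfile.hatMinus_zero (h : IsSmoothLeftProfile u v1 v2 qm) (ha : 0 < qm)
    (x : ℝ) : (fun k => hatMinus u qm x k 0 + I * u x * (k + lam qm k)⁻¹) =O[atInfty]
      fun k => k⁻¹ ^ 2 := by
  refine (IsSmoothProfile.hatPlus_one h ha (-x)).congr_left fun k => ?_
  rw [hatMinus_eq (IsSmoothProfile.toIsProfile h) ha]; simp

theorem IsSmoothLeftProfile.hatMinus_one (h : IsSmoothLeftProfile u v1 v2 qm) (ha : 0 < qm)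
    (x : ℝ) : (fun k => hatMinus u qm x k 1 + 1) =O[atInfty] fun k => k⁻¹ ^ 1 := by
  refine (IsSmoothProfile.hatPlus_zero h ha (-x)).neg_left.congr_left fun k => ?_
  rw [hatMinus_eq (IsSmoothProfile.toIsProfile h) ha]; simp; ring

theorem tendsto_of_isBigO {f : ℂ → ℂ} {c : ℂ}
    (h : (fun k => f k - c) =O[atInfty] fun k => k⁻¹ ^ 1) : Tendsto f atInfty (𝓝 c) := by
  have h1 : Tendsto (fun k : ℂ => k⁻¹ ^ 1) atInfty (𝓝 0) := by
    simp only [pow_one]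
    exact (tendsto_inv₀_cobounded (α := ℂ)).mono_left inf_le_left
  have h2 := (h.trans_tendsto h1).add_const c
  simpa using h2

theorem isBigO_one_of {f : ℂ → ℂ} {c : ℂ}
    (h : (fun k => f k - c) =O[atInfty] fun k => k⁻¹ ^ 1) : f =O[atInfty] fun k => k⁻¹ ^ 0 := by
  simpa using (tendsto_of_isBigO h).isBigO_one ℂ

/-- A step with two integrable derivatives: `u1`, `u2` are those of `u`, and `v1`, `v2` are those of
the reflected profile `x ↦ u (-x)`. -/
structure IsSmoothStep (u u1 u2 v1 v2 : ℝ → ℝ) (qm qp : ℝ) : Prop where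
  pos : 0 < qp
  lt : qp < qm
  left : IsSmoothLeftProfile u v1 v2 qm
  right : IsSmoothProfile u u1 u2 qp

namespace IsSmoothStep

variable (h : IsSmoothStep u u1 u2 v1 v2 qm qp)
include h

theorem isStep : IsStep u qm qp := ⟨h.pos, h.lt, h.left.toIsProfile, h.right.toIsProfile⟩

theorem hatWr_sub_one : (fun k => hatWr u qm qp k - 1) =O[atInfty] fun k => k⁻¹ ^ 1 := by
  have p0 := h.right.hatPlus_zero h.pos 0
  have p1 := h.right.hatPlus_one h.pos 0
  have m0 := h.left.hatMinus_zero h.isStep.pos' 0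
  have m1 := h.left.hatMinus_one h.isStep.pos' 0
  have P1 : (fun k => hatPlus u qp 0 k 1) =O[atInfty] fun k => k⁻¹ ^ 1 :=
    ((p1.trans (isBigO_inv_pow_of_le one_le_two)).sub
      ((isBigO_inv_add_lam h.pos).const_mul_left (I * u 0))).congr_left fun k => by ring
  have M0 : (fun k => hatMinus u qm 0 k 0) =O[atInfty] fun k => k⁻¹ ^ 1 :=
    ((m0.trans (isBigO_inv_pow_of_le one_le_two)).sub
      ((isBigO_inv_add_lam h.isStep.pos').const_mul_left (I * u 0))).congr_left fun k => by ring
  have P0 := isBigO_one_of p0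
  have e1 : (fun k => hatMinus u qm 0 k 0 * hatPlus u qp 0 k 1) =O[atInfty] fun k => k⁻¹ ^ 1 :=
    ((M0.mul P1).congr_right fun k => by ring).trans (isBigO_inv_pow_of_le (m := 2) one_le_two)
  have e2 : (fun k => (hatMinus u qm 0 k 1 + 1) * hatPlus u qp 0 k 0) =O[atInfty] fun k => k⁻¹ ^ 1 :=
    (m1.mul P0).congr_right fun k => by ring
  exact ((e1.sub e2).add p0).congr_left fun k => by rw [hatWr]; ring

theorem inv_hatWr_sub_one : (fun k => (hatWr u qm qp k)⁻¹ - 1) =O[atInfty] fun k => k⁻¹ ^ 1 := by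
  have h1 := h.hatWr_sub_one
  have h2 := tendsto_of_isBigO h1
  have h3 : (fun k => (hatWr u qm qp k)⁻¹) =O[atInfty] fun k => k⁻¹ ^ 0 := by
    simpa using (h2.inv₀ one_ne_zero).isBigO_one ℂ
  refine ((h1.neg_left.mul h3).congr_right fun k => by ring).congr' ?_ EventuallyEq.rfl
  filter_upwards [h2.eventually_ne one_ne_zero] with k hk
  field_simp; ring

end IsSmoothStep

theorem E_inv (a : ℝ) (k : ℂ) : (E a k)⁻¹ = (gam a k)⁻¹ •
    !![1, -(I * a / (k - lam a k)); I * a / (k - lam a k), 1] := by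
  rw [Matrix.inv_def, Ring.inverse_eq_inv', gam, E_eq, adjugate_fin_two_of, neg_neg]

/-- `M` with `1 / s₁₁` written as `γ / Wr`. -/
theorem M_eq (u : ℝ → ℝ) (qm qp x : ℝ) (k : ℂ) : M u qm qp x k =
    !![gam qp k * (jostWr u qm qp k)⁻¹ * muMinus u qm 0 k x 0, muPlus u qp 1 k x 0;
      gam qp k * (jostWr u qm qp k)⁻¹ * muMinus u qm 0 k x 1, muPlus u qp 1 k x 1] := by
  have h : ∀ z, z / s11 u qm qp k = gam qp k * (jostWr u qm qp k)⁻¹ * z := fun z => by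
    rw [s11, jostWr, div_div_eq_mul_div]; ring
  rw [M, h, h]

/-- `N` in terms of the Jost solutions. Only the second Jost solution is divided by `λ`. -/
theorem N_eq (hqp : 0 < qp) (x : ℝ) {k : ℂ} (hl : lam qp k ≠ 0) : N u qm qp x k = Matrix.of fun i =>
    ![(jostWr u qm qp k)⁻¹ * muMinus u qm 0 k x i - I * qp * (2 * lam qp k)⁻¹ * muPlus u qp 1 k x i,
      -(I * qp * (k - lam qp k)⁻¹ * (jostWr u qm qp k)⁻¹ * muMinus u qm 0 k x i)
        - (k - lam qp k) * (2 * lam qp k)⁻¹ * muPlus u qp 1 k x i] := by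
  have hz := sub_lam_ne_zero hqp k
  have hg := gam_eq hqp k
  rw [N, E_inv qp, M_eq, hg]
  set W := (jostWr u qm qp k)⁻¹
  ext i j
  fin_cases i <;> fin_cases j <;> simp [Matrix.mul_apply, Fin.sum_univ_two] <;> field_simp <;> ring

/-- `N` in terms of the bounded quantities. -/
theorem N_eq_hat (hqp : 0 < qp) (hqm : 0 < qm) (x : ℝ) {k : ℂ} (hl : lam qp k ≠ 0) :
    N u qm qp x k = Matrix.of fun i =>
    ![-(I * qp * (k + lam qp k)⁻¹ * (hatWr u qm qp k)⁻¹ * hatMinus u qm x k i) +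
        (k + lam qp k) * (2 * lam qp k)⁻¹ * hatPlus u qp x k i,
      -((hatWr u qm qp k)⁻¹ * hatMinus u qm x k i) -
        I * qp * (2 * lam qp k)⁻¹ * hatPlus u qp x k i] := by
  have hζ := add_lam_ne_zero hqp k
  have hζm := add_lam_ne_zero hqm k
  have hq : (qp : ℂ) ≠ 0 := ofReal_ne_zero.2 hqp.ne'
  have hm : (qm : ℂ) ≠ 0 := ofReal_ne_zero.2 hqm.ne'
  have hW : hatWr u qm qp k = -I * qm * (k + lam qm k)⁻¹ * (-I * qp * (k + lam qp k)⁻¹) *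
      jostWr u qm qp k := by
    rw [hatWr, jostWr_eq, hatMinus, hatPlus]; simp; ring
  rw [N_eq hqp x hl, hW, sub_lam_eq hqp]
  rw [mul_inv _ (jostWr u qm qp k)]
  set W := (jostWr u qm qp k)⁻¹
  ext i j
  fin_cases j
  · simp [hatMinus, hatPlus]; field_simp; ring_nf; simp only [I_pow_four]; ring
  · simp [hatMinus, hatPlus]; field_simp; ring_nf; simp only [I_sq, I_pow_three]; ring

namespace IsSmoothStep

variable (h : IsSmoothStep u u1 u2 v1 v2 qm qp)
include h

/-- Entrywise `N = 1 + O(1 / k)` in the closed upper half-plane. -/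
theorem N_sub_one (x : ℝ) (i j : Fin 2) :
    (fun k => (N u qm qp x k - 1) i j) =O[atInfty] fun k => k⁻¹ ^ 1 := by
  have p0 := h.right.hatPlus_zero h.pos x
  have p1 := h.right.hatPlus_one h.pos x
  have m0 := h.left.hatMinus_zero h.isStep.pos' x
  have m1 := h.left.hatMinus_one h.isStep.pos' x
  have z1 := isBigO_inv_add_lam h.pos
  have z2 := (isBigO_inv_lam h.pos).const_mul_left 2⁻¹
  have z3 := isBigO_sub_lam h.pos
  have w0 := isBigO_one_of h.inv_hatWr_sub_one
  have w1 := h.inv_hatWr_sub_one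
  have P1 : (fun k => hatPlus u qp x k 1) =O[atInfty] fun k => k⁻¹ ^ 1 :=
    ((p1.trans (isBigO_inv_pow_of_le one_le_two)).sub
      (z1.const_mul_left (I * u x))).congr_left fun k => by ring
  have M0 : (fun k => hatMinus u qm x k 0) =O[atInfty] fun k => k⁻¹ ^ 1 :=
    ((m0.trans (isBigO_inv_pow_of_le one_le_two)).sub
      ((isBigO_inv_add_lam h.isStep.pos').const_mul_left (I * u x))).congr_left fun k => by ring
  have P0 := isBigO_one_of p0
  have M1 : (fun k => hatMinus u qm x k 1) =O[atInfty] fun k => k⁻¹ ^ 0 :=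
    isBigO_one_of (c := -1) (m1.congr_left fun k => by ring)
  -- the slowly varying coefficient `(k + λ) / (2 λ)`
  have c1 : (fun k => (k + lam qp k) * (2 * lam qp k)⁻¹ - 1) =O[atInfty] fun k => k⁻¹ ^ 1 := by
    refine (((z3.mul z2).congr_right fun k => by ring).trans
      (isBigO_inv_pow_of_le (m := 2) one_le_two)).congr' ?_ EventuallyEq.rfl
    filter_upwards [eventually_atInfty_lam_ne_zero h.pos] with k hk
    field_simp; ring
  have c0 := isBigO_one_of c1
  have hN : ∀ᶠ k in atInfty, N u qm qp x k = Matrix.of fun i =>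
      ![-(I * qp * (k + lam qp k)⁻¹ * (hatWr u qm qp k)⁻¹ * hatMinus u qm x k i) +
          (k + lam qp k) * (2 * lam qp k)⁻¹ * hatPlus u qp x k i,
        -((hatWr u qm qp k)⁻¹ * hatMinus u qm x k i) -
          I * qp * (2 * lam qp k)⁻¹ * hatPlus u qp x k i] := by
    filter_upwards [eventually_atInfty_lam_ne_zero h.pos] with k hk
    exact N_eq_hat h.pos h.isStep.pos' x hk
  have hP : ∀ i, (fun k => hatPlus u qp x k i) =O[atInfty] fun k => k⁻¹ ^ 0 := by
    intro i; fin_cases i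
    · exact P0
    · exact P1.trans (isBigO_inv_pow_of_le zero_le_one)
  have hM : ∀ i, (fun k => hatMinus u qm x k i) =O[atInfty] fun k => k⁻¹ ^ 0 := by
    intro i; fin_cases i
    · exact M0.trans (isBigO_inv_pow_of_le zero_le_one)
    · exact M1
  have t1 : ∀ i, (fun k => I * qp * (k + lam qp k)⁻¹ * (hatWr u qm qp k)⁻¹ * hatMinus u qm x k i)
      =O[atInfty] fun k => k⁻¹ ^ 1 := fun i =>
    (((z1.const_mul_left (I * qp)).mul w0).mul (hM i)).congr_right fun k => by ring
  have t2 : ∀ i, (fun k => I * qp * (2 * lam qp k)⁻¹ * hatPlus u qp x k i)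
      =O[atInfty] fun k => k⁻¹ ^ 1 := fun i =>
    ((z2.const_mul_left (I * qp)).mul (hP i)).congr (fun k => by rw [mul_inv]) fun k => by ring
  fin_cases j <;> fin_cases i
  · refine IsBigO.congr' (f₁ := fun k =>
      -(I * qp * (k + lam qp k)⁻¹ * (hatWr u qm qp k)⁻¹ * hatMinus u qm x k 0) +
        (((k + lam qp k) * (2 * lam qp k)⁻¹ - 1) * hatPlus u qp x k 0 + (hatPlus u qp x k 0 - 1)))
      ?_ ?_ EventuallyEq.rfl
    · exact (t1 0).neg_left.add (((c1.mul P0).congr_right fun k => by ring).add p0)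
    · filter_upwards [hN] with k hk
      rw [hk]; simp; ring
  · refine IsBigO.congr' (f₁ := fun k =>
      -(I * qp * (k + lam qp k)⁻¹ * (hatWr u qm qp k)⁻¹ * hatMinus u qm x k 1) +
        ((k + lam qp k) * (2 * lam qp k)⁻¹) * hatPlus u qp x k 1)
      ?_ ?_ EventuallyEq.rfl
    · exact (t1 1).neg_left.add ((c0.mul P1).congr_right fun k => by ring)
    · filter_upwards [hN] with k hk
      rw [hk]; simp
  · refine IsBigO.congr' (f₁ := fun k => -((hatWr u qm qp k)⁻¹ * hatMinus u qm x k 0) -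
        I * qp * (2 * lam qp k)⁻¹ * hatPlus u qp x k 0)
      ?_ ?_ EventuallyEq.rfl
    · exact ((w0.mul M0).congr_right fun k => by ring).neg_left.sub (t2 0)
    · filter_upwards [hN] with k hk
      rw [hk]; simp
  · refine IsBigO.congr' (f₁ := fun k => ((hatWr u qm qp k)⁻¹ - 1) -
        ((hatWr u qm qp k)⁻¹ * (hatMinus u qm x k 1 + 1)) -
        I * qp * (2 * lam qp k)⁻¹ * hatPlus u qp x k 1)
      ?_ ?_ EventuallyEq.rfl
    · exact (w1.sub ((w0.mul m1).congr_right fun k => by ring)).sub (t2 1)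
    · filter_upwards [hN] with k hk
      rw [hk]; simp; ring

/-- The first coefficient of the expansion of `N₁₂` at infinity determines the profile. -/
theorem N_zero_one (x : ℝ) :
    (fun k => N u qm qp x k 0 1 - I * (u x - qp) * (2 * k)⁻¹) =O[atInfty] fun k => k⁻¹ ^ 2 := by
  have p0 := h.right.hatPlus_zero h.pos x
  have m0 := h.left.hatMinus_zero h.isStep.pos' x
  have z2 := (isBigO_inv_lam h.pos).const_mul_left 2⁻¹
  have w1 := h.inv_hatWr_sub_one
  have M0 : (fun k => hatMinus u qm x k 0) =O[atInfty] fun k => k⁻¹ ^ 1 :=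
    ((m0.trans (isBigO_inv_pow_of_le one_le_two)).sub
      ((isBigO_inv_add_lam h.isStep.pos').const_mul_left (I * u x))).congr_left fun k => by ring
  refine IsBigO.congr' (f₁ := fun k => -(((hatWr u qm qp k)⁻¹ - 1) * hatMinus u qm x k 0)
    - (hatMinus u qm x k 0 + I * u x * (k + lam qm k)⁻¹)
    + I * u x * ((k + lam qm k)⁻¹ - (2 * k)⁻¹)
    - I * qp * (2⁻¹ * (lam qp k)⁻¹) * (hatPlus u qp x k 0 - 1)
    - I * qp * 2⁻¹ * ((lam qp k)⁻¹ - k⁻¹)) ?_ ?_ EventuallyEq.rfl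
  · refine ((((?_ : _ =O[atInfty] _).neg_left.sub m0).add
      ((isBigO_inv_add_lam_sub h.isStep.pos').const_mul_left _)).sub ?_).sub
      ((isBigO_inv_lam_sub h.pos).const_mul_left _)
    · exact (w1.mul M0).congr_right fun k => by ring
    · exact ((z2.const_mul_left (I * qp)).mul p0).congr_right fun k => by ring
  · filter_upwards [eventually_atInfty_lam_ne_zero h.pos] with k hk
    rw [N_eq_hat h.pos h.isStep.pos' x hk]
    simp; ring

end IsSmoothStep

end UpperHalfPlane

/-! ### Boundary values, symmetry and jump -/

section BoundaryValues

variable {u : ℝ → ℝ} {a qm qp : ℝ}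

theorem gam_ne_zero (ha : 0 < a) {k : ℂ} (hl : lam a k ≠ 0) : gam a k ≠ 0 := by
  rw [gam_eq ha]
  exact div_ne_zero (mul_ne_zero (by norm_num) hl) (sub_lam_ne_zero ha k)

theorem E_mul_inv (ha : 0 < a) {k : ℂ} (hl : lam a k ≠ 0) : E a k * (E a k)⁻¹ = 1 :=
  Matrix.mul_nonsing_inv _ (isUnit_iff_ne_zero.2 (gam_ne_zero ha hl))

theorem E_inv_mul (ha : 0 < a) {k : ℂ} (hl : lam a k ≠ 0) : (E a k)⁻¹ * E a k = 1 :=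
  Matrix.nonsing_inv_mul _ (isUnit_iff_ne_zero.2 (gam_ne_zero ha hl))

theorem continuousWithinAt_matrix {F : ℂ → Matrix (Fin 2) (Fin 2) ℂ} {S : Set ℂ} {k : ℂ}
    (h : ∀ i j, ContinuousWithinAt (fun k => F k i j) S k) : ContinuousWithinAt F S k :=
  continuousWithinAt_pi.2 fun i => continuousWithinAt_pi.2 fun j => h i j

theorem continuousWithinAt_E_entry (ha : 0 < a) {S : Set ℂ} {k : ℂ}
    (hl : ContinuousWithinAt (lam a) S k) :
    ContinuousWithinAt (fun k => I * a / (k - lam a k)) S k :=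
  continuousWithinAt_const.div (continuousWithinAt_id.sub hl) (sub_lam_ne_zero ha k)

theorem continuousWithinAt_E_inv (ha : 0 < a) {S : Set ℂ} {k : ℂ}
    (hl : ContinuousWithinAt (lam a) S k) (hk : lam a k ≠ 0) :
    ContinuousWithinAt (fun k => (E a k)⁻¹) S k := by
  have h := continuousWithinAt_E_entry ha hl
  have hg : ContinuousWithinAt (gam a) S k := by
    rw [show gam a = _ from funext (gam_eq ha)]
    exact (continuousWithinAt_const.mul hl).div (continuousWithinAt_id.sub hl)
      (sub_lam_ne_zero ha k)
  have hgi := hg.inv₀ (gam_ne_zero ha hk)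
  simp only [E_inv]
  refine hgi.smul (continuousWithinAt_matrix fun i j => ?_)
  fin_cases i <;> fin_cases j
  · exact continuousWithinAt_const
  · exact h.neg
  · exact h
  · exact continuousWithinAt_const

theorem IsStep.continuousWithinAt_M (h : IsStep u qm qp) (x : ℝ) {k : ℂ} (hk : 0 ≤ k.im)
    (hW : jostWr u qm qp k ≠ 0) : ContinuousWithinAt (M u qm qp x) {k | 0 ≤ k.im} k := by
  have e1 := continuousWithinAt_pi.1 (continuousOn_muMinus h.left h.pos' x k hk)
  have e2 := continuousWithinAt_pi.1 (continuousOn_muPlus h.right h.pos x k hk)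
  have e3 := (h.continuousOn_jostWr k hk).inv₀ hW
  have hl := continuousOn_lam h.pos k hk
  have e4 : ContinuousWithinAt (gam qp) {k | 0 ≤ k.im} k := by
    rw [show gam qp = _ from funext (gam_eq h.pos)]
    exact (continuousWithinAt_const.mul hl).div (continuousWithinAt_id.sub hl)
      (sub_lam_ne_zero h.pos k)
  refine continuousWithinAt_matrix fun i j => ?_
  simp only [M_eq]
  fin_cases i <;> fin_cases j
  · exact (e4.mul e3).mul (e1 0)
  · exact e2 0
  · exact (e4.mul e3).mul (e1 1)
  · exact e2 1

theorem IsStep.continuousWithinAt_N (h : IsStep u qm qp) (x : ℝ) {k : ℂ} (hk : 0 ≤ k.im)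
    (hW : jostWr u qm qp k ≠ 0) (hl : lam qp k ≠ 0) :
    ContinuousWithinAt (N u qm qp x) {k | 0 ≤ k.im} k :=
  ContinuousWithinAt.mul (h.continuousWithinAt_M x hk hW)
    (continuousWithinAt_E_inv h.pos (continuousOn_lam h.pos k hk) hl)

theorem IsStep.differentiableAt_M (h : IsStep u qm qp) (x : ℝ) {k : ℂ} (hk : k ∉ cutC qp)
    (hW : jostWr u qm qp k ≠ 0) (i j : Fin 2) :
    DifferentiableAt ℂ (fun k => M u qm qp x k i j) k := by
  have ho := (isClosed_cutC qp).isOpen_compl.mem_nhds hk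
  have ho' := (isClosed_cutC qm).isOpen_compl.mem_nhds (h.notMem hk)
  have e1 := differentiableAt_pi.1 ((differentiableOn_muMinus h.left h.pos' x).differentiableAt ho')
  have e2 := differentiableAt_pi.1 ((differentiableOn_muPlus h.right h.pos x).differentiableAt ho)
  have e3 := (h.differentiableOn_jostWr.differentiableAt ho).inv hW
  have hl := differentiableAt_lam hk
  have e4 : DifferentiableAt ℂ (gam qp) k := by
    rw [show gam qp = _ from funext (gam_eq h.pos)]
    exact ((differentiableAt_const _).mul hl).div (differentiableAt_id.sub hl)
      (sub_lam_ne_zero h.pos k)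
  simp only [M_eq]
  fin_cases i <;> fin_cases j
  · exact (e4.mul e3).mul (e1 0)
  · exact e2 0
  · exact (e4.mul e3).mul (e1 1)
  · exact e2 1

theorem differentiableAt_E_inv (ha : 0 < a) {k : ℂ} (hk : k ∉ cutC a) (i j : Fin 2) :
    DifferentiableAt ℂ (fun k => (E a k)⁻¹ i j) k := by
  have hl := differentiableAt_lam hk
  have hz := sub_lam_ne_zero ha k
  have h : DifferentiableAt ℂ (fun k => I * a / (k - lam a k)) k :=
    (differentiableAt_const _).div (differentiableAt_id.sub hl) hz
  have hg : DifferentiableAt ℂ (gam a) k := by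
    rw [show gam a = _ from funext (gam_eq ha)]
    exact ((differentiableAt_const _).mul hl).div (differentiableAt_id.sub hl) hz
  have hgi := hg.inv (gam_ne_zero ha (lam_ne_zero hk))
  simp only [E_inv]
  fin_cases i <;> fin_cases j
  · exact hgi.mul (differentiableAt_const _)
  · exact hgi.mul h.neg
  · exact hgi.mul h
  · exact hgi.mul (differentiableAt_const _)

theorem IsStep.differentiableAt_N (h : IsStep u qm qp) (x : ℝ) {k : ℂ} (hk : k ∉ cutC qp)
    (hW : jostWr u qm qp k ≠ 0) (i j : Fin 2) :
    DifferentiableAt ℂ (fun k => N u qm qp x k i j) k := by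
  simp only [N, Matrix.mul_apply, Fin.sum_univ_two]
  exact ((h.differentiableAt_M x hk hW i 0).mul (differentiableAt_E_inv h.pos hk 0 j)).add
    ((h.differentiableAt_M x hk hW i 1).mul (differentiableAt_E_inv h.pos hk 1 j))

/-- `A ↦ σ₁ Ā σ₁`. -/
def conjFlip (A : Matrix (Fin 2) (Fin 2) ℂ) : Matrix (Fin 2) (Fin 2) ℂ :=
  !![conj (A 1 1), conj (A 1 0); conj (A 0 1), conj (A 0 0)]

theorem conjFlip_apply (A : Matrix (Fin 2) (Fin 2) ℂ) (i j : Fin 2) :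
    conjFlip A i j = conj (A (1 - i) (1 - j)) := by
  fin_cases i <;> fin_cases j <;> rfl

theorem conjFlip_conjFlip (A : Matrix (Fin 2) (Fin 2) ℂ) : conjFlip (conjFlip A) = A := by
  ext i j; fin_cases i <;> fin_cases j <;> simp [conjFlip]

theorem continuous_conjFlip : Continuous conjFlip :=
  continuous_pi fun i => continuous_pi fun j => by
    simp only [conjFlip_apply]
    exact continuous_conj.comp ((continuous_apply _).comp (continuous_apply _))

theorem Wr_conjSwap (φ ψ : ℝ → Fin 2 → ℂ) :
    Wr (fun x => conjSwap (φ x)) (fun x => conjSwap (ψ x)) = -conj (Wr φ ψ) := by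
  simp [Wr, conjSwap]

theorem IsStep.jostWr_conj (h : IsStep u qm qp) {k : ℂ} (hk : k ∉ cutC qp) :
    jostWr u qm qp (conj k) = I * qm / (conj k - lam qm (conj k)) *
      (I * qp / (conj k - lam qp (conj k))) * conj (jostWr u qm qp k) := by
  rw [jostWr_eq, jostWr_eq, muMinus_zero_conj h.left h.pos' (h.notMem hk),
    muPlus_one_conj h.right h.pos hk]
  simp [conjSwap]; ring

/-- The symmetry `N(k̄) = σ₁ conj N(k) σ₁`. It reduces the lower half-plane to the upper one. -/
theorem IsStep.N_conj (h : IsStep u qm qp) (x : ℝ) {k : ℂ} (hk : k ∉ cutC qp) :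
    N u qm qp x (conj k) = conjFlip (N u qm qp x k) := by
  have hl := lam_ne_zero hk
  have hl' : lam qp (conj k) ≠ 0 := lam_ne_zero (mt conj_mem_cutC.1 hk)
  have hcl : conj (lam qp k) ≠ 0 := (map_ne_zero _).2 hl
  have hz := sub_lam_ne_zero h.pos k
  have hz2 : conj k - conj (lam qp k) ≠ 0 := by rw [← map_sub]; exact (map_ne_zero _).2 hz
  have hz' : conj k + conj (lam qp k) ≠ 0 := by
    rw [← map_add]; exact (map_ne_zero _).2 (add_lam_ne_zero h.pos k)
  have hzm' := sub_lam_ne_zero h.pos' (conj k)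
  have hq : (qp : ℂ) ≠ 0 := ofReal_ne_zero.2 h.pos.ne'
  have hm : (qm : ℂ) ≠ 0 := ofReal_ne_zero.2 h.pos'.ne'
  have h3 := congrArg conj (sub_mul_add_lam h.pos k)
  simp only [map_mul, map_sub, map_add, map_pow, conj_ofReal] at h3
  rw [N_eq h.pos x hl, N_eq h.pos x hl', h.jostWr_conj hk,
    muMinus_zero_conj h.left h.pos' (h.notMem hk), muPlus_one_conj h.right h.pos hk,
    lam_conj h.pos hk]
  rw [mul_inv _ (conj (jostWr u qm qp k)), ← map_inv₀]
  obtain ⟨W, hW'⟩ : ∃ W, W = conj (jostWr u qm qp k)⁻¹ := ⟨_, rfl⟩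
  rw [← hW']
  set lm := lam qm (conj k)
  set l := conj (lam qp k)
  set k' := conj k
  rw [sub_neg_eq_add]
  -- the scalar factors of the conjugated Jost solutions and of their Wronskian
  have c1 : (I * qm / (k' - lm) * (I * qp / (k' + l)))⁻¹ * -(I * qm / (k' - lm)) =
      I * qp / (k' - l) := by
    field_simp; linear_combination -h3 - (qp : ℂ) ^ 2 * I_sq
  have c2 : I * qp * (2 * -l)⁻¹ * (I * qp / (k' + l)) = (k' - l) * (2 * l)⁻¹ := by
    field_simp; linear_combination -h3 - (qp : ℂ) ^ 2 * I_sq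
  have c3 : I * qp * (k' + l)⁻¹ * (I * qp / (k' - l)) = -1 := by
    field_simp; linear_combination h3 + (qp : ℂ) ^ 2 * I_sq
  have c4 : (k' + l) * (2 * -l)⁻¹ * (I * qp / (k' + l)) = - (I * qp * (2 * l)⁻¹) := by
    field_simp
  have hcs : ∀ (v : Fin 2 → ℂ) i, conjSwap v i = conj (v (1 - i)) := fun v i => by
    fin_cases i <;> rfl
  obtain ⟨X, hX⟩ : ∃ X, X = (I * qm / (k' - lm) * (I * qp / (k' + l)))⁻¹ := ⟨_, rfl⟩
  rw [← hX] at c1 ⊢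
  ext i j
  rw [conjFlip_apply]
  set A := conj (muMinus u qm 0 k x (1 - i)) with hA
  set P := conj (muPlus u qp 1 k x (1 - i)) with hP
  fin_cases j
  · have hR : conj (-(I * qp * (k - lam qp k)⁻¹ * (jostWr u qm qp k)⁻¹ *
        muMinus u qm 0 k x (1 - i)) -
        (k - lam qp k) * (2 * lam qp k)⁻¹ * muPlus u qp 1 k x (1 - i)) =
        I * qp / (k' - l) * W * A - (k' - l) * (2 * l)⁻¹ * P := by
      simp only [map_sub, map_neg, map_mul, conj_I, conj_ofReal, map_inv₀, map_ofNat, hA, hP, hW', k', l]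
      ring
    simp [hcs, ← hA, ← hP]
    simp at hR
    rw [hR]
    linear_combination (W * A) * c1 - P * c2
  · have hR : conj ((jostWr u qm qp k)⁻¹ * muMinus u qm 0 k x (1 - i) -
        I * qp * (2 * lam qp k)⁻¹ * muPlus u qp 1 k x (1 - i)) =
        W * A + I * qp * (2 * l)⁻¹ * P := by
      simp only [map_sub, map_mul, conj_I, conj_ofReal, map_inv₀, map_ofNat, hA, hP, hW', l]
      ring
    simp [hcs, ← hA, ← hP]
    simp at hR
    rw [hR]
    linear_combination (-(I * qp * (k' + l)⁻¹) * W * A) * c1 - W * A * c3 - P * c4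

theorem IsStep.M_eq_N_mul (h : IsStep u qm qp) (x : ℝ) {k : ℂ} (hl : lam qp k ≠ 0) :
    M u qm qp x k = N u qm qp x k * E qp k := by
  rw [N, Matrix.mul_assoc, E_inv_mul h.pos hl, Matrix.mul_one]

theorem conjFlip_mul (A B : Matrix (Fin 2) (Fin 2) ℂ) :
    conjFlip (A * B) = conjFlip A * conjFlip B := by
  ext i j
  fin_cases i <;> fin_cases j <;>
    simp [conjFlip, Matrix.mul_apply, Fin.sum_univ_two] <;> ring

theorem conjFlip_one : conjFlip 1 = 1 := by
  ext i j; fin_cases i <;> fin_cases j <;> simp [conjFlip]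

instance (s : ℝ) : (𝓝[{z : ℂ | 0 < z.im}] (s : ℂ)).NeBot :=
  mem_closure_iff_nhdsWithin_neBot.1 (by rw [closure_setOfPred_lt_im]; simp)

instance (s : ℝ) : (𝓝[{z : ℂ | z.im < 0}] (s : ℂ)).NeBot :=
  mem_closure_iff_nhdsWithin_neBot.1 (by rw [closure_setOfPred_im_lt]; simp)

theorem tendsto_conj_below (s : ℝ) :
    Tendsto conj (𝓝[{z : ℂ | z.im < 0}] (s : ℂ)) (𝓝[{z : ℂ | 0 < z.im}] (s : ℂ)) := by
  refine tendsto_nhdsWithin_iff.2 ⟨?_, ?_⟩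
  · have := (continuous_conj.tendsto (s : ℂ)).mono_left
      (nhdsWithin_le_nhds (s := {z : ℂ | z.im < 0}))
    rwa [conj_ofReal] at this
  · filter_upwards [self_mem_nhdsWithin] with z hz
    have : z.im < 0 := hz
    simpa using this

theorem tendsto_above_of_continuousWithinAt {X : Type*} [TopologicalSpace X] {F : ℂ → X} {s : ℝ}
    (h : ContinuousWithinAt F {k | 0 ≤ k.im} s) :
    Tendsto F (𝓝[{z : ℂ | 0 < z.im}] (s : ℂ)) (𝓝 (F s)) :=
  h.mono_left (nhdsWithin_mono _ fun z (hz : 0 < z.im) => show 0 ≤ z.im from hz.le)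

theorem lam_below (ha : 0 < a) {k : ℂ} (hk : k.im < 0) : lam a k = -conj (lam a (conj k)) := by
  have h : conj k ∉ cutC a := fun h => by
    have := h.1
    rw [conj_im] at this
    linarith
  simpa using lam_conj ha h

/-- The boundary value of `E` from below: on the cut, `λ` changes its sign. -/
theorem tendsto_E_below (ha : 0 < a) {s : ℝ} (hs : s ∈ cut a) :
    Tendsto (E a) (𝓝[{z : ℂ | z.im < 0}] (s : ℂ))
      (𝓝 !![1, I * a / (s + lam a s); -(I * a / (s + lam a s)), 1]) := by
  have h1 := (tendsto_above_of_continuousWithinAt (continuousOn_lam ha (s : ℂ) (by simp))).comp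
    (tendsto_conj_below s)
  have h2 : Tendsto (lam a) (𝓝[{z : ℂ | z.im < 0}] (s : ℂ)) (𝓝 (-lam a s)) := by
    have h3 := ((continuous_conj.tendsto _).comp h1).neg
    rw [conj_lam_of_mem_cutC (mem_cutC_ofReal.2 hs)] at h3
    refine h3.congr' ?_
    filter_upwards [self_mem_nhdsWithin] with k hk
    exact (lam_below ha hk).symm
  have h4 : Tendsto (fun k => I * a / (k - lam a k)) (𝓝[{z : ℂ | z.im < 0}] (s : ℂ))
      (𝓝 (I * a / (s + lam a s))) := by
    have h5 := (tendsto_id.mono_left (nhdsWithin_le_nhds (a := (s : ℂ)))).sub h2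
    rw [sub_neg_eq_add] at h5
    exact tendsto_const_nhds.div h5 (add_lam_ne_zero ha s)
  rw [show E a = fun k => _ from funext (E_eq a)]
  refine tendsto_pi_nhds.2 fun i => tendsto_pi_nhds.2 fun j => ?_
  fin_cases i <;> fin_cases j
  · exact tendsto_const_nhds
  · exact h4
  · exact h4.neg
  · exact tendsto_const_nhds

theorem below_E (ha : 0 < a) {s : ℝ} (hs : s ∈ cut a) :
    below (E a) s = !![1, I * a / (s + lam a s); -(I * a / (s + lam a s)), 1] :=
  (tendsto_E_below ha hs).limUnder_eq

/-- The boundary values satisfy `E⁻ (E⁺ - 1) = E⁺`, as `(i a / (s + λ)) (i a / (s - λ)) = -1`. -/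
theorem below_E_mul (ha : 0 < a) {s : ℝ} (hs : s ∈ cut a) :
    below (E a) s * (E a s - 1) = E a s := by
  have h1 := sub_lam_ne_zero ha s
  have h2 := add_lam_ne_zero ha s
  have h3 := sub_mul_add_lam ha s
  have h4 : I * a / (s + lam a s) * (I * a / (s - lam a s)) = -1 := by
    field_simp
    linear_combination h3 + (a : ℂ) ^ 2 * I_sq
  rw [below_E ha hs, E_eq]
  ext i j
  fin_cases i <;> fin_cases j <;> simp [Matrix.mul_apply, Fin.sum_univ_two] <;>
    linear_combination -h4

theorem conjFlip_E {k : ℂ} (hk : k ∈ cutC a) : conjFlip (E a k) = E a k := by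
  ext i j
  fin_cases i <;> fin_cases j <;>
    simp [conjFlip, E_eq, conj_lam_of_mem_cutC hk, conj_of_mem_cutC hk] <;> ring

namespace IsStep

variable (h : IsStep u qm qp) {s : ℝ} (hs : qp < |s|) (hW : jostWr u qm qp s ≠ 0) (x : ℝ)
include h hs hW

theorem tendsto_N_above :
    Tendsto (N u qm qp x) (𝓝[{z : ℂ | 0 < z.im}] (s : ℂ)) (𝓝 (N u qm qp x s)) :=
  tendsto_above_of_continuousWithinAt
    (h.continuousWithinAt_N x (by simp) hW (lam_ne_zero_of_abs h.pos hs.ne'))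

omit hs in
theorem tendsto_M_above :
    Tendsto (M u qm qp x) (𝓝[{z : ℂ | 0 < z.im}] (s : ℂ)) (𝓝 (M u qm qp x s)) :=
  tendsto_above_of_continuousWithinAt (h.continuousWithinAt_M x (by simp) hW)

theorem tendsto_N_below :
    Tendsto (N u qm qp x) (𝓝[{z : ℂ | z.im < 0}] (s : ℂ)) (𝓝 (conjFlip (N u qm qp x s))) := by
  refine (((continuous_conjFlip.tendsto _).comp (h.tendsto_N_above hs hW x)).comp
    (tendsto_conj_below s)).congr' ?_
  filter_upwards [self_mem_nhdsWithin] with k hk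
  have hk' : conj k ∉ cutC qp := fun h0 => by
    have h1 := h0.1
    rw [conj_im] at h1
    have : k.im < 0 := hk
    linarith
  simpa using (h.N_conj x hk').symm

theorem tendsto_M_below : Tendsto (M u qm qp x) (𝓝[{z : ℂ | z.im < 0}] (s : ℂ))
    (𝓝 (conjFlip (N u qm qp x s) * below (E qp) s)) := by
  have h1 := tendsto_E_below h.pos (s := s) hs.le
  rw [← below_E h.pos (s := s) hs.le] at h1
  refine ((h.tendsto_N_below hs hW x).mul h1).congr' ?_
  filter_upwards [self_mem_nhdsWithin] with k hk
  have hk' : k ∉ cutC qp := fun h0 => (show k.im < 0 from hk).ne h0.1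
  exact (h.M_eq_N_mul x (lam_ne_zero hk')).symm

theorem above_N : above (N u qm qp x) s = N u qm qp x s := (h.tendsto_N_above hs hW x).limUnder_eq

omit hs in
theorem above_M : above (M u qm qp x) s = M u qm qp x s := (h.tendsto_M_above hW x).limUnder_eq

theorem below_N : below (N u qm qp x) s = conjFlip (N u qm qp x s) :=
  (h.tendsto_N_below hs hW x).limUnder_eq

theorem below_M : below (M u qm qp x) s = below (N u qm qp x) s * below (E qp) s := by
  rw [h.below_N hs hW]; exact (h.tendsto_M_below hs hW x).limUnder_eq

/-- `M⁻ (E₊ - 1)` is the conjugate of `M⁺` with rows and columns exchanged. -/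
theorem below_M_mul : below (M u qm qp x) s * (E qp s - 1) = conjFlip (M u qm qp x s) := by
  have hl := lam_ne_zero_of_abs h.pos hs.ne'
  have hc := mem_cutC_ofReal.2 (show s ∈ cut qp from hs.le)
  have hE := conjFlip_E hc
  rw [h.below_M hs hW, Matrix.mul_assoc, below_E_mul h.pos (show s ∈ cut qp from hs.le),
    h.below_N hs hW, h.M_eq_N_mul x hl, conjFlip_mul, hE]

end IsStep

end BoundaryValues

section Jump

variable {u : ℝ → ℝ} {a qm qp : ℝ}

theorem IsSol.wr_smul {k : ℂ} {φ ψ χ : ℝ → Fin 2 → ℂ} (hφ : IsSol u k φ) (hψ : IsSol u k ψ)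
    (hχ : IsSol u k χ) (x : ℝ) : Wr φ ψ • χ x = Wr χ ψ • φ x + Wr φ χ • ψ x := by
  rw [← hφ.wronskian_eq hψ x, ← hχ.wronskian_eq hψ x, ← hφ.wronskian_eq hχ x]
  ext i
  fin_cases i <;> simp <;> ring

/-- On the cut, the two Jost solutions at `+∞` have the Wronskian `γ`. -/
theorem wr_phiPlus (hu : IsProfile u a) (ha : 0 < a) {k : ℂ} (hk : k ∈ cutC a) :
    Wr (phiPlus u a 0 k) (phiPlus u a 1 k) = gam a k := by
  have h1 := isJost_phiPlus_one hu ha k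
  have h0 : IsJost u a atTop 0 k (phiPlus u a 0 k) := by
    rw [phiPlus_zero_eq hu ha hk]
    exact h1.conjSwap_cut (by decide) hk
  have l0 := tendsto_pi_nhds.1 h0.2
  have l1 := tendsto_pi_nhds.1 h1.2
  have l := ((l0 0).mul (l1 1)).sub ((l0 1).mul (l1 0))
  have hd : E a k 0 0 * E a k 1 1 - E a k 1 0 * E a k 0 1 = gam a k := by
    rw [gam, det_fin_two]; ring
  rw [hd] at l
  refine tendsto_nhds_unique (tendsto_const_nhds.congr fun x => ?_) l
  rw [← IsSol.wronskian_eq h0.1 h1.1 x]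
  have he : exp (I * lam a k * x * sigma3 0 0) * exp (I * lam a k * x * sigma3 1 1) = 1 := by
    rw [← exp_add]; simp [sigma3]
  simp only [normalize, Pi.smul_apply, smul_eq_mul]
  linear_combination (-(phiPlus u a 0 k x 0 * phiPlus u a 1 k x 1 -
    phiPlus u a 0 k x 1 * phiPlus u a 1 k x 0)) * he

theorem conj_gam {k : ℂ} (hk : k ∈ cutC a) : conj (gam a k) = gam a k := by
  rw [gam, E_eq, det_fin_two_of]
  simp [conj_lam_of_mem_cutC hk, conj_of_mem_cutC hk]
  ring

namespace IsStep

variable (h : IsStep u qm qp) {s : ℝ} (hs : qp < |s|) (hW : jostWr u qm qp s ≠ 0)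
include h hs

/-- The scattering relation `φ_{-,1} = s₁₁ φ_{+,1} + s₂₁ φ_{+,2}`. -/
theorem phiMinus_zero_scatter (x : ℝ) : phiMinus u qm 0 s x =
    s11 u qm qp s • phiPlus u qp 0 s x + s21 u qm qp s • phiPlus u qp 1 s x := by
  have hc := mem_cutC_ofReal.2 (show s ∈ cut qp from hs.le)
  have h1 := isJost_phiPlus_one h.right h.pos s
  have h0 : IsSol u s (phiPlus u qp 0 s) := by
    rw [phiPlus_zero_eq h.right h.pos hc]
    exact (h1.conjSwap_cut (j' := 0) (by decide) hc).1
  have hm := isJost_phiMinus_zero h.left h.pos' s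
  have e := IsSol.wr_smul h0 h1.1 hm.1 x
  rw [wr_phiPlus h.right h.pos hc] at e
  have hg := gam_ne_zero h.pos (lam_ne_zero_of_abs h.pos hs.ne')
  rw [s11, s21, div_eq_inv_mul, div_eq_inv_mul, mul_smul, mul_smul, ← smul_add, ← e, smul_smul,
    inv_mul_cancel₀ hg, one_smul]

omit hs in
theorem s22_eq (hm : s ∈ cut qm) : s22 u qm qp s = conj (s11 u qm qp s) := by
  have hcm := mem_cutC_ofReal.2 hm
  have hc := cutC_anti h.lt.le hcm
  rw [s22, s11, phiPlus_zero_eq h.right h.pos hc, phiMinus_one_eq h.left h.pos' hcm, Wr_conjSwap,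
    map_div₀, conj_gam hc]
  simp [Wr, mul_comm]

omit hs in
theorem s12_eq (hm : s ∈ cut qm) : s12 u qm qp s = conj (s21 u qm qp s) := by
  have hcm := mem_cutC_ofReal.2 hm
  have hc := cutC_anti h.lt.le hcm
  rw [s12, s21, phiPlus_zero_eq h.right h.pos hc, phiMinus_one_eq h.left h.pos' hcm,
    map_div₀, conj_gam hc]
  simp [Wr, conjSwap]
  ring

include hW in
theorem s11_ne_zero : s11 u qm qp s ≠ 0 :=
  div_ne_zero hW (gam_ne_zero h.pos (lam_ne_zero_of_abs h.pos hs.ne'))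

/-- The jump relation, where `conjFlip M` is the boundary value `M⁻ (E₊ - 1)`. -/
theorem M_eq_conjFlip_mul (x : ℝ) (hW : jostWr u qm qp s ≠ 0) :
    M u qm qp x s = conjFlip (M u qm qp x s) * (1 - V0 u qm qp x s) := by
  have hc := mem_cutC_ofReal.2 (show s ∈ cut qp from hs.le)
  have hs11 := h.s11_ne_zero hs hW
  have hs11c : conj (s11 u qm qp s) ≠ 0 := (map_ne_zero _).2 hs11
  have hlr := conj_lam_of_mem_cutC hc
  have hp0 : ∀ i, phiPlus u qp 0 s x i = conj (phiPlus u qp 1 s x (1 - i)) := by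
    rw [phiPlus_zero_eq h.right h.pos hc]; intro i; fin_cases i <;> rfl
  have hsc1 : ∀ i, phiMinus u qm 0 s x i = s11 u qm qp s * phiPlus u qp 0 s x i +
      s21 u qm qp s * phiPlus u qp 1 s x i := fun i => by rw [h.phiMinus_zero_scatter hs x]; rfl
  -- the columns of `M` and of `conjFlip M`
  set em := exp (I * lam qm s * x) with hem
  set ep := exp (I * lam qp s * x) with hep
  have hem0 : em ≠ 0 := exp_ne_zero _
  have hep0 : ep ≠ 0 := exp_ne_zero _
  have m1 : ∀ i, M u qm qp x s i 1 = ep⁻¹ * phiPlus u qp 1 s x i := by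
    intro i; rw [hep, ← exp_neg]; fin_cases i <;> simp [M, muPlus, normalize, sigma3]
  have m0 : ∀ i, M u qm qp x s i 0 = em * phiMinus u qm 0 s x i / s11 u qm qp s := by
    intro i; fin_cases i <;> simp [M, muMinus, normalize, sigma3, hem]
  have c0 : ∀ i, conjFlip (M u qm qp x s) i 0 = ep * phiPlus u qp 0 s x i := by
    intro i
    rw [conjFlip_apply, hp0, show (1 - 0 : Fin 2) = 1 from rfl, m1, map_mul, hep, ← exp_neg,
      ← Complex.exp_conj]
    simp [hlr]
  have hentry : ∀ i j, (conjFlip (M u qm qp x s) * (1 - V0 u qm qp x s)) i j =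
      conjFlip (M u qm qp x s) i 0 * ((1 : Matrix (Fin 2) (Fin 2) ℂ) 0 j - V0 u qm qp x s 0 j) +
      conjFlip (M u qm qp x s) i 1 * ((1 : Matrix (Fin 2) (Fin 2) ℂ) 1 j - V0 u qm qp x s 1 j) := by
    intro i j; rw [Matrix.mul_apply, Fin.sum_univ_two]; rfl
  have x1 : exp (I * (lam qm s - lam qp s) * x) = em / ep := by
    rw [hem, hep, ← exp_sub]; congr 1; ring
  have x2 : exp (-2 * I * lam qp s * x) = (ep ^ 2)⁻¹ := by
    rw [hep, ← exp_nat_mul, ← exp_neg]; congr 1; push_cast; ring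
  have x3 : exp (2 * I * lam qm s * x) = em ^ 2 := by
    rw [hem, ← exp_nat_mul]; congr 1; push_cast; ring
  have x4 : exp (-I * (lam qp s + lam qm s) * x) = (ep * em)⁻¹ := by
    rw [hem, hep, ← exp_add, ← exp_neg]; congr 1; ring
  have hcol : ∀ {A B : Matrix (Fin 2) (Fin 2) ℂ}, (∀ i, A i 0 = B i 0 ∧ A i 1 = B i 1) → A = B := by
    intro A B hAB
    ext i j
    fin_cases j
    exacts [(hAB i).1, (hAB i).2]
  by_cases hm : s ∈ cut qm
  · have hcm := mem_cutC_ofReal.2 hm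
    have hlm := conj_lam_of_mem_cutC hcm
    have hm1 : ∀ i, phiMinus u qm 1 s x i = conj (phiMinus u qm 0 s x (1 - i)) := by
      rw [phiMinus_one_eq h.left h.pos' hcm]; intro i; fin_cases i <;> rfl
    have hs22 : s22 u qm qp s ≠ 0 := by rw [h.s22_eq hm]; exact hs11c
    have c1 : ∀ i, conjFlip (M u qm qp x s) i 1 =
        em⁻¹ * phiMinus u qm 1 s x i / s22 u qm qp s := by
      intro i
      rw [conjFlip_apply, hm1, show (1 - 1 : Fin 2) = 0 from rfl, m0, map_div₀, map_mul, hem,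
        ← Complex.exp_conj, ← exp_neg, h.s22_eq hm]
      simp [hlm]
    have hsc2 : ∀ i, phiMinus u qm 1 s x i = s12 u qm qp s * phiPlus u qp 0 s x i +
        s22 u qm qp s * phiPlus u qp 1 s x i := fun i => by
      rw [hm1, hsc1, hp0, hp0, h.s12_eq hm, h.s22_eq hm]
      simp; ring
    refine hcol fun i => ⟨?_, ?_⟩ <;> rw [hentry, c0, c1, V0, if_pos hm, hsc2, x1, x2, x3]
    · simp [m0, hsc1, rho, rhoT]
      field_simp
      ring
    · simp [m1, rhoT]
      field_simp
      ring
  · have hcm : (s : ℂ) ∉ cutC qm := mt mem_cutC_ofReal.1 hm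
    set f := I * qm / (s - lam qm s) with hf
    -- in the gap of the left background, `φ_{-,1}` is self-conjugate up to a factor
    have hself : ∀ y i, muMinus u qm 0 s y i = -f * conj (muMinus u qm 0 s y (1 - i)) := by
      intro y i
      have := muMinus_zero_conj h.left h.pos' hcm y
      rw [conj_ofReal] at this
      conv_lhs => rw [this]
      fin_cases i <;> simp [conjSwap, hf]
    have hf0 : f ≠ 0 := div_ne_zero (mul_ne_zero I_ne_zero (ofReal_ne_zero.2 h.pos'.ne'))
      (sub_lam_ne_zero h.pos' _)
    have hself0 : ∀ i, phiMinus u qm 0 s 0 i = -f * conj (phiMinus u qm 0 s 0 (1 - i)) := by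
      intro i
      simpa [muMinus, normalize] using hself 0 i
    have hs21 : s21 u qm qp s = -f * conj (s11 u qm qp s) := by
      rw [s21, s11, map_div₀, conj_gam hc, phiPlus_zero_eq h.right h.pos hc]
      have e0 : phiMinus u qm 0 s 0 0 = -f * conj (phiMinus u qm 0 s 0 1) := hself0 0
      have e1 : phiMinus u qm 0 s 0 1 = -f * conj (phiMinus u qm 0 s 0 0) := hself0 1
      simp only [Wr, conjSwap, cons_val_zero, cons_val_one, map_sub, map_mul]
      linear_combination (conj (phiPlus u qp 1 s 0 1) / gam qp s) * e1 -
        (conj (phiPlus u qp 1 s 0 0) / gam qp s) * e0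
    have c1 : ∀ i, conjFlip (M u qm qp x s) i 1 =
        em * phiMinus u qm 0 s x i / s21 u qm qp s := by
      intro i
      have e0 := hself x i
      have e1 : ∀ i, muMinus u qm 0 s x i = em * phiMinus u qm 0 s x i := fun i => by
        simp [muMinus, normalize, sigma3, hem]
      rw [conjFlip_apply, show (1 - 1 : Fin 2) = 0 from rfl, m0, ← e1, ← e1, e0, hs21, map_div₀]
      field_simp
    have hs210 : s21 u qm qp s ≠ 0 := by rw [hs21]; exact mul_ne_zero (neg_ne_zero.2 hf0) hs11c
    refine hcol fun i => ⟨?_, ?_⟩ <;> rw [hentry, c0, c1, V0, if_neg hm, x2, x4]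
    · simp [m0, rho]
      field_simp
    · simp [m1, rho, hsc1]
      field_simp
      ring

end IsStep

end Jump

/-! ### Cauchy's formula in the upper half-plane -/

section HalfPlane

open Set

/-- The weight `|s² - a²|^{-1/2}`. -/
def sqrtWeight (a s : ℝ) : ℝ := (√|s ^ 2 - a ^ 2|)⁻¹

theorem integrableOn_inv_sqrt_mul : IntegrableOn (fun y : ℝ => (√|y|)⁻¹ * (1 + |y|)⁻¹) (Ioi 0) := by
  have hm : Measurable fun y : ℝ => (√|y|)⁻¹ * (1 + |y|)⁻¹ := by fun_prop
  rw [← Ioc_union_Ioi_eq_Ioi (zero_le_one (α := ℝ))]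
  refine IntegrableOn.union ?_ ?_
  · have h := (intervalIntegral.intervalIntegrable_rpow' (a := 0) (b := 1) (r := -1 / 2)
      (by norm_num)).1
    refine Integrable.mono' h hm.aestronglyMeasurable ?_
    filter_upwards [ae_restrict_mem measurableSet_Ioc] with y hy
    have hy0 : 0 < y := hy.1
    rw [Real.norm_of_nonneg (by positivity), abs_of_pos hy0]
    have : y ^ (-1 / 2 : ℝ) = (√y)⁻¹ := by
      rw [Real.sqrt_eq_rpow, ← Real.rpow_neg hy0.le]; norm_num
    rw [this]
    exact mul_le_of_le_one_right (by positivity) (inv_le_one_of_one_le₀ (by linarith))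
  · have h := integrableOn_Ioi_rpow_of_lt (a := -3 / 2) (c := 1) (by norm_num) one_pos
    refine Integrable.mono' h hm.aestronglyMeasurable ?_
    filter_upwards [ae_restrict_mem measurableSet_Ioi] with y hy
    have hy0 : 0 < y := zero_lt_one.trans hy
    rw [Real.norm_of_nonneg (by positivity), abs_of_pos hy0]
    have : y ^ (-3 / 2 : ℝ) = (√y)⁻¹ * y⁻¹ := by
      rw [Real.sqrt_eq_rpow, ← Real.rpow_neg hy0.le, ← Real.rpow_neg_one, ← Real.rpow_add hy0]
      norm_num
    rw [this]
    gcongr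
    linarith

theorem integrable_inv_sqrt_mul : Integrable fun y : ℝ => (√|y|)⁻¹ * (1 + |y|)⁻¹ := by
  rw [← integrableOn_univ, ← Iic_union_Ioi (a := (0 : ℝ))]
  refine IntegrableOn.union ?_ integrableOn_inv_sqrt_mul
  have h := integrableOn_inv_sqrt_mul.comp_neg
  rw [integrableOn_Iic_iff_integrableOn_Iio]
  simpa using h

theorem integrable_sqrtWeight {a : ℝ} (ha : 0 < a) :
    Integrable fun s => sqrtWeight a s * (1 + |s|)⁻¹ := by
  have h0 := integrable_inv_sqrt_mul
  have h := ((h0.comp_sub_right a).add (h0.comp_add_right a)).const_mul ((√a)⁻¹ * (1 + a))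
  refine h.mono' (by unfold sqrtWeight; fun_prop) (ae_of_all _ fun s => ?_)
  have hw : 0 ≤ sqrtWeight a s * (1 + |s|)⁻¹ := by unfold sqrtWeight; positivity
  rw [Real.norm_of_nonneg hw]
  have hfac : |s ^ 2 - a ^ 2| = |s - a| * |s + a| := by rw [← abs_mul]; congr 1; ring
  have key : ∀ b c : ℝ, a ≤ |c| → 0 ≤ |b| → 1 + |b| ≤ (1 + a) * (1 + |s|) →
      (√(|b| * |c|))⁻¹ * (1 + |s|)⁻¹ ≤ (√a)⁻¹ * (1 + a) * ((√|b|)⁻¹ * (1 + |b|)⁻¹) := by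
    intro b c hc _ hb
    rw [Real.sqrt_mul (abs_nonneg _), mul_inv]
    have h1 : (√|c|)⁻¹ ≤ (√a)⁻¹ := inv_anti₀ (Real.sqrt_pos.2 ha) (Real.sqrt_le_sqrt hc)
    have h2 : (1 + |s|)⁻¹ ≤ (1 + a) * (1 + |b|)⁻¹ := by
      rw [← div_eq_mul_inv, inv_eq_one_div, div_le_div_iff₀ (by positivity) (by positivity)]
      linarith
    calc (√|b|)⁻¹ * (√|c|)⁻¹ * (1 + |s|)⁻¹ ≤ (√|b|)⁻¹ * (√a)⁻¹ * ((1 + a) * (1 + |b|)⁻¹) := by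
          gcongr
      _ = _ := by ring
  have hp : ∀ b : ℝ, 0 ≤ (√|b|)⁻¹ * (1 + |b|)⁻¹ := fun b => by positivity
  have hc0 : 0 ≤ (√a)⁻¹ * (1 + a) := by positivity
  simp only [sqrtWeight, hfac, Pi.add_apply, mul_add]
  rcases le_total 0 s with hs | hs
  · have := key (s - a) (s + a) (by rw [abs_of_nonneg (by linarith)]; linarith) (abs_nonneg _) (by
      have := abs_sub s a
      rw [abs_of_pos ha] at this
      nlinarith [abs_nonneg s])
    have := mul_nonneg hc0 (hp (s + a))
    linarith
  · have := key (s + a) (s - a) (by rw [abs_of_nonpos (by linarith)]; linarith) (abs_nonneg _) (by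
      have := abs_add_le s a
      rw [abs_of_pos ha] at this
      nlinarith [abs_nonneg s])
    rw [mul_comm |s - a|]
    have := mul_nonneg hc0 (hp (s - a))
    linarith

/-- Cauchy's theorem for a horizontal line in the upper half-plane. -/
theorem integral_line_eq_zero {H : ℂ → ℂ} {C R ε : ℝ}
    (hd : DifferentiableOn ℂ H {z | 0 < z.im})
    (hdecay : ∀ z : ℂ, 0 < z.im → R ≤ ‖z‖ → ‖H z‖ ≤ C / ‖z‖ ^ 2) (hε : 0 < ε)
    (hint : Integrable fun x : ℝ => H (x + ε * I)) : ∫ x : ℝ, H (x + ε * I) = 0 := by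
  have h1 : Tendsto (fun r : ℝ => ∫ x in (-r)..r, H (x + ε * I)) atTop
      (𝓝 (∫ x : ℝ, H (x + ε * I))) :=
    intervalIntegral_tendsto_integral hint tendsto_neg_atTop_atBot tendsto_id
  refine tendsto_nhds_unique h1 ?_
  have h2 : Tendsto (fun r : ℝ => 4 * C / r) atTop (𝓝 0) := tendsto_const_nhds.div_atTop tendsto_id
  refine squeeze_zero_norm' ?_ h2
  filter_upwards [eventually_ge_atTop R, eventually_gt_atTop ε] with r hR hr
  have hr0 : 0 < r := hε.trans hr
  have hrect := integral_boundary_rect_eq_zero_of_differentiableOn H (-r + ε * I) (r + r * I)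
    (hd.mono fun z hz => by
      have := hz.2
      simp [uIcc_of_le hr.le] at this
      exact hε.trans_le this.1)
  simp at hrect
  have hC : ∀ z : ℂ, 0 < z.im → r ≤ ‖z‖ → ‖H z‖ ≤ C / r ^ 2 := by
    intro z hz hrz
    refine (hdecay z hz (hR.trans hrz)).trans ?_
    have hC0 : 0 ≤ C := by
      have := (norm_nonneg _).trans (hdecay z hz (hR.trans hrz))
      have h3 : 0 < ‖z‖ ^ 2 := by have := hr0.trans_le hrz; positivity
      by_contra hneg
      exact absurd this (not_le.2 (div_neg_of_neg_of_pos (not_le.1 hneg) h3))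
    gcongr
  have i1 : ‖∫ x in (-r)..r, H (x + r * I)‖ ≤ C / r ^ 2 * |r - -r| := by
    refine intervalIntegral.norm_integral_le_of_norm_le_const fun x _ => hC _ (by simp [hr0]) ?_
    have := abs_im_le_norm ((x : ℂ) + r * I)
    simp at this
    exact (le_abs_self r).trans this
  have i2 : ∀ b : ℝ, r ≤ |b| → ‖∫ y in ε..r, H (b + y * I)‖ ≤ C / r ^ 2 * |r - ε| := by
    intro b hb
    refine intervalIntegral.norm_integral_le_of_norm_le_const fun y hy => hC _ ?_ ?_
    · rw [uIoc_of_le hr.le] at hy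
      simpa using hε.trans hy.1
    · have := abs_re_le_norm ((b : ℂ) + y * I)
      simp at this
      exact hb.trans this
  have j1 := i2 r (le_abs_self r)
  have j2 := i2 (-r) (by rw [abs_neg]; exact le_abs_self r)
  push_cast at j2
  have hCr : 0 ≤ C / r ^ 2 := (norm_nonneg _).trans (hC (r * I) (by simp [hr0]) (by simp [le_abs_self]))
  have e1 : |r - ε| ≤ r := by rw [abs_of_pos (by linarith)]; linarith
  have e2 : |r - -r| = 2 * r := by rw [sub_neg_eq_add, abs_of_pos (by linarith)]; ring
  have e3 : ∫ x in (-r)..r, H (x + ε * I) = (∫ x in (-r)..r, H (x + r * I)) -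
      I * (∫ y in ε..r, H (r + y * I)) + I * ∫ y in ε..r, H (-r + y * I) := by
    linear_combination hrect
  rw [e3]
  refine (norm_add_le _ _).trans ((add_le_add_left (norm_sub_le _ _) _).trans ?_)
  rw [norm_mul, norm_mul, norm_I, one_mul, one_mul]
  rw [e2] at i1
  have e4 : C / r ^ 2 * |r - ε| ≤ C / r ^ 2 * r := by gcongr
  have e5 : C / r ^ 2 * (2 * r) + C / r ^ 2 * r + C / r ^ 2 * r = 4 * C / r := by
    field_simp; ring
  linarith

/-- Cauchy's theorem for the boundary values on the real line. -/
theorem integral_boundary_eq_zero {H : ℂ → ℂ} {h : ℝ → ℂ} {g : ℝ → ℝ} {C R δ : ℝ}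
    (hd : DifferentiableOn ℂ H {z | 0 < z.im})
    (hdecay : ∀ z : ℂ, 0 < z.im → R ≤ ‖z‖ → ‖H z‖ ≤ C / ‖z‖ ^ 2) (hδ : 0 < δ)
    (hg : Integrable g) (hHg : ∀ᵐ x : ℝ, ∀ y, 0 < y → y < δ → ‖H (x + y * I)‖ ≤ g x)
    (hlim : ∀ᵐ s : ℝ, Tendsto H (𝓝[{z : ℂ | 0 < z.im}] (s : ℂ)) (𝓝 (h s))) :
    Integrable h ∧ ∫ s, h s = 0 := by
  set ε : ℕ → ℝ := fun n => δ / (n + 2) with hε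
  have hε0 : ∀ n, 0 < ε n := fun n => by positivity
  have hε1 : ∀ n, ε n < δ := fun n => by
    rw [hε]; exact div_lt_self hδ (by have := n.cast_nonneg (α := ℝ); linarith)
  have hεlim : Tendsto ε atTop (𝓝 0) := by
    refine tendsto_const_nhds.div_atTop ?_
    exact tendsto_atTop_add_const_right _ _ tendsto_natCast_atTop_atTop
  have hcont : ∀ n, Continuous fun x : ℝ => H (x + ε n * I) := by
    intro n
    refine continuous_iff_continuousAt.2 fun x => ?_
    have hx : ((x : ℂ) + ε n * I) ∈ {z : ℂ | 0 < z.im} := by simpa using hε0 n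
    have h1 := (hd.differentiableAt ((isOpen_lt continuous_const continuous_im).mem_nhds hx)).continuousAt
    exact ContinuousAt.comp (f := fun x : ℝ => (x : ℂ) + ε n * I) h1 (by fun_prop)
  have hbound : ∀ᵐ x : ℝ, ∀ n, ‖H (x + ε n * I)‖ ≤ g x := by
    filter_upwards [hHg] with x hx n
    exact hx (ε n) (hε0 n) (hε1 n)
  have hpt : ∀ᵐ x : ℝ, Tendsto (fun n => H (x + ε n * I)) atTop (𝓝 (h x)) := by
    filter_upwards [hlim] with x hx
    refine hx.comp (tendsto_nhdsWithin_iff.2 ⟨?_, Eventually.of_forall fun n => ?_⟩)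
    · have h1 : Tendsto (fun n => (ε n : ℂ)) atTop (𝓝 0) :=
        (continuous_ofReal.tendsto' 0 0 ofReal_zero).comp hεlim
      simpa using (h1.mul_const I).const_add (x : ℂ)
    · simpa using hε0 n
  have hzero : ∀ n, ∫ x : ℝ, H (x + ε n * I) = 0 := fun n =>
    integral_line_eq_zero hd hdecay (hε0 n)
      (hg.mono' (hcont n).aestronglyMeasurable (hbound.mono fun x hx => hx n))
  have hmeas : AEStronglyMeasurable h :=
    aestronglyMeasurable_of_tendsto_ae atTop (fun n => (hcont n).aestronglyMeasurable) hpt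
  refine ⟨hg.mono' hmeas ?_, ?_⟩
  · filter_upwards [hpt, hbound] with x hx hb
    exact le_of_tendsto hx.norm (Eventually.of_forall hb)
  · have := tendsto_integral_of_dominated_convergence g (fun n => (hcont n).aestronglyMeasurable) hg
      (fun n => hbound.mono fun x hx => hx n) hpt
    simp only [hzero] at this
    exact (tendsto_nhds_unique this tendsto_const_nhds)

theorem one_add_abs_re_le {w p : ℂ} {η : ℝ} (hη : 0 < η) (h : η ≤ ‖w - p‖) :
    1 + |w.re| ≤ ((1 + ‖p‖) / η + 1) * ‖w - p‖ := by
  have h1 : |w.re| ≤ ‖p‖ + ‖w - p‖ := by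
    refine (abs_re_le_norm w).trans ?_
    have := norm_add_le p (w - p)
    rwa [add_sub_cancel] at this
  have h2 : 1 + ‖p‖ ≤ (1 + ‖p‖) / η * ‖w - p‖ := by
    rw [div_mul_eq_mul_div, le_div_iff₀ hη]; gcongr
  linarith

theorem norm_inv_sub_le {w p : ℂ} {η : ℝ} (hη : 0 < η) (h : η ≤ ‖w - p‖) :
    ‖(w - p)⁻¹‖ ≤ ((1 + ‖p‖) / η + 1) * (1 + |w.re|)⁻¹ := by
  have h1 := one_add_abs_re_le hη h
  have h2 : 0 < ‖w - p‖ := hη.trans_le h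
  rw [norm_inv, ← div_eq_mul_inv, inv_eq_one_div, div_le_div_iff₀ h2 (by positivity)]
  linarith

theorem norm_le_two_mul_sqrt {a : ℝ} (ha : 0 < a) {w : ℂ} (hw : 2 * a ≤ ‖w‖) :
    ‖w‖ ≤ 2 * √‖w ^ 2 - (a : ℂ) ^ 2‖ := by
  have h1 : ‖w‖ ^ 2 ≤ ‖w ^ 2 - (a : ℂ) ^ 2‖ + a ^ 2 := by
    have := norm_add_le (w ^ 2 - (a : ℂ) ^ 2) ((a : ℂ) ^ 2)
    rwa [sub_add_cancel, norm_pow, norm_pow, norm_real, Real.norm_eq_abs, sq_abs] at this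
  have h2 : (‖w‖ / 2) ^ 2 ≤ ‖w ^ 2 - (a : ℂ) ^ 2‖ := by nlinarith [norm_nonneg w]
  have := Real.le_sqrt_of_sq_le h2
  linarith

/-- The Poisson kernel of the upper half-plane has integral `2πi` in this normalization. -/
theorem integral_poisson {k0 : ℂ} (hk0 : 0 < k0.im) :
    Integrable (fun s : ℝ => ((s : ℂ) - k0)⁻¹ - (s - conj k0)⁻¹) ∧
      ∫ s : ℝ, (((s : ℂ) - k0)⁻¹ - (s - conj k0)⁻¹) = 2 * Real.pi * I := by
  have h1 : ∀ s : ℝ, ((s : ℂ) - k0)⁻¹ - (s - conj k0)⁻¹ =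
      2 * I / k0.im * ((1 + ((s - k0.re) / k0.im) ^ 2)⁻¹ : ℝ) := by
    intro s
    have e1 : (s : ℂ) - k0 ≠ 0 := fun h => by
      have := congrArg im h; simp at this; exact hk0.ne' this
    have e2 : (s : ℂ) - conj k0 ≠ 0 := fun h => by
      have := congrArg im h; simp at this; exact hk0.ne' this
    have e3 : (k0.im : ℂ) ≠ 0 := ofReal_ne_zero.2 hk0.ne'
    have e4 : ((s : ℂ) - k0) * (s - conj k0) = (s - k0.re) ^ 2 + k0.im ^ 2 := by
      apply Complex.ext <;> simp [pow_two]; ring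
    have e5 : k0 - conj k0 = 2 * I * k0.im := by
      apply Complex.ext <;> simp; ring
    have e6 : ((s : ℂ) - k0.re) ^ 2 + k0.im ^ 2 ≠ 0 := e4 ▸ mul_ne_zero e1 e2
    have e7 : (k0.im : ℂ) ^ 2 + (s - k0.re) ^ 2 ≠ 0 := by rwa [add_comm]
    have e8 : ((s : ℂ) - k0)⁻¹ - (s - conj k0)⁻¹ = (2 * I * k0.im) /
        ((s - k0.re) ^ 2 + k0.im ^ 2) := by
      rw [← e4, ← e5]; field_simp; ring
    rw [e8]
    push_cast
    field_simp
    ring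
  have h2 : Integrable fun s : ℝ => ((1 + ((s - k0.re) / k0.im) ^ 2)⁻¹ : ℝ) :=
    (integrable_inv_one_add_sq.comp_div hk0.ne').comp_sub_right k0.re
  have h3 : ∫ s : ℝ, ((1 + ((s - k0.re) / k0.im) ^ 2)⁻¹ : ℝ) = k0.im * Real.pi := by
    rw [integral_sub_right_eq_self (fun s : ℝ => (1 + (s / k0.im) ^ 2)⁻¹),
      Measure.integral_comp_div (fun s : ℝ => (1 + s ^ 2)⁻¹), integral_univ_inv_one_add_sq,
      abs_of_pos hk0, smul_eq_mul]
  simp only [h1]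
  refine ⟨h2.ofReal.const_mul _, ?_⟩
  have h4 : ∫ s : ℝ, (((1 + ((s - k0.re) / k0.im) ^ 2)⁻¹ : ℝ) : ℂ) = (k0.im * Real.pi : ℝ) := by
    rw [← h3]; exact integral_ofReal
  rw [integral_const_mul, h4]
  have e3 : (k0.im : ℂ) ≠ 0 := ofReal_ne_zero.2 hk0.ne'
  push_cast
  field_simp

/-- Cauchy's formula in the upper half-plane, for functions with at most inverse square root
singularities at `±a` and decay at infinity. The integral against the reflected pole vanishes. -/
theorem cauchy_upper {F : ℂ → ℂ} {f : ℝ → ℂ} {a C : ℝ} (ha : 0 < a)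
    (hd : DifferentiableOn ℂ F {z | 0 < z.im})
    (hb : ∀ z : ℂ, 0 < z.im → ‖F z‖ * √‖z ^ 2 - (a : ℂ) ^ 2‖ ≤ C)
    (hlim : ∀ᵐ s : ℝ, Tendsto F (𝓝[{z : ℂ | 0 < z.im}] (s : ℂ)) (𝓝 (f s)))
    {k0 : ℂ} (hk0 : 0 < k0.im) :
    (Integrable (fun s : ℝ => f s * ((s : ℂ) - k0)⁻¹) ∧
      ∫ s : ℝ, f s * ((s : ℂ) - k0)⁻¹ = 2 * Real.pi * I * F k0) ∧
    (Integrable (fun s : ℝ => f s * ((s : ℂ) - conj k0)⁻¹) ∧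
      ∫ s : ℝ, f s * ((s : ℂ) - conj k0)⁻¹ = 0) := by
  have hC0 : 0 ≤ C := (by positivity : (0 : ℝ) ≤ _).trans (hb k0 hk0)
  have hopen : IsOpen {z : ℂ | 0 < z.im} := isOpen_lt continuous_const continuous_im
  have hne : ∀ s : ℝ, s ≠ a → s ≠ -a → 0 < |s ^ 2 - a ^ 2| := fun s h1 h2 => by
    rw [abs_pos]
    have : (s - a) * (s + a) ≠ 0 := mul_ne_zero (sub_ne_zero.2 h1) (fun h => h2 (by linarith))
    intro h; apply this; linarith
  have hnull : ∀ᵐ s : ℝ, s ≠ a ∧ s ≠ -a := by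
    have h1 : ∀ b : ℝ, ∀ᵐ s : ℝ, s ≠ b := fun b => by simp [ae_iff]
    filter_upwards [h1 a, h1 (-a)] with s h1 h2
    exact ⟨h1, h2⟩
  have hF : ∀ s y : ℝ, s ≠ a ∧ s ≠ -a → 0 < y → ‖F (s + y * I)‖ ≤ C * sqrtWeight a s := by
    intro s y hs hy
    have h1 := hb (s + y * I) (by simpa using hy)
    have h2 : |s ^ 2 - a ^ 2| ≤ ‖((s : ℂ) + y * I) ^ 2 - (a : ℂ) ^ 2‖ := by
      have e1 : ((s : ℂ) + y * I) ^ 2 - (a : ℂ) ^ 2 = (s - a + y * I) * (s + a + y * I) := by ring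
      have e2 : |s - a| ≤ ‖(s : ℂ) - a + y * I‖ := by
        have := abs_re_le_norm ((s : ℂ) - a + y * I); simpa using this
      have e3 : |s + a| ≤ ‖(s : ℂ) + a + y * I‖ := by
        have := abs_re_le_norm ((s : ℂ) + a + y * I); simpa using this
      rw [e1, norm_mul, show s ^ 2 - a ^ 2 = (s - a) * (s + a) by ring, abs_mul]
      gcongr
    have h3 : 0 < √|s ^ 2 - a ^ 2| := Real.sqrt_pos.2 (hne s hs.1 hs.2)
    rw [sqrtWeight, ← div_eq_mul_inv, le_div_iff₀ h3]
    refine le_trans ?_ h1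
    gcongr
  have hFlarge : ∀ z : ℂ, 0 < z.im → 2 * a ≤ ‖z‖ → ‖F z‖ ≤ 2 * C / ‖z‖ := by
    intro z hz hza
    have h1 := norm_le_two_mul_sqrt ha hza
    have h2 : 0 < ‖z‖ := by linarith
    rw [le_div_iff₀ h2]
    calc ‖F z‖ * ‖z‖ ≤ ‖F z‖ * (2 * √‖z ^ 2 - (a : ℂ) ^ 2‖) := by gcongr
      _ ≤ 2 * C := by linarith [hb z hz]
  have hlow : ∀ z : ℂ, 0 < z.im → k0.im ≤ ‖z - conj k0‖ := by
    intro z hz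
    have := abs_im_le_norm (z - conj k0)
    simp at this
    exact (by linarith [le_abs_self (z.im + k0.im)] : k0.im ≤ |z.im + k0.im|).trans this
  have hfar : ∀ z p : ℂ, 2 * ‖p‖ + 1 ≤ ‖z‖ → ‖(z - p)⁻¹‖ ≤ 2 / ‖z‖ := by
    intro z p hz
    have h1 : ‖z‖ ≤ ‖p‖ + ‖z - p‖ := by
      have := norm_add_le p (z - p)
      rwa [add_sub_cancel] at this
    have hp := norm_nonneg p
    have h2 : 0 < ‖z - p‖ := by linarith
    rw [norm_inv, inv_eq_one_div, div_le_div_iff₀ h2 (by linarith)]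
    linarith
  have hcn : ‖conj k0‖ = ‖k0‖ := norm_conj k0
  set R := 2 * a + 2 * ‖k0‖ + 1 with hR
  have hkn := norm_nonneg k0
  set K := (1 + ‖k0‖) / (k0.im / 2) + 1 with hK
  have hK0 : 0 ≤ K := by positivity
  have hcontcut : ∀ p : ℂ, p.im ≠ 0 → ∀ s : ℝ, Tendsto (fun z : ℂ => (z - p)⁻¹)
      (𝓝[{z : ℂ | 0 < z.im}] (s : ℂ)) (𝓝 ((s - p)⁻¹)) := by
    intro p hp s
    have h1 : (s : ℂ) - p ≠ 0 := fun h => hp (by have := congrArg im h; simpa using this)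
    exact (((continuous_id.sub continuous_const).tendsto (s : ℂ)).inv₀ h1).mono_left
      nhdsWithin_le_nhds
  -- the reflected pole
  have hB := integral_boundary_eq_zero (H := fun z => F z * (z - conj k0)⁻¹)
    (h := fun s => f s * ((s : ℂ) - conj k0)⁻¹)
    (g := fun s => C * K * (sqrtWeight a s * (1 + |s|)⁻¹)) (C := 4 * C) (R := R) (δ := 1)
    (hd.mul fun z hz => ((differentiableAt_id.sub_const _).inv (by
      have := (hlow z hz).trans_lt' hk0
      exact norm_pos_iff.1 this)).differentiableWithinAt)
    (fun z hz hzR => by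
      have h1 := hFlarge z hz (by linarith)
      have h2 := hfar z (conj k0) (by rw [hcn]; linarith)
      have h0 : 0 < ‖z‖ := by linarith
      rw [norm_mul]
      calc _ ≤ 2 * C / ‖z‖ * (2 / ‖z‖) := by gcongr
        _ = _ := by field_simp; ring) one_pos
    ((integrable_sqrtWeight ha).const_mul _)
    (by
      filter_upwards [hnull] with s hs y hy _
      have h1 := hF s y hs hy
      have h2 := norm_inv_sub_le (w := s + y * I) (p := conj k0) (half_pos hk0)
        (by linarith [hlow (s + y * I) (by simpa using hy)])
      rw [hcn, ← hK] at h2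
      simp only [add_re, ofReal_re, mul_re, I_re, mul_zero, ofReal_im, I_im, mul_one, sub_self,
        add_zero] at h2
      rw [norm_mul]
      calc _ ≤ C * sqrtWeight a s * (K * (1 + |s|)⁻¹) := by
            have : 0 ≤ sqrtWeight a s := by unfold sqrtWeight; positivity
            gcongr
        _ = _ := by ring)
    (by
      filter_upwards [hlim] with s hs
      exact hs.mul (hcontcut _ (by simpa using hk0.ne') s))
  -- the pole itself, removed by subtracting the value there
  have hker : ∀ z : ℂ, z - k0 ≠ 0 → z - conj k0 ≠ 0 →
      (z - k0)⁻¹ - (z - conj k0)⁻¹ = 2 * k0.im * I * ((z - k0)⁻¹ * (z - conj k0)⁻¹) := by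
    intro z h1 h2
    have e5 : k0 - conj k0 = 2 * k0.im * I := by
      apply Complex.ext <;> simp; ring
    rw [← e5]; field_simp; ring
  have hA := integral_boundary_eq_zero
    (H := fun z => dslope F k0 z * (2 * k0.im * I) * (z - conj k0)⁻¹)
    (h := fun s => (f s - F k0) * (((s : ℂ) - k0)⁻¹ - (s - conj k0)⁻¹))
    (g := fun s => 2 * k0.im * K ^ 2 * (C * (sqrtWeight a s * (1 + |s|)⁻¹) +
      ‖F k0‖ * (1 + s ^ 2)⁻¹)) (C := (2 * C + ‖F k0‖) * (2 * k0.im) * 4) (R := R) (δ := k0.im / 2)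
    ((((differentiableOn_dslope (hopen.mem_nhds hk0)).2 hd).mul_const _).mul fun z hz =>
      ((differentiableAt_id.sub_const _).inv (by
      have := (hlow z hz).trans_lt' hk0
      exact norm_pos_iff.1 this)).differentiableWithinAt)
    (fun z hz hzR => by
      have h1 := hFlarge z hz (by linarith)
      have h2 := hfar z (conj k0) (by rw [hcn]; linarith)
      have h3 := hfar z k0 (by linarith)
      have h0 : 1 ≤ ‖z‖ := by linarith
      have hzk : z ≠ k0 := fun h => by rw [h] at hzR; linarith
      have h4 : ‖F z - F k0‖ ≤ 2 * C + ‖F k0‖ := by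
        refine (norm_sub_le _ _).trans (by
          gcongr
          exact h1.trans (div_le_self (by positivity) h0))
      rw [dslope_of_ne _ hzk, slope_def_module, smul_eq_mul]
      simp only [norm_mul, norm_ofNat, norm_real, norm_I, Real.norm_of_nonneg hk0.le, mul_one]
      calc _ ≤ 2 / ‖z‖ * (2 * C + ‖F k0‖) * (2 * k0.im) * (2 / ‖z‖) := by gcongr
        _ = _ := by field_simp; ring) (half_pos hk0)
    ((((integrable_sqrtWeight ha).const_mul _).add
      (integrable_inv_one_add_sq.const_mul _)).const_mul _)
    (by
      filter_upwards [hnull] with s hs y hy hyδ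
      have h1 := hF s y hs hy
      have h2 := norm_inv_sub_le (w := s + y * I) (p := conj k0) (half_pos hk0)
        (by linarith [hlow (s + y * I) (by simpa using hy)])
      have h5 : k0.im / 2 ≤ ‖(s : ℂ) + y * I - k0‖ := by
        have := abs_im_le_norm ((s : ℂ) + y * I - k0)
        simp at this
        refine le_trans ?_ this
        rw [abs_sub_comm]
        exact (by linarith : k0.im / 2 ≤ k0.im - y).trans (le_abs_self _)
      have h3 := norm_inv_sub_le (w := s + y * I) (p := k0) (half_pos hk0) h5
      rw [hcn, ← hK] at h2
      rw [← hK] at h3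
      simp only [add_re, ofReal_re, mul_re, I_re, mul_zero, ofReal_im, I_im, mul_one, sub_self,
        add_zero] at h2 h3
      have hzk : (s : ℂ) + y * I ≠ k0 := fun h => by
        rw [h, sub_self, norm_zero] at h5; linarith
      have h4 : ‖F (s + y * I) - F k0‖ ≤ C * sqrtWeight a s + ‖F k0‖ :=
        (norm_sub_le _ _).trans (by gcongr)
      rw [dslope_of_ne _ hzk, slope_def_module, smul_eq_mul]
      simp only [norm_mul, norm_ofNat, norm_real, norm_I, Real.norm_of_nonneg hk0.le, mul_one]
      have hw : 0 ≤ sqrtWeight a s := by unfold sqrtWeight; positivity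
      have h6 : (1 + |s|)⁻¹ * (1 + |s|)⁻¹ ≤ (1 + s ^ 2)⁻¹ := by
        rw [← mul_inv]
        exact inv_anti₀ (by positivity) (by nlinarith [abs_nonneg s, sq_abs s])
      have h7 : (1 + |s|)⁻¹ * (1 + |s|)⁻¹ ≤ (1 + |s|)⁻¹ :=
        mul_le_of_le_one_right (by positivity) (inv_le_one_of_one_le₀ (by linarith [abs_nonneg s]))
      calc _ ≤ K * (1 + |s|)⁻¹ * (C * sqrtWeight a s + ‖F k0‖) * (2 * k0.im) *
            (K * (1 + |s|)⁻¹) := by gcongr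
        _ = 2 * k0.im * K ^ 2 * (C * (sqrtWeight a s * ((1 + |s|)⁻¹ * (1 + |s|)⁻¹)) +
            ‖F k0‖ * ((1 + |s|)⁻¹ * (1 + |s|)⁻¹)) := by ring
        _ ≤ _ := by gcongr)
    (by
      filter_upwards [hlim] with s hs
      have h1 := ((hs.sub_const (F k0)).mul ((hcontcut k0 hk0.ne' s).sub
        (hcontcut (conj k0) (by simpa using hk0.ne') s)))
      refine h1.congr' ?_
      have h2 : ∀ᶠ z in 𝓝[{z : ℂ | 0 < z.im}] (s : ℂ), z ≠ k0 := by
        refine nhdsWithin_le_nhds (isOpen_ne.mem_nhds fun h => ?_)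
        rw [← h] at hk0; simp at hk0
      filter_upwards [h2, self_mem_nhdsWithin] with z hz hz0
      have h3 : z - conj k0 ≠ 0 := norm_pos_iff.1 ((hlow z hz0).trans_lt' hk0)
      rw [hker z (sub_ne_zero.2 hz) h3, dslope_of_ne _ hz, slope_def_module, smul_eq_mul]
      ring)
  obtain ⟨hP1, hP2⟩ := integral_poisson hk0
  have hsplit : (fun s : ℝ => f s * ((s : ℂ) - k0)⁻¹) = fun s : ℝ =>
      ((f s - F k0) * (((s : ℂ) - k0)⁻¹ - (s - conj k0)⁻¹) + f s * ((s : ℂ) - conj k0)⁻¹) +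
        F k0 * (((s : ℂ) - k0)⁻¹ - (s - conj k0)⁻¹) := by
    funext s; ring
  refine ⟨⟨?_, ?_⟩, hB⟩
  · rw [hsplit]
    exact (hA.1.add hB.1).add (hP1.const_mul _)
  · have e1 := (integral_add hA.1 hB.1).trans (by rw [hA.2, hB.2, add_zero])
    rw [hsplit]
    refine (integral_add (hA.1.add hB.1) (hP1.const_mul (F k0))).trans ?_
    rw [integral_const_mul, hP2]
    refine (congrArg (· + F k0 * (2 * Real.pi * I)) e1).trans ?_
    ring

end HalfPlane

/-! ### The poles -/

section Poles

open Asymptotics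

variable {u u1 u2 v1 v2 : ℝ → ℝ} {qm qp : ℝ} {J : ℕ} {κ : Fin J → ℝ}

/-- There are no spectral singularities, and the zeros of `s₁₁` in the gap are the simple zeros
`κ j`. -/
structure IsSpectrum (u : ℝ → ℝ) (qm qp : ℝ) {J : ℕ} (κ : Fin J → ℝ) : Prop where
  sing : ∀ s ∈ cut qp, jostWr u qm qp (s : ℂ) ≠ 0
  inj : Function.Injective κ
  zero : ∀ s : ℝ, (|s| < qp ∧ s11 u qm qp s = 0) ↔ ∃ j, κ j = s
  simple : ∀ j, deriv (s11 u qm qp) (κ j) ≠ 0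

theorem IsSpectrum.abs_lt (hs : IsSpectrum u qm qp κ) (j : Fin J) : |κ j| < qp :=
  ((hs.zero _).2 ⟨j, rfl⟩).1

theorem IsSpectrum.notMem (hs : IsSpectrum u qm qp κ) (j : Fin J) : (κ j : ℂ) ∉ cutC qp :=
  fun h => (hs.abs_lt j).not_ge (mem_cutC_ofReal.1 h)

theorem IsSpectrum.s11_eq_zero (hs : IsSpectrum u qm qp κ) (j : Fin J) :
    s11 u qm qp (κ j) = 0 := ((hs.zero _).2 ⟨j, rfl⟩).2

theorem IsSpectrum.jostWr_eq_zero (hs : IsSpectrum u qm qp κ) (hqp : 0 < qp) (j : Fin J) :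
    jostWr u qm qp (κ j) = 0 :=
  (div_eq_zero_iff.1 (hs.s11_eq_zero j)).resolve_right (gam_ne_zero hqp (lam_ne_zero (hs.notMem j)))

theorem IsSpectrum.jostWr_ne_zero (hs : IsSpectrum u qm qp κ) (h : IsStep u qm qp) {k : ℂ}
    (hk : ∀ j, k ≠ κ j) : jostWr u qm qp k ≠ 0 := by
  by_cases him : k.im = 0
  · obtain ⟨s, rfl⟩ : ∃ s : ℝ, (s : ℂ) = k := ⟨k.re, Complex.ext (by simp) (by simp [him])⟩
    by_cases hc : s ∈ cut qp
    · exact hs.sing s hc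
    · intro h0
      obtain ⟨j, hj⟩ := (hs.zero s).1 ⟨not_le.1 hc, by
        rw [s11, show Wr _ _ = jostWr u qm qp s from rfl, h0, zero_div]⟩
      exact hk j (by rw [hj])
  · exact h.jostWr_ne_zero him

theorem IsStep.differentiableAt_s11 (h : IsStep u qm qp) {k : ℂ} (hk : k ∉ cutC qp) :
    DifferentiableAt ℂ (s11 u qm qp) k := by
  have ho := (isClosed_cutC qp).isOpen_compl.mem_nhds hk
  have hg : DifferentiableAt ℂ (gam qp) k := by
    rw [show gam qp = _ from funext (gam_eq h.pos)]
    exact ((differentiableAt_const _).mul (differentiableAt_lam hk)).div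
      (differentiableAt_id.sub (differentiableAt_lam hk)) (sub_lam_ne_zero h.pos k)
  exact (h.differentiableOn_jostWr.differentiableAt ho).div hg
    (gam_ne_zero h.pos (lam_ne_zero hk))

/-- At a simple zero of `s₁₁`, `M` has a simple pole whose residue is determined by the factor of
proportionality of the two Jost solutions. -/
theorem IsSpectrum.tendsto_residue_M (hs : IsSpectrum u qm qp κ) (h : IsStep u qm qp) (j : Fin J)
    {b C : ℂ} (hb : ∀ x, phiMinus u qm 0 (κ j) x = b • phiPlus u qp 1 (κ j) x)
    (hC : C = b / deriv (s11 u qm qp) (κ j)) (x : ℝ) :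
    Tendsto (fun k : ℂ => (k - κ j) • M u qm qp x k) (𝓝[≠] (κ j : ℂ))
      (𝓝 (resM u qm qp C x (κ j))) := by
  have hk := hs.notMem j
  have ho := (isClosed_cutC qp).isOpen_compl.mem_nhds hk
  have ho' := (isClosed_cutC qm).isOpen_compl.mem_nhds (h.notMem hk)
  have e1 := differentiableAt_pi.1 ((differentiableOn_muMinus h.left h.pos' x).differentiableAt ho')
  have e2 := differentiableAt_pi.1 ((differentiableOn_muPlus h.right h.pos x).differentiableAt ho)
  have hd := hasDerivAt_iff_tendsto_slope.1 (h.differentiableAt_s11 hk).hasDerivAt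
  have hinv := hd.inv₀ (hs.simple j)
  have hmu : ∀ i, muMinus u qm 0 (κ j) x i =
      b * exp (I * (lam qp (κ j) + lam qm (κ j)) * x) * muPlus u qp 1 (κ j) x i := by
    intro i
    have e3 : exp (I * lam qm (κ j) * x) = exp (I * (lam qp (κ j) + lam qm (κ j)) * x) *
        exp (-(I * lam qp (κ j) * x)) := by rw [← exp_add]; congr 1; ring
    simp [muMinus, muPlus, normalize, hb, sigma3, e3]; ring
  have c0 : ∀ i, Tendsto (fun k : ℂ => (k - κ j) * (muMinus u qm 0 k x i / s11 u qm qp k))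
      (𝓝[≠] (κ j : ℂ)) (𝓝 (C * exp (I * (lam qp (κ j) + lam qm (κ j)) * x) *
        muPlus u qp 1 (κ j) x i)) := by
    intro i
    have h1 := hinv.mul ((e1 i).continuousAt.tendsto.mono_left
      (nhdsWithin_le_nhds (s := {(κ j : ℂ)}ᶜ)))
    rw [hmu] at h1
    have h2 : (deriv (s11 u qm qp) (κ j))⁻¹ * (b * exp (I * (lam qp (κ j) + lam qm (κ j)) * x) *
        muPlus u qp 1 (κ j) x i) = C * exp (I * (lam qp (κ j) + lam qm (κ j)) * x) *
        muPlus u qp 1 (κ j) x i := by rw [hC]; ring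
    rw [h2] at h1
    refine h1.congr fun k => ?_
    rw [slope_def_field, hs.s11_eq_zero, sub_zero, inv_div]
    ring
  have c1 : ∀ i, Tendsto (fun k : ℂ => (k - κ j) * muPlus u qp 1 k x i)
      (𝓝[≠] (κ j : ℂ)) (𝓝 0) := by
    intro i
    have h0 : Tendsto (fun k : ℂ => k - κ j) (𝓝 (κ j : ℂ)) (𝓝 0) := by
      simpa using ((continuous_id (X := ℂ)).tendsto (κ j : ℂ)).sub_const (κ j : ℂ)
    have h1 := h0.mul (e2 i).continuousAt.tendsto
    simp only [zero_mul] at h1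
    exact h1.mono_left nhdsWithin_le_nhds
  refine tendsto_pi_nhds.2 fun i => tendsto_pi_nhds.2 fun a => ?_
  fin_cases i <;> fin_cases a
  · simpa [M, resM] using c0 0
  · simpa [M, resM] using c1 0
  · simpa [M, resM] using c0 1
  · simpa [M, resM] using c1 1

theorem continuousAt_lam {a : ℝ} {k : ℂ} (hk : k ∉ cutC a) : ContinuousAt (lam a) k :=
  (differentiableAt_lam hk).continuousAt

/-- The residue of `N` at `κ j`. -/
def resN (u : ℝ → ℝ) (qm qp : ℝ) (C : ℂ) (x κ : ℝ) : Matrix (Fin 2) (Fin 2) ℂ :=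
  resM u qm qp C x κ * (E qp κ)⁻¹

theorem IsSpectrum.tendsto_residue_N (hs : IsSpectrum u qm qp κ) (h : IsStep u qm qp) (j : Fin J)
    {b C : ℂ} (hb : ∀ x, phiMinus u qm 0 (κ j) x = b • phiPlus u qp 1 (κ j) x)
    (hC : C = b / deriv (s11 u qm qp) (κ j)) (x : ℝ) :
    Tendsto (fun k : ℂ => (k - κ j) • N u qm qp x k) (𝓝[≠] (κ j : ℂ))
      (𝓝 (resN u qm qp C x (κ j))) := by
  have hk := hs.notMem j
  have hE : ContinuousAt (fun k => (E qp k)⁻¹) (κ j : ℂ) := by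
    rw [← continuousWithinAt_univ]
    exact continuousWithinAt_E_inv h.pos (continuousAt_lam hk).continuousWithinAt (lam_ne_zero hk)
  refine ((hs.tendsto_residue_M h j hb hC x).mul
    (hE.tendsto.mono_left nhdsWithin_le_nhds)).congr fun k => ?_
  rw [N, Matrix.smul_mul]

theorem tendsto_conj_punctured (s : ℝ) : Tendsto conj (𝓝[≠] (s : ℂ)) (𝓝[≠] (s : ℂ)) := by
  refine tendsto_nhdsWithin_iff.2 ⟨?_, ?_⟩
  · have := (continuous_conj.tendsto (s : ℂ)).mono_left (nhdsWithin_le_nhds (s := {(s : ℂ)}ᶜ))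
    rwa [conj_ofReal] at this
  · filter_upwards [self_mem_nhdsWithin] with z hz h
    apply hz
    have : conj z = (s : ℂ) := h
    rw [← conj_conj z, this, conj_ofReal]; rfl

theorem IsSpectrum.conjFlip_resN (hs : IsSpectrum u qm qp κ) (h : IsStep u qm qp) (j : Fin J)
    {b C : ℂ} (hb : ∀ x, phiMinus u qm 0 (κ j) x = b • phiPlus u qp 1 (κ j) x)
    (hC : C = b / deriv (s11 u qm qp) (κ j)) (x : ℝ) :
    conjFlip (resN u qm qp C x (κ j)) = resN u qm qp C x (κ j) := by
  have h1 := hs.tendsto_residue_N h j hb hC x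
  have h2 := ((continuous_conjFlip.tendsto _).comp h1).comp (tendsto_conj_punctured (κ j))
  refine tendsto_nhds_unique (h2.congr' ?_) h1
  have h3 : ∀ᶠ k in 𝓝[≠] (κ j : ℂ), k ∉ cutC qp :=
    nhdsWithin_le_nhds ((isClosed_cutC qp).isOpen_compl.mem_nhds (hs.notMem j))
  filter_upwards [h3] with k hk
  have hk' : conj k ∉ cutC qp := mt conj_mem_cutC.1 hk
  have h4 := h.N_conj x hk'
  rw [conj_conj] at h4
  rw [h4]
  ext a c
  simp [conjFlip_apply]

/-- `N` without its value at infinity and its poles. -/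
def regN (u : ℝ → ℝ) (qm qp : ℝ) (κ : Fin J → ℝ) (C : Fin J → ℂ) (x : ℝ) (k : ℂ) :
    Matrix (Fin 2) (Fin 2) ℂ :=
  N u qm qp x k - 1 - ∑ j, (k - κ j)⁻¹ • resN u qm qp (C j) x (κ j)

theorem regN_apply (C : Fin J → ℂ) (x : ℝ) (k : ℂ) (a c : Fin 2) :
    regN u qm qp κ C x k a c = (N u qm qp x k - 1) a c -
      ∑ j, (k - κ j)⁻¹ * resN u qm qp (C j) x (κ j) a c := by
  simp [regN, Matrix.sum_apply]

/-- `b j` is the factor of proportionality of the Jost solutions at `κ j`, and `C j` the norming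
constant `b j / s₁₁'(κ j)`. -/
structure IsNorming (u : ℝ → ℝ) (qm qp : ℝ) {J : ℕ} (κ : Fin J → ℝ) (b C : Fin J → ℂ) : Prop where
  smul : ∀ j x, phiMinus u qm 0 (κ j) x = b j • phiPlus u qp 1 (κ j) x
  eq : ∀ j, C j = b j / deriv (s11 u qm qp) (κ j)

variable {b C : Fin J → ℂ}

theorem continuousAt_poleSum (C : Fin J → ℂ) (x : ℝ) {k : ℂ} (hne : ∀ j, k ≠ κ j) (a c : Fin 2) :
    ContinuousAt (fun k : ℂ => ∑ j, (k - κ j)⁻¹ * resN u qm qp (C j) x (κ j) a c) k :=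
  tendsto_finsetSum _ fun j _ =>
    ((continuousAt_id.sub continuousAt_const).inv₀ (sub_ne_zero.2 (hne j))).mul continuousAt_const

theorem lam_mul_N_apply (hqp : 0 < qp) (x : ℝ) {k : ℂ} (hl : lam qp k ≠ 0) (a c : Fin 2) :
    lam qp k * N u qm qp x k a c =
      ![lam qp k * (jostWr u qm qp k)⁻¹ * muMinus u qm 0 k x a - I * qp / 2 * muPlus u qp 1 k x a,
        -(I * qp / (k - lam qp k) * lam qp k * (jostWr u qm qp k)⁻¹ * muMinus u qm 0 k x a)
          - (k - lam qp k) / 2 * muPlus u qp 1 k x a] c := by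
  rw [N_eq hqp x hl]
  fin_cases c <;> simp <;> field_simp

/-- `λ₊ N` is bounded near every point of the closed upper half-plane that is not a pole. -/
theorem IsSpectrum.eventually_norm_lam_mul_regN_le (hs : IsSpectrum u qm qp κ) (C : Fin J → ℂ)
    (x : ℝ) (h : IsStep u qm qp) {k : ℂ} (hk : 0 ≤ k.im) (hne : ∀ j, k ≠ κ j) (a c : Fin 2) :
    ∃ B, ∀ᶠ z in 𝓝 k, 0 < z.im → ‖lam qp z * regN u qm qp κ C x z a c‖ ≤ B := by
  have e1 := continuousWithinAt_pi.1 (continuousOn_muMinus h.left h.pos' x k hk) a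
  have e2 := continuousWithinAt_pi.1 (continuousOn_muPlus h.right h.pos x k hk) a
  have e3 := (h.continuousOn_jostWr k hk).inv₀ (hs.jostWr_ne_zero h hne)
  have hl := continuousOn_lam h.pos k hk
  have hid : ContinuousWithinAt (fun k : ℂ => k) {k | 0 ≤ k.im} k := continuousWithinAt_id
  have hG : ∃ G : ℂ → ℂ, ContinuousWithinAt G {k | 0 ≤ k.im} k ∧
      ∀ z, lam qp z ≠ 0 → lam qp z * N u qm qp x z a c = G z := by
    refine ⟨_, ?_, fun z hz => lam_mul_N_apply h.pos x hz a c⟩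
    fin_cases c
    · exact ((hl.mul e3).mul e1).sub (continuousWithinAt_const.mul e2)
    · exact ((((continuousWithinAt_E_entry h.pos hl).mul hl).mul e3).mul e1).neg.sub
        (((hid.sub hl).div_const 2).mul e2)
  obtain ⟨G, hGc, hG⟩ := hG
  have hsum := (continuousAt_poleSum (κ := κ) (u := u) (qm := qm) (qp := qp) C x hne a
    c).continuousWithinAt (s := {k | 0 ≤ k.im})
  have htot := (hGc.sub (hl.mul (continuousWithinAt_const
    (b := (1 : Matrix (Fin 2) (Fin 2) ℂ) a c)))).sub (hl.mul hsum)
  obtain ⟨B, hev⟩ : ∃ B, ∀ᶠ z in 𝓝[{k | 0 ≤ k.im}] k, ‖G z - lam qp z *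
      (1 : Matrix (Fin 2) (Fin 2) ℂ) a c - lam qp z *
      ∑ j, (z - κ j)⁻¹ * resN u qm qp (C j) x (κ j) a c‖ ≤ B :=
    ⟨_, htot.norm.eventually_le_const (lt_add_one _)⟩
  refine ⟨B, (eventually_nhdsWithin_iff.1 hev).mono fun z hz him => ?_⟩
  have hlz : lam qp z ≠ 0 := lam_ne_zero fun h0 => him.ne' h0.1
  refine le_of_eq_of_le ?_ (hz (show 0 ≤ z.im from him.le))
  congr 1
  rw [regN_apply, ← hG z hlz, Matrix.sub_apply]
  ring

section

variable (hs : IsSpectrum u qm qp κ) (hn : IsNorming u qm qp κ b C) (x : ℝ)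
include hs hn

theorem regN_conj (h : IsStep u qm qp) {k : ℂ} (hk : k ∉ cutC qp) :
    regN u qm qp κ C x (conj k) = conjFlip (regN u qm qp κ C x k) := by
  ext a c
  rw [conjFlip_apply, regN_apply, regN_apply, h.N_conj x hk, map_sub, map_sum]
  have h1 : ∀ j, resN u qm qp (C j) x (κ j) a c =
      conj (resN u qm qp (C j) x (κ j) (1 - a) (1 - c)) := fun j => by
    rw [← conjFlip_apply, hs.conjFlip_resN h j (hn.smul j) (hn.eq j) x]
  congr 1
  · rw [Matrix.sub_apply, Matrix.sub_apply, map_sub, conjFlip_apply]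
    fin_cases a <;> fin_cases c <;> simp
  · refine Finset.sum_congr rfl fun j _ => ?_
    rw [h1 j]; simp

omit hn in
theorem differentiableAt_regN (h : IsStep u qm qp) {k : ℂ} (hk : k ∉ cutC qp)
    (hne : ∀ j, k ≠ κ j) (a c : Fin 2) :
    DifferentiableAt ℂ (fun k => regN u qm qp κ C x k a c) k := by
  simp only [regN_apply]
  have h1 : ∀ j, DifferentiableAt ℂ
      (fun k : ℂ => (k - κ j)⁻¹ * resN u qm qp (C j) x (κ j) a c) k := fun j =>
    ((differentiableAt_id.sub_const (κ j : ℂ)).fun_inv (sub_ne_zero.2 (hne j))).mul_const _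
  exact ((h.differentiableAt_N x hk (hs.jostWr_ne_zero h hne) a c).sub_const _).sub
    (DifferentiableAt.fun_sum fun j _ => h1 j)

omit hn in
theorem continuousWithinAt_regN (h : IsStep u qm qp) {k : ℂ} (hk : 0 ≤ k.im) (hl : lam qp k ≠ 0)
    (hne : ∀ j, k ≠ κ j) (a c : Fin 2) :
    ContinuousWithinAt (fun k => regN u qm qp κ C x k a c) {k | 0 ≤ k.im} k := by
  simp only [regN_apply]
  have h1 := continuousWithinAt_pi.1 (continuousWithinAt_pi.1
    (h.continuousWithinAt_N x hk (hs.jostWr_ne_zero h hne) hl) a) c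
  exact (h1.sub continuousWithinAt_const).sub (continuousAt_poleSum C x hne a c).continuousWithinAt

/-- The singularity of `regN` at a pole of `N` is removable. -/
theorem tendsto_regN_pole (h : IsStep u qm qp) (j : Fin J) (a c : Fin 2) :
    ∃ l, Tendsto (fun z => regN u qm qp κ C x z a c) (𝓝[≠] (κ j : ℂ)) (𝓝 l) := by
  have hsub : Tendsto (fun z : ℂ => z - κ j) (𝓝[≠] (κ j : ℂ)) (𝓝 0) := by
    have := ((continuous_id (X := ℂ)).tendsto (κ j : ℂ)).sub_const (κ j : ℂ)
    simp only [id, sub_self] at this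
    exact this.mono_left nhdsWithin_le_nhds
  have hne : ∀ᶠ z : ℂ in 𝓝[≠] (κ j : ℂ), ∀ i, z ≠ κ i := by
    refine eventually_all.2 fun i => ?_
    by_cases hij : i = j
    · subst hij; exact self_mem_nhdsWithin
    · refine nhdsWithin_le_nhds (isOpen_ne.mem_nhds fun h0 => hij (hs.inj ?_))
      exact (ofReal_inj.1 h0).symm
  have hnot : ∀ᶠ z : ℂ in 𝓝[≠] (κ j : ℂ), z ∉ cutC qp :=
    nhdsWithin_le_nhds ((isClosed_cutC qp).isOpen_compl.mem_nhds (hs.notMem j))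
  refine ⟨_, tendsto_limUnder_of_differentiable_on_punctured_nhds_of_isLittleO ?_ ?_⟩
  · filter_upwards [hne, hnot] with z h1 h2
    exact differentiableAt_regN hs x h h2 h1 a c
  · have hres : Tendsto (fun z : ℂ => (z - κ j) * regN u qm qp κ C x z a c) (𝓝[≠] (κ j : ℂ))
        (𝓝 0) := by
      have h1 := tendsto_pi_nhds.1 (tendsto_pi_nhds.1
        (hs.tendsto_residue_N h j (hn.smul j) (hn.eq j) x) a) c
      have h2 : Tendsto (fun z : ℂ => ∑ i, (z - κ j) * (z - κ i)⁻¹ *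
          resN u qm qp (C i) x (κ i) a c) (𝓝[≠] (κ j : ℂ))
          (𝓝 (∑ i, if i = j then resN u qm qp (C i) x (κ i) a c else 0)) := by
        refine tendsto_finsetSum _ fun i _ => ?_
        by_cases hij : i = j
        · subst hij
          rw [if_pos rfl]
          refine tendsto_const_nhds.congr' ?_
          filter_upwards [self_mem_nhdsWithin] with z hz
          rw [mul_inv_cancel₀ (sub_ne_zero.2 hz), one_mul]
        · rw [if_neg hij]
          have h3 : (κ j : ℂ) - κ i ≠ 0 := sub_ne_zero.2 fun h0 => hij
            (hs.inj (ofReal_inj.1 h0).symm)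
          have h4 : Tendsto (fun z : ℂ => (z - κ i)⁻¹) (𝓝[≠] (κ j : ℂ))
              (𝓝 ((κ j - κ i : ℂ)⁻¹)) :=
            ((((continuous_id (X := ℂ)).tendsto (κ j : ℂ)).sub_const (κ i : ℂ)).inv₀ h3).mono_left
              nhdsWithin_le_nhds
          simpa using (hsub.mul h4).mul_const (resN u qm qp (C i) x (κ i) a c)
      have h5 := (h1.sub (hsub.mul_const ((1 : Matrix (Fin 2) (Fin 2) ℂ) a c))).sub h2
      simp only [Finset.sum_ite_eq', Finset.mem_univ, if_true, zero_mul, sub_zero, sub_self] at h5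
      refine h5.congr fun z => ?_
      rw [regN_apply, Matrix.sub_apply, mul_sub, Finset.mul_sum]
      simp only [mul_assoc, Matrix.smul_apply, smul_eq_mul]
      ring
    rw [isLittleO_iff_tendsto']
    · have h6 := hres.sub (hsub.mul_const (regN u qm qp κ C x (κ j) a c))
      simp only [zero_mul, sub_zero] at h6
      refine h6.congr fun z => ?_
      rw [div_inv_eq_mul]; ring
    · filter_upwards [self_mem_nhdsWithin] with z hz h0
      exact absurd (inv_eq_zero.1 h0) (sub_ne_zero.2 hz)

omit hs hn in
theorem isBigO_regN {v1 v2 : ℝ → ℝ} (h : IsSmoothStep u u1 u2 v1 v2 qm qp) (a c : Fin 2) :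
    (fun k => regN u qm qp κ C x k a c) =O[atInfty] fun k => k⁻¹ ^ 1 := by
  simp only [regN_apply]
  refine (h.N_sub_one x a c).sub (IsBigO.fun_sum fun j _ => ?_)
  have h1 : (fun k : ℂ => (k - κ j)⁻¹) =O[atInfty] fun k => k⁻¹ ^ 1 := by
    refine isBigO_atInfty (C := 2) (R := 2 * |κ j| + 1) fun k _ hk => ?_
    have h2 : ‖k‖ ≤ |κ j| + ‖k - κ j‖ := by
      have := norm_add_le (κ j : ℂ) (k - κ j)
      rwa [add_sub_cancel, norm_real, Real.norm_eq_abs] at this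
    have h0 := abs_nonneg (κ j)
    have h3 : 0 < ‖k - κ j‖ := by linarith
    have h4 : 0 < ‖k‖ := by linarith
    rw [norm_inv, pow_one, ← div_eq_mul_inv, inv_eq_one_div, div_le_div_iff₀ h3 h4]
    linarith
  simpa [mul_comm] using h1.const_mul_left (resN u qm qp (C j) x (κ j) a c)

/-- After removal of the poles, `N - 1` has at most inverse square root singularities at `±q₊`
and decays at infinity. -/
theorem exists_bound_regN {v1 v2 : ℝ → ℝ} (h : IsSmoothStep u u1 u2 v1 v2 qm qp) (a c : Fin 2) :
    ∃ B, ∀ k : ℂ, 0 < k.im → ‖regN u qm qp κ C x k a c‖ * √‖k ^ 2 - (qp : ℂ) ^ 2‖ ≤ B := by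
  have hnorm : ∀ k, √‖k ^ 2 - (qp : ℂ) ^ 2‖ = ‖lam qp k‖ := fun k => by
    rw [← lam_sq h.pos, norm_pow, Real.sqrt_sq (norm_nonneg _)]
  obtain ⟨C1, R, hC1⟩ := isBigO_atInfty_iff.1 (isBigO_regN x h a c)
  -- near infinity the bound is the decay of `regN`; on a large ball it is local boundedness
  have hcpt : ∃ B, ∀ k ∈ Metric.closedBall (0 : ℂ) (max R 1), 0 < k.im →
      ‖lam qp k * regN u qm qp κ C x k a c‖ ≤ B := by
    refine (isCompact_closedBall (0 : ℂ) (max R 1)).induction_on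
      (p := fun S => ∃ B, ∀ k ∈ S, 0 < k.im → ‖lam qp k * regN u qm qp κ C x k a c‖ ≤ B)
      ⟨0, by simp⟩ (fun S T hST ⟨B, hB⟩ => ⟨B, fun k hk => hB k (hST hk)⟩)
      (fun S T ⟨B, hB⟩ ⟨B', hB'⟩ => ⟨max B B', ?_⟩) fun k _ => ?_
    · rintro k (hk | hk) him
      · exact (hB k hk him).trans (le_max_left _ _)
      · exact (hB' k hk him).trans (le_max_right _ _)
    · suffices hloc : ∃ B, ∀ᶠ z in 𝓝 k, 0 < z.im →
          ‖lam qp z * regN u qm qp κ C x z a c‖ ≤ B by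
        obtain ⟨B, hB⟩ := hloc
        exact ⟨_, nhdsWithin_le_nhds hB, B, fun z hz => hz⟩
      rcases lt_or_ge k.im 0 with hk | hk
      · refine ⟨0, ?_⟩
        filter_upwards [(isOpen_lt continuous_im continuous_const).mem_nhds hk] with z hz him
        exact absurd him (not_lt.2 (le_of_lt hz))
      · by_cases hne : ∀ j, k ≠ κ j
        · exact hs.eventually_norm_lam_mul_regN_le C x h.isStep hk hne a c
        · push Not at hne
          obtain ⟨j, rfl⟩ := hne
          obtain ⟨l, hl⟩ := tendsto_regN_pole hs hn x h.isStep j a c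
          have h1 := ((continuousAt_lam (hs.notMem j)).tendsto.mono_left
            (nhdsWithin_le_nhds (s := {(κ j : ℂ)}ᶜ))).mul hl
          refine ⟨_, (eventually_nhdsWithin_iff.1
            (h1.norm.eventually_le_const (lt_add_one _))).mono fun z hz him => hz ?_⟩
          rintro rfl
          simp at him
  obtain ⟨B, hB⟩ := hcpt
  refine ⟨max B (C1 * (1 + qp)), fun k hk => ?_⟩
  rw [hnorm]
  rcases le_total ‖k‖ (max R 1) with h1 | h1
  · rw [mul_comm, ← norm_mul]
    exact (hB k (by simpa using h1) hk).trans (le_max_left _ _)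
  · refine le_trans ?_ (le_max_right _ _)
    have h2 := hC1 k hk.le ((le_max_left _ _).trans h1)
    have h3 : 1 ≤ ‖k‖ := (le_max_right _ _).trans h1
    have h4 : ‖lam qp k‖ ≤ ‖k‖ * (1 + qp) := by
      refine abs_le_of_sq_le_sq' ?_ (by have := h.pos; positivity) |>.2
      rw [← norm_pow, lam_sq h.pos]
      refine (norm_sub_le _ _).trans ?_
      rw [norm_pow, norm_pow, norm_real, Real.norm_of_nonneg h.pos.le]
      have := h.pos
      nlinarith [mul_pos this (by linarith : 0 < ‖k‖), mul_le_mul h3 h3 zero_le_one (by linarith)]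
    have h5 : 0 ≤ C1 * ‖k‖⁻¹ ^ 1 := (norm_nonneg _).trans h2
    calc _ ≤ C1 * ‖k‖⁻¹ ^ 1 * (‖k‖ * (1 + qp)) := by gcongr
      _ = C1 * (1 + qp) := by field_simp

end

end Poles

/-! ### The Plemelj representation -/

section Plemelj

open Asymptotics

variable {u u1 u2 v1 v2 : ℝ → ℝ} {qm qp : ℝ} {J : ℕ} {κ : Fin J → ℝ} {b C : Fin J → ℂ}

/-- The counterpart of `IsSmoothStep.N_zero_one` for the other off-diagonal entry. Together they show
that the first-order terms cancel in the jump of `N₁₂`. -/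
theorem IsSmoothStep.N_one_zero (h : IsSmoothStep u u1 u2 v1 v2 qm qp) (x : ℝ) :
    (fun k => N u qm qp x k 1 0 + I * (u x - qp) * (2 * k)⁻¹) =O[atInfty] fun k => k⁻¹ ^ 2 := by
  have p1 := h.right.hatPlus_one h.pos x
  have m1 := h.left.hatMinus_one h.isStep.pos' x
  have z1 := isBigO_inv_add_lam h.pos
  have z2 := (isBigO_inv_lam h.pos).const_mul_left 2⁻¹
  have z3 := isBigO_sub_lam h.pos
  have w1 := h.inv_hatWr_sub_one
  have P1 : (fun k => hatPlus u qp x k 1) =O[atInfty] fun k => k⁻¹ ^ 1 :=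
    ((p1.trans (isBigO_inv_pow_of_le one_le_two)).sub
      (z1.const_mul_left (I * u x))).congr_left fun k => by ring
  have M1 : (fun k => hatMinus u qm x k 1) =O[atInfty] fun k => k⁻¹ ^ 0 :=
    isBigO_one_of (c := -1) (m1.congr_left fun k => by ring)
  have e1 : (fun k => ((hatWr u qm qp k)⁻¹ - 1) * hatMinus u qm x k 1 +
      (hatMinus u qm x k 1 + 1)) =O[atInfty] fun k => k⁻¹ ^ 1 :=
    ((w1.mul M1).congr_right fun k => by ring).add m1
  refine IsBigO.congr' (f₁ := fun k => -(I * qp * (k + lam qp k)⁻¹ *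
      (((hatWr u qm qp k)⁻¹ - 1) * hatMinus u qm x k 1 + (hatMinus u qm x k 1 + 1)))
    + I * qp * ((k + lam qp k)⁻¹ - (2 * k)⁻¹)
    + (k - lam qp k) * (2⁻¹ * (lam qp k)⁻¹) * hatPlus u qp x k 1
    + (hatPlus u qp x k 1 + I * u x * (k + lam qp k)⁻¹)
    - I * u x * ((k + lam qp k)⁻¹ - (2 * k)⁻¹)) ?_ ?_ EventuallyEq.rfl
  · refine ((((?_ : _ =O[atInfty] _).neg_left.add
      ((isBigO_inv_add_lam_sub h.pos).const_mul_left _)).add ?_).add p1).sub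
      ((isBigO_inv_add_lam_sub h.pos).const_mul_left _)
    · exact ((z1.const_mul_left (I * qp)).mul e1).congr_right fun k => by ring
    · exact (((z3.mul z2).mul P1).congr_right fun k => by ring).trans
        (isBigO_inv_pow_of_le (m := 3) (by norm_num))
  · filter_upwards [eventually_atInfty_lam_ne_zero h.pos] with k hk
    have hζ := add_lam_ne_zero h.pos k
    rw [N_eq_hat h.pos h.isStep.pos' x hk]
    simp
    field_simp
    ring

/-- The difference `N⁻ - N⁺` of the boundary values on the real line. -/
def jumpN (u : ℝ → ℝ) (qm qp x s : ℝ) : Matrix (Fin 2) (Fin 2) ℂ :=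
  conjFlip (N u qm qp x s) - N u qm qp x s

theorem norm_inv_sub_le_of_notMem {a : ℝ} {k0 : ℂ} (hk0 : k0 ∉ cutC a) :
    ∃ K, ∀ᶠ k in 𝓝 k0, ∀ s ∈ cut a, ‖((s : ℂ) - k)⁻¹‖ ≤ K * (1 + |s|)⁻¹ := by
  obtain ⟨δ, hδ, hball⟩ := Metric.isOpen_iff.1 (isClosed_cutC a).isOpen_compl k0 hk0
  refine ⟨(1 + (‖k0‖ + δ / 2)) / (δ / 2) + 1, ?_⟩
  filter_upwards [Metric.ball_mem_nhds k0 (half_pos hδ)] with k hk s hs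
  have hk' : ‖k - k0‖ < δ / 2 := by simpa [dist_eq_norm] using hk
  have h1 : δ ≤ ‖(s : ℂ) - k0‖ := by
    by_contra hlt
    exact hball (by simpa [dist_eq_norm] using hlt) (mem_cutC_ofReal.2 hs)
  have h2 : δ / 2 ≤ ‖(s : ℂ) - k‖ := by
    have := norm_add_le ((s : ℂ) - k) (k - k0)
    rw [sub_add_sub_cancel] at this
    linarith
  have h3 : ‖k‖ ≤ ‖k0‖ + δ / 2 := by
    have := norm_add_le k0 (k - k0)
    rw [add_sub_cancel] at this
    linarith
  have h4 := norm_inv_sub_le (half_pos hδ) h2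
  rw [ofReal_re] at h4
  refine h4.trans ?_
  gcongr

/-- The Cauchy integral over the cut converges and is continuous off the cut. -/
theorem cauchy_integral_cut {a B : ℝ} (ha : 0 < a) {f : ℝ → ℂ}
    (hm : AEStronglyMeasurable f (volume.restrict (cut a)))
    (hB : ∀ᵐ s ∂volume.restrict (cut a), ‖f s‖ ≤ B * sqrtWeight a s) {k0 : ℂ}
    (hk0 : k0 ∉ cutC a) :
    IntegrableOn (fun s : ℝ => f s / (s - k0)) (cut a) ∧
      ContinuousAt (fun k => ∫ s in cut a, f s / (s - k)) k0 := by
  obtain ⟨K, hK⟩ := norm_inv_sub_le_of_notMem hk0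
  have hmeas : ∀ k : ℂ, AEStronglyMeasurable (fun s : ℝ => f s / (s - k)) (volume.restrict (cut a)) :=
    fun k => by
      have h1 : Measurable fun s : ℝ => ((s : ℂ) - k)⁻¹ := by fun_prop
      exact (hm.mul h1.aestronglyMeasurable).congr (ae_of_all _ fun s => (div_eq_mul_inv _ _).symm)
  have hbd : Integrable (fun s => B * K * (sqrtWeight a s * (1 + |s|)⁻¹)) (volume.restrict (cut a)) :=
    ((integrable_sqrtWeight ha).const_mul _).integrableOn
  have hle : ∀ᶠ k in 𝓝 k0, ∀ᵐ s ∂volume.restrict (cut a),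
      ‖f s / (s - k)‖ ≤ B * K * (sqrtWeight a s * (1 + |s|)⁻¹) := by
    filter_upwards [hK] with k hk
    filter_upwards [hB, ae_restrict_mem (isClosed_cut a).measurableSet] with s h1 h2
    rw [div_eq_mul_inv, norm_mul]
    calc _ ≤ B * sqrtWeight a s * (K * (1 + |s|)⁻¹) :=
          mul_le_mul h1 (hk s h2) (norm_nonneg _) ((norm_nonneg _).trans h1)
      _ = _ := by ring
  refine ⟨hbd.mono' (hmeas k0) hle.self_of_nhds,
    continuousAt_of_dominated (Eventually.of_forall hmeas) hle hbd ?_⟩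
  filter_upwards [ae_restrict_mem (isClosed_cut a).measurableSet] with s hs
  refine continuousAt_const.div (continuousAt_const.sub continuousAt_id) (sub_ne_zero.2 fun h => ?_)
  have h' : (s : ℂ) = k0 := h
  exact hk0 (h' ▸ mem_cutC_ofReal.2 hs)

section

variable (hs : IsSpectrum u qm qp κ) (hn : IsNorming u qm qp κ b C) (x : ℝ)
include hs hn

/-- The jump of `N` is the jump of `regN`: the residues are invariant under the symmetry, so the
pole terms cancel. -/
theorem jumpN_eq (h : IsStep u qm qp) (s : ℝ) (a c : Fin 2) : jumpN u qm qp x s a c =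
    conj (regN u qm qp κ C x s (1 - a) (1 - c)) - regN u qm qp κ C x s a c := by
  have h1 : ∀ j, conj (resN u qm qp (C j) x (κ j) (1 - a) (1 - c)) =
      resN u qm qp (C j) x (κ j) a c := fun j => by
    rw [← conjFlip_apply, hs.conjFlip_resN h j (hn.smul j) (hn.eq j) x]
  have h2 : conj ((1 : Matrix (Fin 2) (Fin 2) ℂ) (1 - a) (1 - c)) =
      (1 : Matrix (Fin 2) (Fin 2) ℂ) a c := by
    rw [← conjFlip_apply, conjFlip_one]
  rw [jumpN, Matrix.sub_apply, conjFlip_apply, regN_apply, regN_apply, Matrix.sub_apply,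
    Matrix.sub_apply, map_sub, map_sub, map_sum, h2]
  simp only [map_mul, h1, map_inv₀, map_sub, conj_ofReal]
  ring

omit hn in
theorem ae_tendsto_regN (h : IsStep u qm qp) (a c : Fin 2) :
    ∀ᵐ s : ℝ, Tendsto (fun k => regN u qm qp κ C x k a c) (𝓝[{z : ℂ | 0 < z.im}] (s : ℂ))
      (𝓝 (regN u qm qp κ C x s a c)) := by
  have h1 : ∀ b : ℝ, ∀ᵐ s : ℝ, s ≠ b := fun b => by simp [ae_iff]
  filter_upwards [h1 qp, h1 (-qp), ae_all_iff.2 fun j => h1 (κ j)] with s h2 h3 h4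
  refine tendsto_above_of_continuousWithinAt (F := fun k => regN u qm qp κ C x k a c)
    (continuousWithinAt_regN hs x h (by simp) ?_ (fun j hj => h4 j (ofReal_inj.1 hj)) a c)
  refine lam_ne_zero_of_abs h.pos fun h5 => ?_
  rcases (abs_eq h.pos.le).1 h5 with h6 | h6
  exacts [h2 h6, h3 h6]

/-- Cauchy's formula is applied to `regN` at the point of `{k0, conj k0}` in the upper half-plane;
the conjugate terms come from the symmetry of `N`. Off the cut the jump vanishes. -/
theorem plemelj_of_im_ne_zero (h : IsSmoothStep u u1 u2 v1 v2 qm qp) {k0 : ℂ} (hk0 : k0.im ≠ 0)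
    (a c : Fin 2) :
    IntegrableOn (fun s : ℝ => jumpN u qm qp x s a c / (s - k0)) (cut qp) ∧
      ∫ s in cut qp, jumpN u qm qp x s a c / (s - k0) =
        -(2 * Real.pi * I * regN u qm qp κ C x k0 a c) := by
  have hdiff : ∀ a c, DifferentiableOn ℂ (fun k => regN u qm qp κ C x k a c) {z | 0 < z.im} :=
    fun a c k hk => (differentiableAt_regN hs x h.isStep (fun h0 => (ne_of_gt hk) h0.1)
      (fun j hj => by
        have : (0 : ℝ) < k.im := hk
        rw [hj, ofReal_im] at this
        exact lt_irrefl _ this) a c).differentiableWithinAt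
  have hcauchy : ∀ (a c) {k : ℂ}, 0 < k.im →
      (Integrable (fun s : ℝ => regN u qm qp κ C x s a c * ((s : ℂ) - k)⁻¹) ∧
        ∫ s : ℝ, regN u qm qp κ C x s a c * ((s : ℂ) - k)⁻¹ =
          2 * Real.pi * I * regN u qm qp κ C x k a c) ∧
      (Integrable (fun s : ℝ => regN u qm qp κ C x s a c * ((s : ℂ) - conj k)⁻¹) ∧
        ∫ s : ℝ, regN u qm qp κ C x s a c * ((s : ℂ) - conj k)⁻¹ = 0) := fun a c k hk => by
    obtain ⟨B, hB⟩ := exists_bound_regN hs hn x h a c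
    exact cauchy_upper h.pos (hdiff a c) hB (ae_tendsto_regN hs x h.isStep a c) hk
  -- the integral over the whole line
  have hline : Integrable (fun s : ℝ => jumpN u qm qp x s a c / (s - k0)) ∧
      ∫ s : ℝ, jumpN u qm qp x s a c / (s - k0) =
        -(2 * Real.pi * I * regN u qm qp κ C x k0 a c) := by
    have hf : (fun s : ℝ => jumpN u qm qp x s a c / (s - k0)) = fun s : ℝ =>
        conj (regN u qm qp κ C x s (1 - a) (1 - c) * ((s : ℂ) - conj k0)⁻¹) -
          regN u qm qp κ C x s a c * ((s : ℂ) - k0)⁻¹ := by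
      funext s
      rw [jumpN_eq hs hn x h.isStep]
      simp only [map_mul, map_inv₀, map_sub, conj_ofReal, conj_conj]
      ring
    have hci : ∀ {g : ℝ → ℂ}, Integrable g → Integrable (fun s => conj (g s)) ∧
        ∫ s, conj (g s) = conj (∫ s, g s) := fun hg =>
      ⟨(conjCLE.toContinuousLinearMap.integrable_comp hg), integral_conj⟩
    rw [hf]
    rcases lt_or_gt_of_ne hk0 with him | him
    · have hk1 : 0 < (conj k0).im := by simpa using him
      have e1 := (hcauchy a c hk1).2
      have e2 := (hcauchy (1 - a) (1 - c) hk1).1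
      rw [conj_conj] at e1
      have e3 := hci e2.1
      refine ⟨e3.1.sub e1.1, (integral_sub e3.1 e1.1).trans ?_⟩
      rw [e3.2, e1.2, e2.2, regN_conj hs hn x h.isStep (fun h0 => hk0 h0.1), conjFlip_apply]
      have h5 : ∀ i : Fin 2, 1 - (1 - i) = i := by decide
      rw [h5, h5]
      simp [map_ofNat]
    · have e1 := (hcauchy a c him).1
      have e2 := (hcauchy (1 - a) (1 - c) him).2
      have e3 := hci e2.1
      refine ⟨e3.1.sub e1.1, (integral_sub e3.1 e1.1).trans ?_⟩
      rw [e3.2, e1.2, e2.2, map_zero, zero_sub]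
  refine ⟨hline.1.integrableOn, ?_⟩
  rw [← hline.2]
  refine setIntegral_eq_integral_of_ae_compl_eq_zero ?_
  refine ae_of_all _ fun s hsc => ?_
  have hsc' : (s : ℂ) ∉ cutC qp := fun h0 => hsc (mem_cutC_ofReal.1 h0)
  have := h.isStep.N_conj x hsc'
  rw [conj_ofReal] at this
  rw [jumpN, ← this, sub_self]
  simp

theorem norm_regN_le (h : IsSmoothStep u u1 u2 v1 v2 qm qp) (a c : Fin 2) :
    ∃ B, ∀ᵐ s : ℝ, ‖regN u qm qp κ C x s a c‖ ≤ B * sqrtWeight qp s := by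
  obtain ⟨B, hB⟩ := exists_bound_regN hs hn x h a c
  have h1 : ∀ b : ℝ, ∀ᵐ s : ℝ, s ≠ b := fun b => by simp [ae_iff]
  refine ⟨B, ?_⟩
  filter_upwards [ae_tendsto_regN hs x h.isStep (C := C) a c, h1 qp, h1 (-qp)] with s h2 h3 h4
  have h5 : Tendsto (fun k : ℂ => √‖k ^ 2 - (qp : ℂ) ^ 2‖) (𝓝[{z : ℂ | 0 < z.im}] (s : ℂ))
      (𝓝 √‖(s : ℂ) ^ 2 - (qp : ℂ) ^ 2‖) :=
    (Continuous.tendsto (by fun_prop) _).mono_left nhdsWithin_le_nhds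
  have h6 : ‖regN u qm qp κ C x s a c‖ * √‖(s : ℂ) ^ 2 - (qp : ℂ) ^ 2‖ ≤ B :=
    le_of_tendsto (h2.norm.mul h5) (eventually_nhdsWithin_of_forall fun k hk => hB k hk)
  have h7 : ‖(s : ℂ) ^ 2 - (qp : ℂ) ^ 2‖ = |s ^ 2 - qp ^ 2| := by
    rw [← ofReal_pow, ← ofReal_pow, ← ofReal_sub, norm_real, Real.norm_eq_abs]
  have h8 : s ^ 2 - qp ^ 2 ≠ 0 := by
    rw [sq_sub_sq]
    exact mul_ne_zero (fun h => h4 (by linarith)) (sub_ne_zero.2 h3)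
  rwa [h7, ← le_div_iff₀ (Real.sqrt_pos.2 (abs_pos.2 h8)), div_eq_mul_inv] at h6

theorem norm_jumpN_le (h : IsSmoothStep u u1 u2 v1 v2 qm qp) (a c : Fin 2) :
    ∃ B, ∀ᵐ s : ℝ, ‖jumpN u qm qp x s a c‖ ≤ B * sqrtWeight qp s := by
  obtain ⟨B, hB⟩ := norm_regN_le hs hn x h a c
  obtain ⟨B', hB'⟩ := norm_regN_le hs hn x h (1 - a) (1 - c)
  refine ⟨B' + B, ?_⟩
  filter_upwards [hB, hB'] with s h1 h2
  rw [jumpN_eq hs hn x h.isStep, add_mul]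
  refine (norm_sub_le _ _).trans (add_le_add ?_ h1)
  rwa [norm_conj]

theorem aestronglyMeasurable_jumpN (h : IsSmoothStep u u1 u2 v1 v2 qm qp) (a c : Fin 2) :
    AEStronglyMeasurable (fun s => jumpN u qm qp x s a c) (volume.restrict (cut qp)) := by
  have h1 := (plemelj_of_im_ne_zero hs hn x h (k0 := I) (by simp) a c).1.aestronglyMeasurable
  have h2 : Continuous fun s : ℝ => (s : ℂ) - I := by fun_prop
  refine (h1.mul h2.aestronglyMeasurable).congr (ae_of_all _ fun s => ?_)
  have h3 : (s : ℂ) - I ≠ 0 := fun h0 => by simpa using congrArg im h0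
  exact div_mul_cancel₀ _ h3

/-- The Plemelj formula for `regN`. In the gap it follows by continuity from the upper half-plane. -/
theorem plemelj (h : IsSmoothStep u u1 u2 v1 v2 qm qp) {k0 : ℂ} (hk0 : k0 ∉ cutC qp)
    (hne : ∀ j, k0 ≠ κ j) (a c : Fin 2) :
    IntegrableOn (fun s : ℝ => jumpN u qm qp x s a c / (s - k0)) (cut qp) ∧
      ∫ s in cut qp, jumpN u qm qp x s a c / (s - k0) =
        -(2 * Real.pi * I * regN u qm qp κ C x k0 a c) := by
  by_cases him : k0.im = 0
  · obtain ⟨B, hB⟩ := norm_jumpN_le hs hn x h a c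
    have h1 := cauchy_integral_cut h.pos (aestronglyMeasurable_jumpN hs hn x h a c)
      (ae_restrict_of_ae hB) hk0
    obtain ⟨s, rfl⟩ : ∃ s : ℝ, (s : ℂ) = k0 := ⟨k0.re, Complex.ext (by simp) (by simp [him])⟩
    have h2 := (differentiableAt_regN hs x h.isStep hk0 hne (C := C) a c).continuousAt
    refine ⟨h1.1, tendsto_nhds_unique
      (h1.2.tendsto.mono_left (nhdsWithin_le_nhds (s := {z : ℂ | 0 < z.im}))) ?_⟩
    refine ((h2.tendsto.mono_left (nhdsWithin_le_nhds (s := {z : ℂ | 0 < z.im}))).const_mul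
      (2 * Real.pi * I)).neg.congr' ?_
    filter_upwards [self_mem_nhdsWithin] with k hk
    have hk' : 0 < k.im := hk
    exact (plemelj_of_im_ne_zero hs hn x h hk'.ne' a c).2.symm
  · exact plemelj_of_im_ne_zero hs hn x h him a c

/-- The Plemelj representation of `N`. -/
theorem N_apply_eq (h : IsSmoothStep u u1 u2 v1 v2 qm qp) {k0 : ℂ} (hk0 : k0 ∉ cutC qp)
    (hne : ∀ j, k0 ≠ κ j) (a c : Fin 2) : N u qm qp x k0 a c =
      (1 : Matrix (Fin 2) (Fin 2) ℂ) a c + ∑ j, (k0 - κ j)⁻¹ * resN u qm qp (C j) x (κ j) a c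
      - (2 * Real.pi * I)⁻¹ * ∫ s in cut qp, jumpN u qm qp x s a c / (s - k0) := by
  rw [(plemelj hs hn x h hk0 hne a c).2, regN_apply, Matrix.sub_apply]
  have := Real.pi_ne_zero
  have h1 : (2 * Real.pi * I : ℂ) ≠ 0 := two_pi_I_ne_zero
  field_simp
  ring

end

end Plemelj

/-! ### The jump matrices and the reconstruction formula -/

section Reconstruction

open Asymptotics

variable {u u1 u2 v1 v2 : ℝ → ℝ} {qm qp : ℝ} {J : ℕ} {κ : Fin J → ℝ} {b C : Fin J → ℂ}

namespace IsStep

variable (h : IsStep u qm qp) {s : ℝ} (hs : qp < |s|) (hW : jostWr u qm qp s ≠ 0) (x : ℝ)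
include h hs hW

theorem above_M_eq : above (M u qm qp x) s =
    below (M u qm qp x) s * (E qp s - 1) * (1 - V0 u qm qp x s) := by
  rw [h.above_M hW, h.below_M_mul hs hW, ← h.M_eq_conjFlip_mul hs x hW]

/-- The jump relation of `N`; the left-hand factor of `Ṽ` turns `N⁻` into `M⁻`. -/
theorem below_N_mul_Vtilde : below (N u qm qp x) s * Vtilde u qm qp x s = N u qm qp x s := by
  rw [Vtilde, V, ← mul_assoc, ← mul_assoc, ← mul_assoc, ← h.below_M hs hW,
    ← h.above_M_eq hs hW, h.above_M hW, N]

theorem below_N_mul_one_sub : below (N u qm qp x) s * (1 - Vtilde u qm qp x s) =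
    jumpN u qm qp x s := by
  rw [mul_sub, mul_one, h.below_N_mul_Vtilde hs hW, h.below_N hs hW, jumpN]

theorem below_M_mul_V0 : below (M u qm qp x) s * (E qp s - 1) * V0 u qm qp x s * (E qp s)⁻¹ =
    jumpN u qm qp x s := by
  have hl := lam_ne_zero_of_abs h.pos (s := s) hs.ne'
  have h1 : conjFlip (M u qm qp x s) * (E qp s)⁻¹ = conjFlip (N u qm qp x s) := by
    have hc : (s : ℂ) ∈ cutC qp := mem_cutC_ofReal.2 hs.le
    conv_lhs => rw [h.M_eq_N_mul x hl]
    rw [conjFlip_mul, conjFlip_E hc, mul_assoc, E_mul_inv h.pos hl, mul_one]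
  have h2 := h.above_M_eq hs hW x
  rw [h.above_M hW, h.below_M_mul hs hW, mul_sub, mul_one] at h2
  rw [h.below_M_mul hs hW, jumpN, ← h1, N, ← sub_mul]
  congr 1
  generalize conjFlip (M u qm qp x s) = A at h2 ⊢
  rw [h2]; abel

/-- The integrand of the reconstruction formula is, up to a constant, the jump of `N₁₂`. -/
theorem jumpN_zero_one : jumpN u qm qp x s 0 1 = -(I / 2) * recIntegrand u qm qp x s := by
  have hl := lam_ne_zero_of_abs h.pos (s := s) hs.ne'
  have hk := sub_lam_ne_zero h.pos (s : ℂ)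
  rw [← h.below_M_mul_V0 hs hW, E_inv, gam_eq h.pos, recIntegrand]
  generalize below (M u qm qp x) s = A
  generalize V0 u qm qp x s = W
  simp [E, Matrix.mul_apply, Fin.sum_univ_two, sigma3, Qmat]
  field_simp
  ring

end IsStep

theorem resN_zero_one (hqp : 0 < qp) (c : ℂ) (x s : ℝ) (hl : lam qp s ≠ 0) :
    resN u qm qp c x s 0 1 = I / 2 * (qp * (c * exp (I * (lam qp s + lam qm s) * x) *
      M u qm qp x s 0 1 / lam qp s)) := by
  have hk := sub_lam_ne_zero hqp (s : ℂ)
  rw [resN, E_inv, gam_eq hqp, resM]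
  generalize M u qm qp x s = A
  simp [Matrix.mul_apply, Fin.sum_univ_two]
  field_simp

/-- The jump of `N₁₂` has inverse square root singularities at `±q₊` and is `O(s⁻²)` at infinity. -/
theorem norm_jumpN_zero_one_le (hs : IsSpectrum u qm qp κ) (hn : IsNorming u qm qp κ b C) (x : ℝ)
    (h : IsSmoothStep u u1 u2 v1 v2 qm qp) :
    ∃ K, ∀ᵐ s : ℝ, ‖jumpN u qm qp x s 0 1‖ ≤ K * (sqrtWeight qp s * (1 + |s|)⁻¹) := by
  obtain ⟨B, hB⟩ := norm_jumpN_le hs hn x h 0 1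
  obtain ⟨C1, R1, h1⟩ := isBigO_atInfty_iff.1 (h.N_zero_one x)
  obtain ⟨C2, R2, h2⟩ := isBigO_atInfty_iff.1 (h.N_one_zero x)
  set R := max (max R1 R2) (max qp 1) with hR
  have hR1 : R1 ≤ R := (le_max_left _ _).trans (le_max_left _ _)
  have hR2 : R2 ≤ R := (le_max_right _ _).trans (le_max_left _ _)
  have hRq : qp ≤ R := (le_max_left _ _).trans (le_max_right _ _)
  have hR0 : 1 ≤ R := (le_max_right _ _).trans (le_max_right _ _)
  have hw : ∀ s, 0 ≤ sqrtWeight qp s := fun s => by rw [sqrtWeight]; positivity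
  refine ⟨max (B * (1 + R)) (2 * (|C1| + |C2|)), ?_⟩
  have hne : ∀ b : ℝ, ∀ᵐ s : ℝ, s ≠ b := fun b => by simp [ae_iff]
  filter_upwards [hB, hne qp, hne (-qp)] with s h3 h4 h5
  have hpos : 0 ≤ sqrtWeight qp s * (1 + |s|)⁻¹ := mul_nonneg (hw s) (by positivity)
  by_cases hsR : |s| ≤ R
  · refine le_trans ?_ (mul_le_mul_of_nonneg_right (le_max_left _ _) hpos)
    refine h3.trans ?_
    have hB0 : 0 ≤ B * sqrtWeight qp s := (norm_nonneg _).trans h3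
    have h6 : 1 ≤ (1 + R) * (1 + |s|)⁻¹ := by
      rw [← div_eq_mul_inv, one_le_div (by positivity)]; linarith
    calc B * sqrtWeight qp s ≤ B * sqrtWeight qp s * ((1 + R) * (1 + |s|)⁻¹) :=
          le_mul_of_one_le_right hB0 h6
      _ = _ := by ring
  · refine le_trans ?_ (mul_le_mul_of_nonneg_right (le_max_right _ _) hpos)
    have hsR' : R < |s| := not_le.1 hsR
    have hs1 : 1 < |s| := hR0.trans_lt hsR'
    have hn1 : ‖(s : ℂ)‖ = |s| := by rw [norm_real, Real.norm_eq_abs]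
    have e1 := h1 s (by simp) (by rw [hn1]; linarith)
    have e2 := h2 s (by simp) (by rw [hn1]; linarith)
    rw [hn1] at e1 e2
    have e3 : jumpN u qm qp x s 0 1 =
        conj (N u qm qp x s 1 0 + I * (u x - qp) * (2 * (s : ℂ))⁻¹) -
          (N u qm qp x s 0 1 - I * (u x - qp) * (2 * (s : ℂ))⁻¹) := by
      rw [jumpN, Matrix.sub_apply, conjFlip_apply, map_add, map_mul, map_mul, map_inv₀, map_mul,
        map_sub, conj_ofReal, conj_ofReal, conj_ofReal, conj_I, map_ofNat]
      simp
      ring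
    have e4 : ‖jumpN u qm qp x s 0 1‖ ≤ (|C1| + |C2|) * |s|⁻¹ ^ 2 := by
      rw [e3]
      refine (norm_sub_le _ _).trans ?_
      rw [norm_conj]
      have e5 : C1 * |s|⁻¹ ^ 2 ≤ |C1| * |s|⁻¹ ^ 2 := by gcongr; exact le_abs_self _
      have e6 : C2 * |s|⁻¹ ^ 2 ≤ |C2| * |s|⁻¹ ^ 2 := by gcongr; exact le_abs_self _
      rw [add_mul]
      linarith
    refine e4.trans ?_
    have e7 : |s|⁻¹ ≤ sqrtWeight qp s := by
      have e8 : qp ^ 2 < s ^ 2 := by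
        rw [← sq_abs s]; exact pow_lt_pow_left₀ (by linarith) h.pos.le two_ne_zero
      rw [sqrtWeight, abs_of_pos (sub_pos.2 e8)]
      refine inv_anti₀ (Real.sqrt_pos.2 (by linarith)) ?_
      rw [← Real.sqrt_sq_eq_abs]
      exact Real.sqrt_le_sqrt (by linarith [sq_nonneg qp])
    have e9 : |s|⁻¹ ≤ 2 * (1 + |s|)⁻¹ := by
      rw [← div_eq_mul_inv, inv_eq_one_div, div_le_div_iff₀ (by linarith) (by linarith)]
      linarith
    calc (|C1| + |C2|) * |s|⁻¹ ^ 2 = (|C1| + |C2|) * (|s|⁻¹ * |s|⁻¹) := by rw [sq]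
      _ ≤ (|C1| + |C2|) * (sqrtWeight qp s * (2 * (1 + |s|)⁻¹)) := by
          refine mul_le_mul_of_nonneg_left ?_ (by positivity)
          exact mul_le_mul e7 e9 (by positivity) (hw s)
      _ = _ := by ring

theorem integrableOn_jumpN_zero_one (hs : IsSpectrum u qm qp κ) (hn : IsNorming u qm qp κ b C)
    (x : ℝ) (h : IsSmoothStep u u1 u2 v1 v2 qm qp) :
    IntegrableOn (fun s => jumpN u qm qp x s 0 1) (cut qp) := by
  obtain ⟨K, hK⟩ := norm_jumpN_zero_one_le hs hn x h
  exact Integrable.mono' ((integrable_sqrtWeight h.pos).const_mul K).integrableOn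
    (aestronglyMeasurable_jumpN hs hn x h 0 1) (ae_restrict_of_ae hK)

theorem norm_le_norm_ofReal_sub (s y : ℝ) : ‖(y : ℂ) * I‖ ≤ ‖(s : ℂ) - y * I‖ := by
  have h1 := abs_im_le_norm ((s : ℂ) - y * I)
  have h2 : ((s : ℂ) - y * I).im = -y := by simp
  rw [h2, abs_neg] at h1
  simpa using h1

/-- The leading coefficient at infinity of a Cauchy integral. -/
theorem tendsto_mul_cauchy {f : ℝ → ℂ} {μ : Measure ℝ} (hf : Integrable f μ) :
    Tendsto (fun y : ℝ => (y * I) * ∫ s, f s / (s - y * I) ∂μ) atTop (𝓝 (-∫ s, f s ∂μ)) := by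
  rw [← integral_neg]
  simp only [← integral_const_mul]
  refine tendsto_integral_filter_of_dominated_convergence (fun s => ‖f s‖) ?_ ?_ hf.norm ?_
  · refine Eventually.of_forall fun y => ?_
    have h1 : Measurable fun s : ℝ => (y * I) * ((s : ℂ) - y * I)⁻¹ := by fun_prop
    exact (hf.1.mul h1.aestronglyMeasurable).congr (ae_of_all _ fun s => by
      simp only [Pi.mul_apply]; ring)
  · filter_upwards [eventually_gt_atTop 0] with y hy
    refine ae_of_all _ fun s => ?_
    have h1 := norm_le_norm_ofReal_sub s y
    have h2 : 0 < ‖(y : ℂ) * I‖ := by simpa using hy.ne'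
    rw [norm_mul, norm_div, mul_div_left_comm]
    exact mul_le_of_le_one_right (norm_nonneg _) ((div_le_one (h2.trans_le h1)).2 h1)
  · refine ae_of_all _ fun s => ?_
    have h0 : Tendsto (fun y : ℝ => (s : ℂ) * (y : ℂ)⁻¹) atTop (𝓝 0) := by
      have : Tendsto (fun y : ℝ => ((y⁻¹ : ℝ) : ℂ)) atTop (𝓝 0) :=
        (continuous_ofReal.tendsto' 0 0 ofReal_zero).comp tendsto_inv_atTop_zero
      simpa using this.const_mul (s : ℂ)
    have h1 : Tendsto (fun y : ℝ => f s * I * ((s : ℂ) * (y : ℂ)⁻¹ - I)⁻¹) atTop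
        (𝓝 (f s * I * (0 - I)⁻¹)) :=
      ((h0.sub_const I).inv₀ (by simp)).const_mul _
    have h2 : f s * I * (0 - I)⁻¹ = -f s := by
      rw [zero_sub, inv_neg, mul_neg, mul_assoc, mul_inv_cancel₀ I_ne_zero, mul_one]
    rw [h2] at h1
    refine h1.congr' ?_
    filter_upwards [eventually_gt_atTop 0] with y hy
    have hy' : (y : ℂ) ≠ 0 := ofReal_ne_zero.2 hy.ne'
    have h3 : (s : ℂ) * (y : ℂ)⁻¹ - I = (s - y * I) * (y : ℂ)⁻¹ := by field_simp
    rw [h3, mul_inv, inv_inv]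
    ring

theorem tendsto_mul_inv_sub (p : ℂ) :
    Tendsto (fun y : ℝ => (y * I) * ((y : ℂ) * I - p)⁻¹) atTop (𝓝 1) := by
  have h0 : Tendsto (fun y : ℝ => I - p * (y : ℂ)⁻¹) atTop (𝓝 I) := by
    have : Tendsto (fun y : ℝ => ((y⁻¹ : ℝ) : ℂ)) atTop (𝓝 0) :=
      (continuous_ofReal.tendsto' 0 0 ofReal_zero).comp tendsto_inv_atTop_zero
    simpa using (this.const_mul p).const_sub I
  have h1 := (h0.inv₀ I_ne_zero).const_mul I
  rw [mul_inv_cancel₀ I_ne_zero] at h1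
  refine h1.congr' ?_
  filter_upwards [eventually_gt_atTop 0] with y hy
  have hy' : (y : ℂ) ≠ 0 := ofReal_ne_zero.2 hy.ne'
  have h3 : I - p * (y : ℂ)⁻¹ = (y * I - p) * (y : ℂ)⁻¹ := by field_simp
  rw [h3, mul_inv, inv_inv]
  ring

theorem tendsto_atInfty : Tendsto (fun y : ℝ => (y : ℂ) * I) atTop atInfty := by
  refine tendsto_inf.2 ⟨?_, tendsto_principal.2 ?_⟩
  · rw [← tendsto_norm_atTop_iff_cobounded]
    refine tendsto_abs_atTop_atTop.congr fun y => by simp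
  · filter_upwards [eventually_ge_atTop 0] with y hy
    simpa using hy

/-- Comparison of the coefficients of `1 / k` in the Plemelj representation of `N₁₂`, as `k → ∞` along
the imaginary axis. -/
theorem IsSmoothStep.reconstruction (h : IsSmoothStep u u1 u2 v1 v2 qm qp)
    (hs : IsSpectrum u qm qp κ) (hn : IsNorming u qm qp κ b C) (x : ℝ) :
    I * (u x - qp) * 2⁻¹ = ∑ j, resN u qm qp (C j) x (κ j) 0 1 +
      (2 * Real.pi * I)⁻¹ * ∫ s in cut qp, jumpN u qm qp x s 0 1 := by
  have h1 : Tendsto (fun y : ℝ => (y * I) * N u qm qp x (y * I) 0 1) atTop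
      (𝓝 (I * (u x - qp) * 2⁻¹)) := by
    have h2 : (fun k => k * (N u qm qp x k 0 1 - I * (u x - qp) * (2 * k)⁻¹)) =O[atInfty]
        fun k => k⁻¹ := by
      refine ((isBigO_refl (fun k : ℂ => k) atInfty).mul (h.N_zero_one x)).congr' EventuallyEq.rfl ?_
      filter_upwards [eventually_atInfty_ne_zero] with k hk
      field_simp
    have h3 : Tendsto (fun k : ℂ => k⁻¹) atInfty (𝓝 0) :=
      tendsto_inv₀_cobounded.mono_left inf_le_left
    have h4 := ((h2.trans_tendsto h3).comp tendsto_atInfty).add_const (I * (u x - qp) * 2⁻¹)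
    rw [zero_add] at h4
    refine h4.congr' ?_
    filter_upwards [eventually_gt_atTop 0] with y hy
    have hy' : (y : ℂ) ≠ 0 := ofReal_ne_zero.2 hy.ne'
    have := I_ne_zero
    simp only [Function.comp_apply]
    field_simp
    ring
  have h5 : Tendsto (fun y : ℝ => ∑ j, (y * I) * ((y : ℂ) * I - κ j)⁻¹ *
      resN u qm qp (C j) x (κ j) 0 1) atTop (𝓝 (∑ j, resN u qm qp (C j) x (κ j) 0 1)) := by
    refine tendsto_finsetSum _ fun j _ => ?_
    simpa using (tendsto_mul_inv_sub (κ j)).mul_const (resN u qm qp (C j) x (κ j) 0 1)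
  have h6 := (tendsto_mul_cauchy (integrableOn_jumpN_zero_one hs hn x h)).const_mul
    ((2 * Real.pi * I : ℂ)⁻¹)
  refine tendsto_nhds_unique h1 ?_
  have h7 := h5.sub h6
  rw [mul_neg, sub_neg_eq_add] at h7
  refine h7.congr' ?_
  filter_upwards [eventually_gt_atTop 0] with y hy
  have him : ((y : ℂ) * I).im = y := by simp
  have hk : (y : ℂ) * I ∉ cutC qp := fun h0 => hy.ne' (him ▸ h0.1)
  have hne : ∀ j, (y : ℂ) * I ≠ κ j := fun j h0 => by
    have := congrArg im h0
    rw [him, ofReal_im] at this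
    exact hy.ne' this
  rw [N_apply_eq hs hn x h hk hne]
  have h8 : (1 : Matrix (Fin 2) (Fin 2) ℂ) 0 1 = 0 := by simp
  rw [h8, zero_add, mul_sub, Finset.mul_sum]
  simp only [mul_assoc]
  congr 1
  ring

/-- `N → I` at infinity, with an error of order `1 / k`. -/
theorem IsSmoothStep.isBigO_N (h : IsSmoothStep u u1 u2 v1 v2 qm qp) (x : ℝ) (a c : Fin 2) :
    (fun k => (N u qm qp x k - 1) a c) =O[Bornology.cobounded ℂ ⊓ 𝓟 (cutC qp)ᶜ] fun k => k⁻¹ := by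
  obtain ⟨C1, R1, h1⟩ := isBigO_atInfty_iff.1 (h.N_sub_one x a c)
  obtain ⟨C2, R2, h2⟩ := isBigO_atInfty_iff.1 (h.N_sub_one x (1 - a) (1 - c))
  refine IsBigO.of_bound (max C1 C2) ?_
  have hlarge : ∀ᶠ k : ℂ in Bornology.cobounded ℂ, max R1 R2 ≤ ‖k‖ :=
    tendsto_norm_cobounded_atTop.eventually_ge_atTop _
  filter_upwards [hlarge.filter_mono inf_le_left,
    (eventually_principal.2 fun k hk => hk : ∀ᶠ k in 𝓟 (cutC qp)ᶜ, k ∈ (cutC qp)ᶜ).filter_mono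
      inf_le_right] with k hk hc
  rw [norm_inv]
  rcases le_total 0 k.im with him | him
  · refine (h1 k him ((le_max_left _ _).trans hk)).trans ?_
    rw [pow_one]
    gcongr
    exact le_max_left _ _
  · have h3 : N u qm qp x k = conjFlip (N u qm qp x (conj k)) := by
      rw [h.isStep.N_conj x hc, conjFlip_conjFlip]
    have h4 : (N u qm qp x k - 1) a c = conj ((N u qm qp x (conj k) - 1) (1 - a) (1 - c)) := by
      rw [h3, Matrix.sub_apply, Matrix.sub_apply, map_sub, conjFlip_apply, ← conjFlip_apply 1,
        conjFlip_one]
    rw [h4, norm_conj]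
    refine (h2 (conj k) (by simpa using him) (by rw [norm_conj]; exact (le_max_right _ _).trans hk)).trans ?_
    rw [pow_one, norm_conj]
    gcongr
    exact le_max_right _ _

end Reconstruction

/-! ### Solutions of the equation as smooth steps -/

theorem exists_abs_le_of_tendsto {u : ℝ → ℝ} {l r : ℝ} (hu : Continuous u)
    (hl : Tendsto u atBot (𝓝 l)) (hr : Tendsto u atTop (𝓝 r)) : ∃ B, ∀ x, |u x| ≤ B := by
  obtain ⟨x0, h0⟩ := eventually_atBot.1 (hl.abs.eventually_le_const (lt_add_one |l|))
  obtain ⟨x1, h1⟩ := eventually_atTop.1 (hr.abs.eventually_le_const (lt_add_one |r|))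
  obtain ⟨B, hB⟩ := (isCompact_Icc (a := x0) (b := x1)).exists_bound_of_continuousOn hu.continuousOn
  refine ⟨max B (max (|l| + 1) (|r| + 1)), fun x => ?_⟩
  rcases le_total x x0 with hx | hx
  · exact (h0 x hx).trans ((le_max_left _ _).trans (le_max_right _ _))
  rcases le_total x1 x with hx' | hx'
  · exact (h1 x hx').trans ((le_max_right _ _).trans (le_max_right _ _))
  · exact (hB x ⟨hx, hx'⟩).trans (le_max_left _ _)

theorem IsShortRange.of_integrableOn_Ici {v : ℝ → ℝ} (hv : Continuous v)
    (h : IntegrableOn (fun s => (1 + |s|) * v s) (Set.Ici 0)) : IsShortRange v where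
  continuous := hv
  moment x := by
    have h1 : IntegrableOn (fun s => (1 + |s|) * v s) (Set.Icc x 0) :=
      ((continuous_const.add continuous_abs).mul hv).continuousOn.integrableOn_compact isCompact_Icc
    refine (h1.union h).mono_set fun s hs => ?_
    rcases le_total s 0 with h0 | h0
    exacts [Or.inl ⟨le_of_lt hs, h0⟩, Or.inr h0]

/-- A solution of the equation is, at each time, a smooth step between its boundary values. -/
theorem IsDefocusingSolution.isSmoothStep {q : ℝ → ℝ → ℝ} {qm qp : ℝ} {T : Set ℝ}
    (hq : IsDefocusingSolution q qm qp T) (hqp : 0 < qp) (hqm : qp < qm) {t : ℝ} (ht : t ∈ T) :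
    IsSmoothStep (fun x => q x t) (deriv fun x => q x t) (iteratedDeriv 2 fun x => q x t)
      (fun x => -deriv (fun x => q x t) (-x)) (fun x => iteratedDeriv 2 (fun x => q x t) (-x))
      qm qp := by
  set u : ℝ → ℝ := fun x => q x t with hu
  have hc := hq.contDiff t ht
  obtain ⟨B, hB⟩ := exists_abs_le_of_tendsto hc.continuous (hq.tendsto_left t ht)
    (hq.tendsto_right t ht)
  have d1 : ∀ x, HasDerivAt u (deriv u x) x := fun x =>
    (hc.differentiable (by norm_num) x).hasDerivAt
  have d2 : ∀ x, HasDerivAt (deriv u) (iteratedDeriv 2 u x) x := fun x => by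
    have h1 := hc.differentiable_iteratedDeriv 1 (by norm_num)
    rw [iteratedDeriv_one] at h1
    rw [iteratedDeriv_succ, iteratedDeriv_one]
    exact (h1 x).hasDerivAt
  have c2 : Continuous (iteratedDeriv 2 u) := hc.continuous_iteratedDeriv 2 (by norm_num)
  refine ⟨hqp, hqm, ?_, ?_⟩
  · refine ⟨⟨⟨B, fun x => hB (-x)⟩, ?_⟩, fun x => ?_, fun x => ?_, c2.comp continuous_neg,
      (hq.integrable_deriv t ht).comp_neg.neg, (hq.integrable_deriv_two t ht).comp_neg⟩
    · refine .of_integrableOn_Ici ((hc.continuous.comp continuous_neg).sub continuous_const) ?_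
      have h2 := (hq.moment_left t ht)
      rw [← neg_zero, ← (Measure.measurePreserving_neg (volume : Measure ℝ)).integrableOn_comp_preimage
        (Homeomorph.neg ℝ).measurableEmbedding] at h2
      simpa [Function.comp_def] using h2
    · simpa [Function.comp_def] using (d1 (-x)).scomp x (hasDerivAt_neg x)
    · simpa [Function.comp_def] using ((d2 (-x)).scomp x (hasDerivAt_neg x)).fun_neg
  · exact ⟨⟨⟨B, hB⟩, .of_integrableOn_Ici (hc.continuous.sub continuous_const) (hq.moment_right t ht)⟩,
      d1, d2, c2, hq.integrable_deriv t ht, hq.integrable_deriv_two t ht⟩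

theorem ae_lt_abs_restrict_cut (a : ℝ) : ∀ᵐ s : ℝ ∂volume.restrict (cut a), a < |s| := by
  have hne : ∀ b : ℝ, ∀ᵐ s : ℝ, s ≠ b := fun b => by simp [ae_iff]
  filter_upwards [ae_restrict_mem (isClosed_cut a).measurableSet, ae_restrict_of_ae (hne a),
    ae_restrict_of_ae (hne (-a))] with s h1 h2 h3
  refine lt_of_le_of_ne h1 fun h => ?_
  rcases abs_choice s with h4 | h4
  exacts [h2 (by rw [h, h4]), h3 (by rw [h, h4, neg_neg])]

end MKdV

end

open MKdV in
theorem mainTheorem6 (q : ℝ → ℝ → ℝ) (qm qp : ℝ) (hqp : 0 < qp) (hqm : qp < qm)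
    (T : Set ℝ) (hT : IsOpen T) (hq : IsDefocusingSolution q qm qp T)
    (t : ℝ) (ht : t ∈ T) (u : ℝ → ℝ) (hu : u = fun x => q x t)
    -- no spectral singularities
    (hsing : ∀ s ∈ cut qp, Wr (phiMinus u qm 0 (s : ℂ)) (phiPlus u qp 1 (s : ℂ)) ≠ 0)
    -- the zeros of `s₁₁` in `(-qp, qp)` are the points `κ j`, and they are simple
    (J : ℕ) (κ : Fin J → ℝ) (hκ : Function.Injective κ)
    (hzero : ∀ s : ℝ, (|s| < qp ∧ s11 u qm qp s = 0) ↔ ∃ j, κ j = s)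
    (hsimple : ∀ j, deriv (s11 u qm qp) (κ j) ≠ 0) :
    ∃ b : Fin J → ℂ,
      (∀ j x, phiMinus u qm 0 (κ j) x = b j • phiPlus u qp 1 (κ j) x) ∧
      ∀ C : Fin J → ℂ, (∀ j, C j = b j / deriv (s11 u qm qp) (κ j)) → ∀ x : ℝ,
        -- analyticity of `M` away from `Σ₊` and the points `κ j`
        (∀ a c, DifferentiableOn ℂ (fun k => M u qm qp x k a c)
          {k | k ∉ cutC qp ∧ ∀ j, k ≠ κ j}) ∧
        -- the jump of `M`
        (∀ s : ℝ, qp < |s| →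
          HasAbove (M u qm qp x) s ∧ HasBelow (M u qm qp x) s ∧
          above (M u qm qp x) s =
            below (M u qm qp x) s * (E qp s - 1) * (1 - V0 u qm qp x s)) ∧
        -- the residues of `M`
        (∀ j, Tendsto (fun k : ℂ => (k - κ j) • M u qm qp x k) (𝓝[≠] (κ j : ℂ))
          (𝓝 (resM u qm qp (C j) x (κ j)))) ∧
        -- the normalization and the jump of `N`
        (∀ a c, (fun k => (N u qm qp x k - 1) a c)
          =O[Bornology.cobounded ℂ ⊓ 𝓟 (cutC qp)ᶜ] fun k => k⁻¹) ∧
        (∀ s : ℝ, qp < |s| →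
          HasAbove (N u qm qp x) s ∧ HasBelow (N u qm qp x) s ∧ HasBelow (E qp) s ∧
          above (N u qm qp x) s = below (N u qm qp x) s * Vtilde u qm qp x s) ∧
        -- the Plemelj representations of `N` and `M`
        (∀ k : ℂ, k ∉ cutC qp → (∀ j, k ≠ κ j) →
          (∀ a c, IntegrableOn (fun s : ℝ =>
            (below (N u qm qp x) s * (1 - Vtilde u qm qp x s)) a c / (s - k)) (cut qp)) ∧
          N u qm qp x k = 1
            + ∑ j, (1 / (k - κ j)) • (resM u qm qp (C j) x (κ j) * (E qp (κ j))⁻¹)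
            - (1 / (2 * Real.pi * I)) • Matrix.of fun a c => ∫ s in cut qp,
              (below (N u qm qp x) s * (1 - Vtilde u qm qp x s)) a c / (s - k)) ∧
        (∀ k : ℂ, k ∉ cutC qp → (∀ j, k ≠ κ j) →
          (∀ a c, IntegrableOn (fun s : ℝ => (below (M u qm qp x) s * (E qp s - 1)
            * V0 u qm qp x s * (E qp s)⁻¹) a c / (s - k)) (cut qp)) ∧
          M u qm qp x k = E qp k
            + ∑ j, (1 / (k - κ j)) •
              (resM u qm qp (C j) x (κ j) * (E qp (κ j))⁻¹ * E qp k)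
            - (1 / (2 * Real.pi * I)) • ((Matrix.of fun a c => ∫ s in cut qp,
              (below (M u qm qp x) s * (E qp s - 1)
                * V0 u qm qp x s * (E qp s)⁻¹) a c / (s - k)) * E qp k)) ∧
        -- the reconstruction formula
        IntegrableOn (recIntegrand u qm qp x) (cut qp) ∧
        (q x t : ℂ) =
          qp * (1 + ∑ j, C j * exp (I * (lam qp (κ j) + lam qm (κ j)) * x)
            * M u qm qp x (κ j) 0 1 / lam qp (κ j))
          + I / (2 * Real.pi) * ∫ s in cut qp, recIntegrand u qm qp x s := by
  have hs0 := hq.isSmoothStep hqp hqm ht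
  subst hu
  set u : ℝ → ℝ := fun x => q x t with hu
  have h0 := hs0.isStep
  have hspec : IsSpectrum u qm qp κ := ⟨hsing, hκ, hzero, hsimple⟩
  choose b hb using fun j => h0.exists_smul_of_jostWr_eq_zero (hspec.jostWr_eq_zero hqp j)
  refine ⟨b, hb, fun C hC x => ?_⟩
  have hn : IsNorming u qm qp κ b C := ⟨hb, hC⟩
  have hW : ∀ s : ℝ, qp < |s| → jostWr u qm qp s ≠ 0 := fun s hs => hspec.sing s hs.le
  -- both integrands agree with the jump of `N` except at the two branch points
  have hae : ∀ᵐ s : ℝ ∂volume.restrict (cut qp), qp < |s| := ae_lt_abs_restrict_cut qp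
  have hN : ∀ k : ℂ, ∀ a c, (fun s : ℝ =>
      (below (N u qm qp x) s * (1 - Vtilde u qm qp x s)) a c / (s - k)) =ᵐ[volume.restrict (cut qp)]
        fun s => jumpN u qm qp x s a c / (s - k) := fun k a c => by
    filter_upwards [hae] with s hs
    rw [h0.below_N_mul_one_sub hs (hW s hs)]
  have hM : ∀ k : ℂ, ∀ a c, (fun s : ℝ => (below (M u qm qp x) s * (E qp s - 1)
      * V0 u qm qp x s * (E qp s)⁻¹) a c / (s - k)) =ᵐ[volume.restrict (cut qp)]
        fun s => jumpN u qm qp x s a c / (s - k) := fun k a c => by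
    filter_upwards [hae] with s hs
    rw [h0.below_M_mul_V0 hs (hW s hs)]
  have hrepr : ∀ k : ℂ, k ∉ cutC qp → (∀ j, k ≠ κ j) → N u qm qp x k = 1
      + ∑ j, (1 / (k - κ j)) • (resM u qm qp (C j) x (κ j) * (E qp (κ j))⁻¹)
      - (1 / (2 * Real.pi * I)) • Matrix.of fun a c =>
        ∫ s in cut qp, jumpN u qm qp x s a c / (s - k) := fun k hk hne => by
    ext a c
    rw [N_apply_eq hspec hn x hs0 hk hne]
    simp [Matrix.sum_apply, resN]
  have hrec : ∀ᵐ s : ℝ ∂volume.restrict (cut qp),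
      recIntegrand u qm qp x s = 2 * I * jumpN u qm qp x s 0 1 := by
    filter_upwards [hae] with s hs
    rw [h0.jumpN_zero_one hs (hW s hs)]
    linear_combination recIntegrand u qm qp x s * I_sq
  refine ⟨fun a c k hk => (h0.differentiableAt_M x hk.1 (hspec.jostWr_ne_zero h0 hk.2)
      a c).differentiableWithinAt, fun s hs => ⟨⟨_, h0.tendsto_M_above (hW s hs) x⟩,
      ⟨_, h0.tendsto_M_below hs (hW s hs) x⟩, h0.above_M_eq hs (hW s hs) x⟩,
    fun j => hspec.tendsto_residue_M h0 j (hb j) (hC j) x, hs0.isBigO_N x,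
    fun s hs => ⟨⟨_, h0.tendsto_N_above hs (hW s hs) x⟩, ⟨_, h0.tendsto_N_below hs (hW s hs) x⟩,
      ⟨_, tendsto_E_below hqp hs.le⟩, ?_⟩, fun k hk hne => ⟨fun a c => ?_, ?_⟩,
    fun k hk hne => ⟨fun a c => ?_, ?_⟩, ?_, ?_⟩
  · rw [h0.below_N_mul_Vtilde hs (hW s hs), h0.above_N hs (hW s hs)]
  · exact (plemelj hspec hn x hs0 hk hne a c).1.congr (hN k a c).symm
  · rw [hrepr k hk hne]
    simp only [integral_congr_ae (hN k _ _)]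
  · exact (plemelj hspec hn x hs0 hk hne a c).1.congr (hM k a c).symm
  · rw [h0.M_eq_N_mul x (lam_ne_zero hk), hrepr k hk hne]
    simp only [integral_congr_ae (hM k _ _)]
    rw [sub_mul, add_mul, one_mul, Finset.sum_mul]
    simp only [Matrix.smul_mul]
  · exact ((integrableOn_jumpN_zero_one hspec hn x hs0).const_mul (2 * I)).congr
      (hrec.mono fun s hs => hs.symm)
  · have h1 := hs0.reconstruction hspec hn x
    have hl : ∀ j, lam qp (κ j) ≠ 0 := fun j => lam_ne_zero (hspec.notMem j)
    simp only [resN_zero_one hqp _ x _ (hl _), ← Finset.mul_sum] at h1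
    rw [integral_congr_ae hrec, integral_const_mul]
    have hpi : (Real.pi : ℂ) ≠ 0 := ofReal_ne_zero.2 Real.pi_ne_zero
    change (u x : ℂ) = _
    set X := ∫ s in cut qp, jumpN u qm qp x s 0 1
    set Y := ∑ j, C j * exp (I * (lam qp (κ j) + lam qm (κ j)) * x)
            * M u qm qp x (κ j) 0 1 / lam qp (κ j)
    field_simp at h1 ⊢
    rw [I_sq] at h1
    linear_combination -h1 - X * I_sq
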